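/- **Gap labeling.** Let $p\in(0,1)$, $\beta\in\mathbb R$, $n\ge 1$ and $k\in\{0,\dots,3^n-1\}$. For $x\in\mathbb Z_+=\{0,1,2,\dots\}$ let $p(0,1)=1$ and, for $x\ge1$ with $3^{m(x)}$ the largest power of $3$ dividing $x$, let $p(x,x-1)=1-p,\ p(x,x+1)=p$ if $3^{-m(x)}x\equiv1 \pmod 3$, and $p(x,x-1)=p,\ p(x,x+1)=1-p$ if $3^{-m(x)}x\equiv2\pmod 3$; let $p(x,y)=0$ for all other $x\neq y$. Let $\pi\neq0$ be a $\sigma$-finite measure on $\mathbb Z_+$ with $\pi(x)p(x,y)=\pi(y)p(y,x)$ for all $x\ne y$. On $\ell^2(\mathbb Z_+,d\pi)$ consider the bounded operators $$(\Delta_pf)(x)=f(x)-\sum_{y=x\pm1,\,y\ge0}p(x,y)f(y),\qquad (H_{p,\beta,\alpha,\theta}f)(x)=\beta\cos(2\pi\alpha x+\theta)f(x)-\sum_{y=x\pm1,\,y\ge0}p(x,y)f(y)$$ (in the cosine, $\pi$ is the number). For $l\ge0$ let $\Delta_p^{(l)}$ and $H^{(l)}_{p,\beta,\alpha,\theta}$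 be their truncations to $\{0,\dots,3^l\}$ with reflecting boundary condition at $3^l$, i.e. the $(3^l+1)\times(3^l+1)$ matrices with the same entries, except that in the row of $3^l$ the entry in column $3^l-1$ is $-1$. Then the normalized eigenvalue counting measures $$\frac1{3^l+1}\sum_{\lambda\in\sigma(\Delta_p^{(l)})}\delta_\lambda,\qquad \frac1{3^l+1}\sum_{\lambda\in\sigma(H^{(l)}_{p,\beta,k/3^n,0})}\delta_\lambda$$ converge weakly, as $l\to\infty$, to probability measures on $\mathbb R$ (the densities of states of $\Delta_p$ and $H_{p,\beta,k/3^n,0}$). For $T=\Delta_p$ or $T=H_{p,\beta,k/3^n,0}$ with density of states $\nu_T$, let $N_T(x)=\nu_T((-\infty,x])$ be the integrated density of states and let $$\mathcal{GL}(T)=\{N_T(x) : x\in\mathbb R,\ x \text{ in the resolvent set of } T\}$$ be the set of spectral gap labels of $T$. One has $$\mathcal{GL}(H_{p,\beta,k/3^n,0})\subset\Big\{\frac{j}{3^n}+\frac1{3^n}g \ :\ j\in\{0,1,\dots,3^n-1\},\ g\in\mathcal{GL}(\Delta_p)\Big\},$$ where $\mathcal{GL}(\Delta_{1/2})=\{0,1\}$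 and, for $p\neq\frac12$, $$\mathcal{GL}(\Delta_p)=\Big\{\frac{j}{3^i} \ :\ i\in\mathbb N,\ j\in\{0,1,\dots,3^i\}\Big\}.$$ -/

import Mathlib

open MeasureTheory Filter Topology
open scoped ENNReal BoundedContinuousFunction

noncomputable section

namespace SelfSimilarAMO

/-! ### Transition probabilities -/

/-- The probability `p(x, x+1)` of a step to the right. Here `padicValNat 3 x` is the largest
`m` such that `3 ^ m` divides `x` (for `x ≠ 0`), and `3^{-m} x` is `1` or `2` modulo `3`. -/
def stepRight (p : ℝ) (x : ℕ) : ℝ :=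
  if x = 0 then 1 else if x / 3 ^ padicValNat 3 x % 3 = 1 then p else 1 - p

/-- The probability `p(x, x-1)` of a step to the left; there is no such step from `0`. -/
def stepLeft (p : ℝ) (x : ℕ) : ℝ :=
  if x = 0 then 0 else if x / 3 ^ padicValNat 3 x % 3 = 1 then 1 - p else p

/-- The transition probabilities `p(x, y)`, `x ≠ y`, of the nearest neighbour random walk on the
half-line `{0, 1, 2, …}`. -/
def trans (p : ℝ) (x y : ℕ) : ℝ :=
  if y = x + 1 then stepRight p x else if x = y + 1 then stepLeft p x else 0

/-- A nonzero measure on the half-line satisfying the reversibility condition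
`π(x) p(x, y) = π(y) p(y, x)`. -/
structure IsReversible (p : ℝ) (π : Measure ℕ) : Prop where
  ne_zero : π ≠ 0
  balance : ∀ x y : ℕ,
    π {x} * ENNReal.ofReal (trans p x y) = π {y} * ENNReal.ofReal (trans p y x)

/-! ### The operators on the half-line -/

/-- The action on sequences of the Jacobi operator with diagonal `v` and off-diagonal entries
`-p(x, y)`:
`(J f)(x) = v(x) f(x) - p(x, x-1) f(x-1) - p(x, x+1) f(x+1)`. -/
def act (p : ℝ) (v : ℕ → ℝ) (f : ℕ → ℂ) (x : ℕ) : ℂ :=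
  (v x : ℂ) * f x - (stepLeft p x : ℂ) * f (x - 1) - (stepRight p x : ℂ) * f (x + 1)

/-- The almost Mathieu potential `x ↦ β cos (2 π α x + θ)`. -/
def potential (β α θ : ℝ) (x : ℕ) : ℝ := β * Real.cos (2 * Real.pi * α * x + θ)

lemma stepRight_pos {p : ℝ} (hp : p ∈ Set.Ioo (0 : ℝ) 1) (x : ℕ) : 0 < stepRight p x := by
  obtain ⟨h0, h1⟩ := hp
  unfold stepRight; split_ifs <;> linarith

lemma stepRight_le {p : ℝ} (hp : p ∈ Set.Ioo (0 : ℝ) 1) (x : ℕ) : stepRight p x ≤ 1 := by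
  obtain ⟨h0, h1⟩ := hp
  unfold stepRight; split_ifs <;> linarith

lemma stepLeft_pos {p : ℝ} (hp : p ∈ Set.Ioo (0 : ℝ) 1) (x : ℕ) : 0 < stepLeft p (x + 1) := by
  obtain ⟨h0, h1⟩ := hp
  unfold stepLeft
  rw [if_neg (Nat.succ_ne_zero x)]
  split_ifs <;> linarith

lemma stepLeft_le {p : ℝ} (hp : p ∈ Set.Ioo (0 : ℝ) 1) (x : ℕ) : stepLeft p x ≤ 1 := by
  obtain ⟨h0, h1⟩ := hp
  unfold stepLeft; split_ifs <;> linarith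

lemma IsReversible.balance_succ {p : ℝ} {π : Measure ℕ} (h : IsReversible p π) (x : ℕ) :
    π {x} * ENNReal.ofReal (stepRight p x) = π {x + 1} * ENNReal.ofReal (stepLeft p (x + 1)) := by
  have := h.balance x (x + 1)
  have hx : x ≠ x + 1 + 1 := by omega
  simpa [trans, hx] using this

lemma IsReversible.singleton_ne_zero {p : ℝ} (hp : p ∈ Set.Ioo (0 : ℝ) 1) {π : Measure ℕ}
    (h : IsReversible p π) (x : ℕ) : π {x} ≠ 0 := by
  have key : ∀ y, π {y} = 0 ↔ π {y + 1} = 0 := by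
    intro y
    have hb := h.balance_succ y
    have hr : ENNReal.ofReal (stepRight p y) ≠ 0 := by
      simpa using stepRight_pos hp y
    have hl : ENNReal.ofReal (stepLeft p (y + 1)) ≠ 0 := by
      simpa using stepLeft_pos hp y
    constructor
    · intro h0
      rw [h0, zero_mul] at hb
      exact (mul_eq_zero.mp hb.symm).resolve_right hl
    · intro h0
      rw [h0, zero_mul] at hb
      exact (mul_eq_zero.mp hb).resolve_right hr
  have all : ∀ y, π {y} = 0 ↔ π {0} = 0 := by
    intro y
    induction y with
    | zero => rfl
    | succ y ih => rw [← key y, ih]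
  intro hx
  apply h.ne_zero
  have h0 := (all x).mp hx
  rw [← Measure.measure_univ_eq_zero, ← Set.iUnion_of_singleton, measure_iUnion_null_iff]
  exact fun y => (all y).mpr h0

lemma IsReversible.eq_of_ae {p : ℝ} (hp : p ∈ Set.Ioo (0 : ℝ) 1) {π : Measure ℕ}
    (h : IsReversible p π) {f g : ℕ → ℂ} (hfg : f =ᵐ[π] g) : f = g := by
  funext x
  by_contra hx
  refine h.singleton_ne_zero hp x (measure_mono_null ?_ (ae_iff.mp hfg))
  rintro y rfl
  exact hx

lemma eLpNorm_two (π : Measure ℕ) (f : ℕ → ℂ) :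
    eLpNorm f 2 π = (∑' x, ‖f x‖ₑ ^ (2 : ℝ) * π {x}) ^ (1 / 2 : ℝ) := by
  rw [eLpNorm_eq_lintegral_rpow_enorm_toReal (by norm_num) (by norm_num), lintegral_countable']
  norm_num

lemma sq_mul_le {a : ℝ} (h0 : 0 ≤ a) (h1 : a ≤ 1) (z : ℂ) :
    ‖(a : ℂ) * z‖ₑ ^ (2 : ℝ) ≤ ENNReal.ofReal a * ‖z‖ₑ ^ (2 : ℝ) := by
  rw [enorm_mul, ENNReal.mul_rpow_of_nonneg _ _ (by norm_num)]
  gcongr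
  have : ‖(a : ℂ)‖ₑ = ENNReal.ofReal a := by
    rw [← ofReal_norm, Complex.norm_real, Real.norm_of_nonneg h0]
  rw [this]
  have h1' : ENNReal.ofReal a ≤ 1 := by simpa using h1
  calc ENNReal.ofReal a ^ (2 : ℝ) ≤ ENNReal.ofReal a ^ (1 : ℝ) :=
        ENNReal.rpow_le_rpow_of_exponent_ge h1' (by norm_num)
    _ = _ := ENNReal.rpow_one _

lemma eLpNorm_right {p : ℝ} (hp : p ∈ Set.Ioo (0 : ℝ) 1) {π : Measure ℕ}
    (h : IsReversible p π) (f : ℕ → ℂ) :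
    eLpNorm (fun x => (stepRight p x : ℂ) * f (x + 1)) 2 π ≤ eLpNorm f 2 π := by
  rw [eLpNorm_two, eLpNorm_two]
  gcongr ?_ ^ _
  rw [tsum_eq_zero_add' (f := fun x => ‖f x‖ₑ ^ (2 : ℝ) * π {x}) ENNReal.summable]
  refine le_trans (ENNReal.tsum_le_tsum fun x => ?_) le_add_self
  calc _ ≤ ENNReal.ofReal (stepRight p x) * ‖f (x + 1)‖ₑ ^ (2 : ℝ) * π {x} := by
        gcongr
        exact sq_mul_le (stepRight_pos hp x).le (stepRight_le hp x) _
    _ = ‖f (x + 1)‖ₑ ^ (2 : ℝ) * (π {x + 1} * ENNReal.ofReal (stepLeft p (x + 1))) := by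
        rw [← h.balance_succ]; ring
    _ ≤ ‖f (x + 1)‖ₑ ^ (2 : ℝ) * (π {x + 1} * 1) := by
        gcongr
        simpa using stepLeft_le hp (x + 1)
    _ = _ := by rw [mul_one]

lemma eLpNorm_left {p : ℝ} (hp : p ∈ Set.Ioo (0 : ℝ) 1) {π : Measure ℕ}
    (h : IsReversible p π) (f : ℕ → ℂ) :
    eLpNorm (fun x => (stepLeft p x : ℂ) * f (x - 1)) 2 π ≤ eLpNorm f 2 π := by
  rw [eLpNorm_two, eLpNorm_two]
  gcongr ?_ ^ _
  rw [tsum_eq_zero_add' ENNReal.summable]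
  have h0 : stepLeft p 0 = 0 := by simp [stepLeft]
  simp only [h0, Complex.ofReal_zero, zero_mul, enorm_zero, add_tsub_cancel_right]
  rw [ENNReal.zero_rpow_of_pos (by norm_num), zero_mul, zero_add]
  refine ENNReal.tsum_le_tsum fun x => ?_
  calc _ ≤ ENNReal.ofReal (stepLeft p (x + 1)) * ‖f x‖ₑ ^ (2 : ℝ) * π {x + 1} := by
        gcongr
        exact sq_mul_le (stepLeft_pos hp x).le (stepLeft_le hp _) _
    _ = ‖f x‖ₑ ^ (2 : ℝ) * (π {x} * ENNReal.ofReal (stepRight p x)) := by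
        rw [h.balance_succ]; ring
    _ ≤ ‖f x‖ₑ ^ (2 : ℝ) * (π {x} * 1) := by
        gcongr
        simpa using stepRight_le hp x
    _ = _ := by rw [mul_one]

lemma eLpNorm_diag {v : ℕ → ℝ} {C : ℝ} (hC : ∀ x, |v x| ≤ C) (π : Measure ℕ) (f : ℕ → ℂ) :
    eLpNorm (fun x => (v x : ℂ) * f x) 2 π ≤ ENNReal.ofReal C * eLpNorm f 2 π := by
  refine eLpNorm_le_mul_eLpNorm_of_ae_le_mul (Eventually.of_forall fun x => ?_) 2
  rw [norm_mul, Complex.norm_real, Real.norm_eq_abs]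
  gcongr
  exact hC x

lemma eLpNorm_act {p : ℝ} (hp : p ∈ Set.Ioo (0 : ℝ) 1) {π : Measure ℕ}
    (h : IsReversible p π) {v : ℕ → ℝ} {C : ℝ} (hC : ∀ x, |v x| ≤ C) (f : ℕ → ℂ) :
    eLpNorm (act p v f) 2 π ≤ ENNReal.ofReal (C + 2) * eLpNorm f 2 π := by
  have hC0 : 0 ≤ C := (abs_nonneg _).trans (hC 0)
  have m : ∀ g : ℕ → ℂ, AEStronglyMeasurable g π := fun g =>
    (measurable_of_countable g).aestronglyMeasurable
  have e : act p v f = ((fun x => (v x : ℂ) * f x) - fun x => (stepLeft p x : ℂ) * f (x - 1))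
      - fun x => (stepRight p x : ℂ) * f (x + 1) := rfl
  rw [e]
  calc _ ≤ eLpNorm ((fun x => (v x : ℂ) * f x) - fun x => (stepLeft p x : ℂ) * f (x - 1)) 2 π
          + eLpNorm (fun x => (stepRight p x : ℂ) * f (x + 1)) 2 π :=
        eLpNorm_sub_le (m _) (m _) (by norm_num)
    _ ≤ (eLpNorm (fun x => (v x : ℂ) * f x) 2 π
          + eLpNorm (fun x => (stepLeft p x : ℂ) * f (x - 1)) 2 π)
          + eLpNorm (fun x => (stepRight p x : ℂ) * f (x + 1)) 2 π := by
        gcongr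
        exact eLpNorm_sub_le (m _) (m _) (by norm_num)
    _ ≤ (ENNReal.ofReal C * eLpNorm f 2 π + eLpNorm f 2 π) + eLpNorm f 2 π := by
        gcongr
        · exact eLpNorm_diag hC π f
        · exact eLpNorm_left hp h f
        · exact eLpNorm_right hp h f
    _ = _ := by
        rw [ENNReal.ofReal_add hC0 (by norm_num)]
        norm_num
        ring

lemma memLp_act {p : ℝ} (hp : p ∈ Set.Ioo (0 : ℝ) 1) {π : Measure ℕ}
    (h : IsReversible p π) {v : ℕ → ℝ} (hv : ∃ C, ∀ x, |v x| ≤ C) (f : Lp ℂ 2 π) :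
    MemLp (act p v f) 2 π := by
  obtain ⟨C, hC⟩ := hv
  refine ⟨(measurable_of_countable _).aestronglyMeasurable, (eLpNorm_act hp h hC f).trans_lt ?_⟩
  exact ENNReal.mul_lt_top ENNReal.ofReal_lt_top (Lp.eLpNorm_lt_top f)

/-- The bounded Jacobi operator `act p v` on the Hilbert space `ℓ²(ℤ₊, dπ)`, for a bounded
diagonal `v`. -/
def jacobiOp {p : ℝ} (hp : p ∈ Set.Ioo (0 : ℝ) 1) {π : Measure ℕ} (hπ : IsReversible p π)
    (v : ℕ → ℝ) (hv : ∃ C, ∀ x, |v x| ≤ C) : Lp ℂ 2 π →L[ℂ] Lp ℂ 2 π :=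
  LinearMap.mkContinuousOfExistsBound
    { toFun := fun f => (memLp_act hp hπ hv f).toLp (act p v f)
      map_add' := by
        intro f g
        rw [← MemLp.toLp_add, MemLp.toLp_eq_toLp_iff,
          hπ.eq_of_ae hp (Lp.coeFn_add f g)]
        refine Eventually.of_forall fun x => ?_
        simp only [act, Pi.add_apply]
        ring
      map_smul' := by
        intro c f
        rw [RingHom.id_apply, ← MemLp.toLp_const_smul, MemLp.toLp_eq_toLp_iff,
          hπ.eq_of_ae hp (Lp.coeFn_smul c f)]
        refine Eventually.of_forall fun x => ?_
        simp only [act, Pi.smul_apply, smul_eq_mul]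
        ring }
    (by
      obtain ⟨C, hC⟩ := hv
      have hC0 : 0 ≤ C := (abs_nonneg _).trans (hC 0)
      refine ⟨C + 2, fun f => ?_⟩
      simp only [LinearMap.coe_mk, AddHom.coe_mk, Lp.norm_toLp]
      rw [Lp.norm_def]
      refine (ENNReal.toReal_mono ?_ (eLpNorm_act hp hπ hC f)).trans_eq ?_
      · exact ENNReal.mul_ne_top ENNReal.ofReal_ne_top (Lp.eLpNorm_ne_top f)
      · rw [ENNReal.toReal_mul, ENNReal.toReal_ofReal (by linarith)])

/-- The self-similar Laplacian `Δ_p` on `ℓ²(ℤ₊, dπ)`. -/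
def laplacian {p : ℝ} (hp : p ∈ Set.Ioo (0 : ℝ) 1) {π : Measure ℕ} (hπ : IsReversible p π) :
    Lp ℂ 2 π →L[ℂ] Lp ℂ 2 π :=
  jacobiOp hp hπ (fun _ => 1) ⟨1, fun _ => by simp⟩

/-- The self-similar almost Mathieu operator `H_{p,β,α,θ}` on `ℓ²(ℤ₊, dπ)`. -/
def almostMathieu {p : ℝ} (hp : p ∈ Set.Ioo (0 : ℝ) 1) {π : Measure ℕ} (hπ : IsReversible p π)
    (β α θ : ℝ) : Lp ℂ 2 π →L[ℂ] Lp ℂ 2 π :=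
  jacobiOp hp hπ (potential β α θ) ⟨|β|, fun x => by
    rw [potential, abs_mul]
    exact mul_le_of_le_one_right (abs_nonneg _) (Real.abs_cos_le_one _)⟩

/-! ### Finite truncations and the density of states -/

/-- The truncation to the vertices `{0, …, 3^l}` of the Jacobi matrix with diagonal `v`, with
reflection at both boundary vertices `0` and `3^l`. -/
def truncation (p : ℝ) (v : ℕ → ℝ) (l : ℕ) : Matrix (Fin (3 ^ l + 1)) (Fin (3 ^ l + 1)) ℝ :=
  fun x y =>
    if x = y then v x
    else if (x : ℕ) = 3 ^ l then (if (y : ℕ) + 1 = 3 ^ l then -1 else 0)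
    else -trans p x y

/-- The level `l` Laplacian `Δ_p^{(l)}`. -/
def finiteLaplacian (p : ℝ) (l : ℕ) : Matrix (Fin (3 ^ l + 1)) (Fin (3 ^ l + 1)) ℝ :=
  truncation p (fun _ => 1) l

/-- The level `l` almost Mathieu operator `H_{p,β,α,θ}^{(l)}`. -/
def finiteAlmostMathieu (p β α θ : ℝ) (l : ℕ) :
    Matrix (Fin (3 ^ l + 1)) (Fin (3 ^ l + 1)) ℝ :=
  truncation p (potential β α θ) l

/-- The normalized sum of Dirac masses at the eigenvalues of a matrix `M` of level `l`. -/
def finiteDensity {l : ℕ} (M : Matrix (Fin (3 ^ l + 1)) (Fin (3 ^ l + 1)) ℝ) : Measure ℝ :=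
  ((3 : ℝ≥0∞) ^ l + 1)⁻¹ • Measure.sum fun lam : spectrum ℝ M => Measure.dirac (lam : ℝ)

/-- `ν` is the density of states of the operator with finite truncations `M l`: it is the
probability measure to which the normalized eigenvalue counting measures converge weakly
(such a limit is unique). -/
structure IsDensityOfStates (M : ∀ l : ℕ, Matrix (Fin (3 ^ l + 1)) (Fin (3 ^ l + 1)) ℝ)
    (ν : Measure ℝ) : Prop where
  isProbabilityMeasure : IsProbabilityMeasure ν
  tendsto : ∀ f : ℝ →ᵇ ℝ,
    Tendsto (fun l => ∫ t, f t ∂finiteDensity (M l)) atTop (𝓝 (∫ t, f t ∂ν))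

/-- The set of spectral gap labels of an operator `T` with density of states `ν`: the values of the
integrated density of states `N(x) = ν((-∞, x])` at the real points of the resolvent set. -/
def gapLabels {E : Type*} [NormedAddCommGroup E] [NormedSpace ℂ E] (T : E →L[ℂ] E)
    (ν : Measure ℝ) : Set ℝ :=
  {N | ∃ x : ℝ, (x : ℂ) ∈ resolventSet ℂ T ∧ N = ν.real (Set.Iic x)}

end SelfSimilarAMO

end

namespace SelfSimilarAMO

open Polynomial

noncomputable section

/-! ### Self-similarity of the transition probabilities -/

/-! Put `s = -E` and let `phi p v x`, a polynomial of degree `x` in `s`, be the solution of the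
eigenvalue equation that starts from the reflecting condition at `0`. The step probabilities depend
only on the lowest nonzero ternary digit, so all blocks of length `3 ^ m` look alike inside, and
reversing a block exchanges left and right steps. The potential with frequency `k / 3 ^ n` and phase
`0` respects these symmetries for `m ≥ n`. Eliminating block interiors, `phi_pow_mul` shows that the
solution read at multiples of `3 ^ m` solves the recurrence with zero diagonal at spectral parameter
`Q_m = phi p v (3 ^ m)`. Hence `Q_{m+1} = T ∘ Q_m` with `q T(w) = w (w ^ 2 - 1 + q)`, `q = p (1 -
p)`, and everything is read off the orbit of `Q_n(s)` under this cubic. Once `|w| > 1`, the orbit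
escapes to infinity.

Counting: `dirichlet_mul_charFun` factors the decimated characteristic polynomial, and a flux
argument makes all the roots real. For real-rooted `Q_m - W` and `Q_m - 1` the root counts on a
half-line differ by at most one, because the derivatives agree; they are equal where `|Q_m| > 1`,
because the parities agree too. So the distribution functions of the truncations converge uniformly,
and on an escaping energy the integrated density of states is an integer divided by `3 ^ m`
(`exists_isDensityOfStates`).

Resolvent set implies escape: a bounded orbit has zeros of some `Q_m` arbitrarily close by, since
the cubic expands the metric `dw / √(1 - w ^ 2)` by at least `3` (`exists_zero_near`). At such a
zero the solution grows at most polynomially, so its cut-offs contradict a resolvent bound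
(`not_mem_resolventSet_of_zero`). For the Laplacian the converse holds as well: an escaping orbit
eventually exceeds the norm of the Markov operator, and solvability is pulled back along the cubic
(`mem_resolventSet_laplacian`).

Gaps: for `p ≠ 1/2` the critical values of the iterated cubic lie outside `[-1, 1]`, so every label
`j / 3 ^ m` is attained by the Laplacian. For `p = 1/2` the cubic is the Chebyshev polynomial `4 w ^
3 - 3 w`, which preserves `[-1, 1]`, so only the labels of the initial level occur. The inclusion
for the almost Mathieu operator is then division with remainder of a root count by `3 ^ d`. -/

lemma pow_mul_div_padicValNat_mod (a : ℕ) {c : ℕ} (hc : c % 3 ≠ 0) :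
    3 ^ a * c / 3 ^ padicValNat 3 (3 ^ a * c) % 3 = c % 3 := by
  have : Fact (Nat.Prime 3) := ⟨Nat.prime_three⟩
  have hc0 : c ≠ 0 := by rintro rfl; simp at hc
  have h0 : padicValNat 3 c = 0 :=
    padicValNat.eq_zero_of_not_dvd fun h => hc (Nat.mod_eq_zero_of_dvd h)
  have h1 : padicValNat 3 (3 ^ a * c) = a := by
    rw [padicValNat.mul (by positivity) hc0, padicValNat.prime_pow, h0, add_zero]
  rw [h1, Nat.mul_div_cancel_left _ (by positivity)]

lemma stepRight_pow_mul (p : ℝ) (a : ℕ) {c : ℕ} (hc : c % 3 ≠ 0) :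
    stepRight p (3 ^ a * c) = if c % 3 = 1 then p else 1 - p := by
  have h : 3 ^ a * c ≠ 0 := mul_ne_zero (by positivity) (by rintro rfl; simp at hc)
  rw [stepRight, if_neg h, pow_mul_div_padicValNat_mod a hc]

lemma stepLeft_pow_mul (p : ℝ) (a : ℕ) {c : ℕ} (hc : c % 3 ≠ 0) :
    stepLeft p (3 ^ a * c) = if c % 3 = 1 then 1 - p else p := by
  have h : 3 ^ a * c ≠ 0 := mul_ne_zero (by positivity) (by rintro rfl; simp at hc)
  rw [stepLeft, if_neg h, pow_mul_div_padicValNat_mod a hc]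

lemma exists_eq_pow_mul {x : ℕ} (hx : x ≠ 0) : ∃ a c : ℕ, c % 3 ≠ 0 ∧ x = 3 ^ a * c := by
  obtain ⟨a, c, hc, h⟩ := Nat.exists_eq_pow_mul_and_not_dvd hx 3 (by norm_num)
  exact ⟨a, c, fun h' => hc (Nat.dvd_of_mod_eq_zero h'), h⟩

lemma stepRight_pow_mul_self (p : ℝ) (m x : ℕ) : stepRight p (3 ^ m * x) = stepRight p x := by
  rcases eq_or_ne x 0 with rfl | hx
  · simp
  obtain ⟨a, c, hc, rfl⟩ := exists_eq_pow_mul hx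
  rw [← mul_assoc, ← pow_add, stepRight_pow_mul p _ hc, stepRight_pow_mul p _ hc]

lemma stepLeft_pow_mul_self (p : ℝ) (m x : ℕ) : stepLeft p (3 ^ m * x) = stepLeft p x := by
  rcases eq_or_ne x 0 with rfl | hx
  · simp
  obtain ⟨a, c, hc, rfl⟩ := exists_eq_pow_mul hx
  rw [← mul_assoc, ← pow_add, stepLeft_pow_mul p _ hc, stepLeft_pow_mul p _ hc]

lemma stepLeft_add_stepRight (p : ℝ) (x : ℕ) : stepLeft p x + stepRight p x = 1 := by
  unfold stepLeft stepRight
  split_ifs <;> ring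

/-- The lowest nonzero ternary digit of `i` sits below position `m`. Adding a multiple of `3 ^ m`
keeps it, while subtracting `i` from such a multiple negates it modulo `3`, which exchanges the
digits `1` and `2`. -/
lemma exists_digit_decomposition (m x : ℕ) {i : ℕ} (h0 : 0 < i) (hi : i < 3 ^ m) :
    ∃ a c d e : ℕ, c % 3 ≠ 0 ∧ d % 3 = c % 3 ∧ (e + c) % 3 = 0 ∧ i = 3 ^ a * c ∧
      3 ^ m * x + i = 3 ^ a * d ∧ 3 ^ m * (x + 1) - i = 3 ^ a * e := by
  obtain ⟨a, c, hc, rfl⟩ := exists_eq_pow_mul h0.ne'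
  have hc0 : c ≠ 0 := by rintro rfl; simp at hc
  have ham : a < m := by
    by_contra h
    have h1 : 3 ^ m ≤ 3 ^ a := Nat.pow_le_pow_right (by norm_num) (not_lt.mp h)
    have h2 : 3 ^ a ≤ 3 ^ a * c := Nat.le_mul_of_pos_right _ (Nat.pos_of_ne_zero hc0)
    omega
  obtain ⟨b, rfl⟩ : ∃ b, m = a + (b + 1) := ⟨m - a - 1, by omega⟩
  have hcb : c < 3 ^ (b + 1) := by
    rw [pow_add 3 a (b + 1)] at hi
    exact Nat.lt_of_mul_lt_mul_left hi
  have hb : 3 ^ (b + 1) * (x + 1) = 3 * (3 ^ b * (x + 1)) := by ring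
  have hle : c ≤ 3 ^ (b + 1) * (x + 1) := by nlinarith
  refine ⟨a, c, 3 * (3 ^ b * x) + c, 3 ^ (b + 1) * (x + 1) - c, hc, by omega, by omega, rfl,
    by ring, ?_⟩
  rw [Nat.mul_sub, pow_add 3 a (b + 1), mul_assoc]

lemma stepRight_block (p : ℝ) (m x : ℕ) {i : ℕ} (h0 : 0 < i) (hi : i < 3 ^ m) :
    stepRight p (3 ^ m * x + i) = stepRight p i := by
  obtain ⟨a, c, d, e, hc, hd, -, rfl, h1, -⟩ := exists_digit_decomposition m x h0 hi
  rw [h1, stepRight_pow_mul p _ hc, stepRight_pow_mul p _ (hd ▸ hc), hd]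

lemma stepLeft_block (p : ℝ) (m x : ℕ) {i : ℕ} (h0 : 0 < i) (hi : i < 3 ^ m) :
    stepLeft p (3 ^ m * x + i) = stepLeft p i := by
  obtain ⟨a, c, d, e, hc, hd, -, rfl, h1, -⟩ := exists_digit_decomposition m x h0 hi
  rw [h1, stepLeft_pow_mul p _ hc, stepLeft_pow_mul p _ (hd ▸ hc), hd]

/-- Exchanging the digits `1` and `2` exchanges the two step probabilities, which is why a reversed
block obeys the same recurrence. -/
lemma stepRight_block_reflect (p : ℝ) (m x : ℕ) {i : ℕ} (h0 : 0 < i) (hi : i < 3 ^ m) :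
    stepRight p (3 ^ m * (x + 1) - i) = stepLeft p i := by
  obtain ⟨a, c, d, e, hc, -, he, rfl, -, h1⟩ := exists_digit_decomposition m x h0 hi
  rw [h1, stepLeft_pow_mul p _ hc, stepRight_pow_mul p _ (by omega)]
  have : e % 3 = 1 ∧ c % 3 = 2 ∨ e % 3 = 2 ∧ c % 3 = 1 := by omega
  rcases this with ⟨h, h'⟩ | ⟨h, h'⟩ <;> simp [h, h']

lemma stepLeft_block_reflect (p : ℝ) (m x : ℕ) {i : ℕ} (h0 : 0 < i) (hi : i < 3 ^ m) :
    stepLeft p (3 ^ m * (x + 1) - i) = stepRight p i := by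
  have h := stepRight_block_reflect p m x h0 hi
  linarith [stepLeft_add_stepRight p i, stepLeft_add_stepRight p (3 ^ m * (x + 1) - i)]

/-! ### Solutions of the Jacobi recurrence as polynomials in the spectral parameter -/

/-- The solution of `p(x, x+1) f(x+1) = (X + v(x)) f(x) - p(x, x-1) f(x-1)`, `x ≥ 1`, with initial
values `f₀`, `f₁`; the indeterminate stands for minus the energy. -/
def sol (p : ℝ) (v : ℕ → ℝ) (f₀ f₁ : ℝ[X]) : ℕ → ℝ[X]
  | 0 => f₀
  | 1 => f₁
  | x + 2 => C (stepRight p (x + 1))⁻¹ * ((X + C (v (x + 1))) * sol p v f₀ f₁ (x + 1)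
      - C (stepLeft p (x + 1)) * sol p v f₀ f₁ x)

lemma C_stepRight_mul_sol {p : ℝ} (hp : p ∈ Set.Ioo (0 : ℝ) 1) (v : ℕ → ℝ) (f₀ f₁ : ℝ[X]) (x : ℕ) :
    C (stepRight p (x + 1)) * sol p v f₀ f₁ (x + 2)
      = (X + C (v (x + 1))) * sol p v f₀ f₁ (x + 1)
        - C (stepLeft p (x + 1)) * sol p v f₀ f₁ x := by
  rw [sol, ← mul_assoc, ← C_mul, mul_inv_cancel₀ (stepRight_pos hp _).ne', C_1, one_mul]

/-- The solution satisfying the reflecting boundary condition at `0`. -/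
def phi (p : ℝ) (v : ℕ → ℝ) : ℕ → ℝ[X] := sol p v 1 (X + C (v 0))

/-- The characteristic function of the truncation to `{0, …, 3 ^ l}`. -/
def charFun (p : ℝ) (v : ℕ → ℝ) (l : ℕ) : ℝ[X] :=
  (X + C (v 0)) * phi p v (3 ^ l) - phi p v (3 ^ l - 1)

/-- The characteristic function of the Dirichlet problem on `{0, …, 3 ^ m}`. -/
def dirichlet (p : ℝ) (v : ℕ → ℝ) (m : ℕ) : ℝ[X] := sol p v 0 1 (3 ^ m)

lemma phi_zero (p : ℝ) (v : ℕ → ℝ) : phi p v 0 = 1 := rfl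

lemma phi_one (p : ℝ) (v : ℕ → ℝ) : phi p v 1 = X + C (v 0) := rfl

lemma phi_rec {p : ℝ} (hp : p ∈ Set.Ioo (0 : ℝ) 1) (v : ℕ → ℝ) (x : ℕ) :
    C (stepRight p (x + 1)) * phi p v (x + 2)
      = (X + C (v (x + 1))) * phi p v (x + 1) - C (stepLeft p (x + 1)) * phi p v x :=
  C_stepRight_mul_sol hp v _ _ x

/-- The recurrence is assumed only at interior points of `{0, …, N}`, so that the lemma applies to a
solution read along a block in either direction. -/
lemma eq_sol_of_rec {p : ℝ} (hp : p ∈ Set.Ioo (0 : ℝ) 1) (v : ℕ → ℝ) {N : ℕ} {g : ℕ → ℝ[X]}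
    (hg : ∀ i, i + 1 < N → C (stepRight p (i + 1)) * g (i + 2)
      = (X + C (v (i + 1))) * g (i + 1) - C (stepLeft p (i + 1)) * g i) :
    ∀ i ≤ N, g i = sol p v 1 0 i * g 0 + sol p v 0 1 i * g 1 := by
  intro i
  induction i using Nat.strong_induction_on with
  | _ i ih =>
    intro hi
    match i, ih, hi with
    | 0, _, _ => simp [sol]
    | 1, _, _ => simp [sol]
    | i + 2, ih, hi =>
      have hR : (C (stepRight p (i + 1)) : ℝ[X]) ≠ 0 := C_ne_zero.mpr (stepRight_pos hp _).ne'
      apply mul_left_cancel₀ hR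
      rw [hg i (by omega), ih (i + 1) (by omega) (by omega), ih i (by omega) (by omega)]
      linear_combination -g 0 * C_stepRight_mul_sol hp v 1 0 i - g 1 * C_stepRight_mul_sol hp v 0 1 i

/-- The diagonal `v` consists of identical reflection symmetric blocks of length `3 ^ n`. -/
def BlockSymmetric (n : ℕ) (v : ℕ → ℝ) : Prop :=
  ∀ m, n ≤ m → ∀ x i, i ≤ 3 ^ m → v (3 ^ m * x + i) = v i ∧ v (3 ^ m * (x + 1) - i) = v i

lemma blockSymmetric_const (c : ℝ) : BlockSymmetric 0 fun _ => c := fun _ _ _ _ _ => ⟨rfl, rfl⟩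

lemma BlockSymmetric.apply_mul {n : ℕ} {v : ℕ → ℝ} (hv : BlockSymmetric n v) {m : ℕ} (hm : n ≤ m)
    (x : ℕ) : v (3 ^ m * x) = v 0 := by
  simpa using (hv m hm x 0 (Nat.zero_le _)).1

/-! ### Decimation: from a chain to its block ends. -/

lemma phi_block {p : ℝ} (hp : p ∈ Set.Ioo (0 : ℝ) 1) {n : ℕ} {v : ℕ → ℝ} (hv : BlockSymmetric n v)
    {m : ℕ} (hm : n ≤ m) (x : ℕ) {i : ℕ} (hi : i ≤ 3 ^ m) :
    phi p v (3 ^ m * x + i) = sol p v 1 0 i * phi p v (3 ^ m * x)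
      + sol p v 0 1 i * phi p v (3 ^ m * x + 1) := by
  refine eq_sol_of_rec hp v (N := 3 ^ m) (g := fun i => phi p v (3 ^ m * x + i)) ?_ i hi
  intro i hi
  have h := phi_rec hp v (3 ^ m * x + i)
  rw [add_assoc, stepRight_block p m x (i := i + 1) (Nat.succ_pos i) hi,
    stepLeft_block p m x (i := i + 1) (Nat.succ_pos i) hi, (hv m hm x (i + 1) hi.le).1] at h
  exact h

lemma phi_block_reflect {p : ℝ} (hp : p ∈ Set.Ioo (0 : ℝ) 1) {n : ℕ} {v : ℕ → ℝ}
    (hv : BlockSymmetric n v) {m : ℕ} (hm : n ≤ m) (x : ℕ) {i : ℕ} (hi : i ≤ 3 ^ m) :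
    phi p v (3 ^ m * (x + 1) - i) = sol p v 1 0 i * phi p v (3 ^ m * (x + 1))
      + sol p v 0 1 i * phi p v (3 ^ m * (x + 1) - 1) := by
  refine eq_sol_of_rec hp v (N := 3 ^ m) (g := fun i => phi p v (3 ^ m * (x + 1) - i)) ?_ i hi
  intro i hi
  have hle : 3 ^ m ≤ 3 ^ m * (x + 1) := Nat.le_mul_of_pos_right _ (Nat.succ_pos x)
  have h := phi_rec hp v (3 ^ m * (x + 1) - (i + 2))
  have e1 : 3 ^ m * (x + 1) - (i + 2) + 1 = 3 ^ m * (x + 1) - (i + 1) := by omega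
  have e2 : 3 ^ m * (x + 1) - (i + 2) + 2 = 3 ^ m * (x + 1) - i := by omega
  rw [e1, e2, stepRight_block_reflect p m x (i := i + 1) (Nat.succ_pos i) hi,
    stepLeft_block_reflect p m x (i := i + 1) (Nat.succ_pos i) hi, (hv m hm x (i + 1) hi.le).2] at h
  linear_combination h

lemma phi_pow {p : ℝ} (hp : p ∈ Set.Ioo (0 : ℝ) 1) {n : ℕ} {v : ℕ → ℝ} (hv : BlockSymmetric n v)
    {m : ℕ} (hm : n ≤ m) :
    phi p v (3 ^ m) = sol p v 1 0 (3 ^ m) + dirichlet p v m * (X + C (v 0)) := by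
  simpa [phi_zero, phi_one, dirichlet] using phi_block hp hv hm 0 le_rfl

/-- The values at the two neighbouring block ends are the same combination of the centre value and
of the value one step away on their side. Weighting them by the right and left probabilities and
using the recurrence at the centre removes the one-step values. -/
lemma phi_pow_mul_rec {p : ℝ} (hp : p ∈ Set.Ioo (0 : ℝ) 1) {n : ℕ} {v : ℕ → ℝ}
    (hv : BlockSymmetric n v) {m : ℕ} (hm : n ≤ m) (x : ℕ) :
    C (stepRight p (x + 1)) * phi p v (3 ^ m * (x + 2))
      = phi p v (3 ^ m) * phi p v (3 ^ m * (x + 1))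
        - C (stepLeft p (x + 1)) * phi p v (3 ^ m * x) := by
  have hpos : 0 < 3 ^ m * (x + 1) := by positivity
  have h1 := phi_block hp hv hm (x + 1) le_rfl
  have h2 := phi_block_reflect hp hv hm x le_rfl
  have h3 := phi_rec hp v (3 ^ m * (x + 1) - 1)
  have h4 := phi_pow hp hv hm
  have e1 : 3 ^ m * (x + 1) - 1 + 1 = 3 ^ m * (x + 1) := by omega
  have e2 : 3 ^ m * (x + 1) - 1 + 2 = 3 ^ m * (x + 1) + 1 := by omega
  have e3 : 3 ^ m * (x + 1) - 3 ^ m = 3 ^ m * x := by rw [mul_add, mul_one, Nat.add_sub_cancel]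
  have e4 : 3 ^ m * (x + 1) + 3 ^ m = 3 ^ m * (x + 2) := by ring
  rw [e1, e2, stepRight_pow_mul_self, stepLeft_pow_mul_self, hv.apply_mul hm] at h3
  rw [e3] at h2
  rw [e4] at h1
  have hLR : (C (stepLeft p (x + 1)) : ℝ[X]) + C (stepRight p (x + 1)) = 1 := by
    rw [← C_add, stepLeft_add_stepRight, C_1]
  rw [h1, h2, h4, dirichlet]
  linear_combination (sol p v 0 1 (3 ^ m)) * h3 + sol p v 1 0 (3 ^ m)* phi p v (3 ^ m * (x + 1)) * hLR

/-- Spectral decimation. -/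
lemma phi_pow_mul {p : ℝ} (hp : p ∈ Set.Ioo (0 : ℝ) 1) {n : ℕ} {v : ℕ → ℝ}
    (hv : BlockSymmetric n v) {m : ℕ} (hm : n ≤ m) (x : ℕ) :
    phi p v (3 ^ m * x) = (phi p 0 x).comp (phi p v (3 ^ m)) := by
  induction x using Nat.strong_induction_on with
  | _ x ih =>
    match x, ih with
    | 0, _ => simp [phi_zero]
    | 1, _ => simp [phi_one]
    | x + 2, ih =>
      have hR : (C (stepRight p (x + 1)) : ℝ[X]) ≠ 0 := C_ne_zero.mpr (stepRight_pos hp _).ne'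
      apply mul_left_cancel₀ hR
      have h := congrArg (fun f => f.comp (phi p v (3 ^ m))) (phi_rec hp 0 x)
      simp only [mul_comp, sub_comp, C_comp, X_comp, Pi.zero_apply, C_0, add_zero] at h
      rw [phi_pow_mul_rec hp hv hm, ih (x + 1) (by omega), ih x (by omega), h]

lemma phi_pow_add {p : ℝ} (hp : p ∈ Set.Ioo (0 : ℝ) 1) {n : ℕ} {v : ℕ → ℝ}
    (hv : BlockSymmetric n v) {m : ℕ} (hm : n ≤ m) (k : ℕ) :
    phi p v (3 ^ (m + k)) = (phi p 0 (3 ^ k)).comp (phi p v (3 ^ m)) := by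
  rw [pow_add, phi_pow_mul hp hv hm]

/-- The reflected last block expresses `dirichlet` times the penultimate value through block ends.
Multiplying the boundary condition by `dirichlet` therefore turns it into the boundary condition of
the decimated chain at `phi p v (3 ^ m)`. -/
lemma dirichlet_mul_charFun {p : ℝ} (hp : p ∈ Set.Ioo (0 : ℝ) 1) {n : ℕ} {v : ℕ → ℝ}
    (hv : BlockSymmetric n v) {m : ℕ} (hm : n ≤ m) (k : ℕ) :
    dirichlet p v m * charFun p v (m + k) = (charFun p 0 k).comp (phi p v (3 ^ m)) := by
  obtain ⟨x, hx⟩ : ∃ x, 3 ^ k = x + 1 := ⟨3 ^ k - 1, (Nat.sub_add_cancel (Nat.one_le_pow _ _ (by norm_num))).symm⟩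
  have h2 := phi_block_reflect hp hv hm x le_rfl
  have e3 : 3 ^ m * (x + 1) - 3 ^ m = 3 ^ m * x := by rw [mul_add, mul_one, Nat.add_sub_cancel]
  rw [e3, phi_pow_mul hp hv hm, phi_pow_mul hp hv hm] at h2
  have h4 := phi_pow hp hv hm
  simp only [charFun, pow_add, hx, sub_comp, mul_comp, X_comp, Pi.zero_apply,
    C_0, add_zero, Nat.add_sub_cancel]
  rw [phi_pow_mul hp hv hm, h2]
  set w := (phi p 0 (x + 1)).comp (phi p v (3 ^ m))
  rw [h4, dirichlet]
  ring

lemma charFun_zero_zero (p : ℝ) : charFun p 0 0 = X ^ 2 - 1 := by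
  simp [charFun, phi_zero, phi_one, sq]

lemma dirichlet_mul_charFun_self {p : ℝ} (hp : p ∈ Set.Ioo (0 : ℝ) 1) {n : ℕ} {v : ℕ → ℝ}
    (hv : BlockSymmetric n v) {m : ℕ} (hm : n ≤ m) :
    dirichlet p v m * charFun p v m = phi p v (3 ^ m) ^ 2 - 1 := by
  simpa [charFun_zero_zero] using dirichlet_mul_charFun hp hv hm 0

/-- The cubic of the spectral decimation. -/
lemma phi_zero_three {p : ℝ} (hp : p ∈ Set.Ioo (0 : ℝ) 1) (w : ℝ) :
    p * (1 - p) * (phi p 0 3).eval w = w * (w ^ 2 - 1 + p * (1 - p)) := by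
  have r1 : stepRight p 1 = p := by simpa using stepRight_pow_mul p 0 (c := 1) (by norm_num)
  have r2 : stepRight p 2 = 1 - p := by simpa using stepRight_pow_mul p 0 (c := 2) (by norm_num)
  have l1 : stepLeft p 1 = 1 - p := by simpa using stepLeft_pow_mul p 0 (c := 1) (by norm_num)
  have l2 : stepLeft p 2 = p := by simpa using stepLeft_pow_mul p 0 (c := 2) (by norm_num)
  have h1 := congrArg (eval w) (phi_rec hp 0 0)
  have h2 := congrArg (eval w) (phi_rec hp 0 1)
  simp only [zero_add, Nat.reduceAdd, r1, r2, l1, l2, eval_mul, eval_sub, eval_add, eval_C, eval_X,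
    Pi.zero_apply, phi_zero, phi_one, add_zero, mul_one] at h1 h2
  linear_combination p * h2 + w * h1

/-! ### Real-rootedness -/

/-- The reversible weight normalized to be `1` at the origin. -/
def weight (p : ℝ) : ℕ → ℝ
  | 0 => 1
  | x + 1 => weight p x * stepRight p x / stepLeft p (x + 1)

lemma weight_pos {p : ℝ} (hp : p ∈ Set.Ioo (0 : ℝ) 1) (x : ℕ) : 0 < weight p x := by
  induction x with
  | zero => simp [weight]
  | succ x ih => exact div_pos (mul_pos ih (stepRight_pos hp x)) (stepLeft_pos hp x)

lemma weight_balance {p : ℝ} (hp : p ∈ Set.Ioo (0 : ℝ) 1) (x : ℕ) :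
    weight p (x + 1) * stepLeft p (x + 1) = weight p x * stepRight p x :=
  div_mul_cancel₀ _ (stepLeft_pos hp x).ne'

/-! ### Reality of zeros through the Wronskian flux. -/

lemma aeval_sol_rec {p : ℝ} (hp : p ∈ Set.Ioo (0 : ℝ) 1) (v : ℕ → ℝ) (f₀ f₁ : ℝ[X]) (z : ℂ)
    (x : ℕ) :
    (stepRight p (x + 1) : ℂ) * aeval z (sol p v f₀ f₁ (x + 2))
      = (z + v (x + 1)) * aeval z (sol p v f₀ f₁ (x + 1))
        - stepLeft p (x + 1) * aeval z (sol p v f₀ f₁ x) := by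
  have h := congrArg (aeval z) (C_stepRight_mul_sol hp v f₀ f₁ x)
  simpa only [map_mul, map_sub, map_add, aeval_C, aeval_X, Complex.coe_algebraMap] using h

/-- The imaginary part of the Wronskian of a solution and its conjugate. -/
def flux (p : ℝ) (f : ℕ → ℂ) (x : ℕ) : ℝ :=
  weight p x * stepRight p x * (f (x + 1) * starRingEnd ℂ (f x)).im

lemma flux_succ {p : ℝ} (hp : p ∈ Set.Ioo (0 : ℝ) 1) {v : ℕ → ℝ} {z : ℂ} {f : ℕ → ℂ}
    (hf : ∀ x, (stepRight p (x + 1) : ℂ) * f (x + 2)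
      = (z + v (x + 1)) * f (x + 1) - stepLeft p (x + 1) * f x) (x : ℕ) :
    flux p f (x + 1) = flux p f x + weight p (x + 1) * z.im * Complex.normSq (f (x + 1)) := by
  have h := congrArg (fun t => (t * starRingEnd ℂ (f (x + 1))).im) (hf x)
  have hb := weight_balance hp x
  simp only [Complex.mul_im, Complex.mul_re, Complex.sub_im, Complex.sub_re, Complex.add_re,
    Complex.add_im, Complex.conj_re, Complex.conj_im, Complex.ofReal_re, Complex.ofReal_im] at h
  simp only [flux, Complex.mul_im, Complex.conj_re, Complex.conj_im, Complex.normSq_apply]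
  linear_combination weight p (x + 1) * h +
    ((f (x + 1)).im * (f x).re - (f (x + 1)).re * (f x).im) * hb

/-- Each step adds a nonnegative multiple of `z.im` to the flux. For nonreal `z` the flux times
`z.im` becomes positive at the left end and can never return to `0` or below, as the condition at
the right end would require. -/
lemma flux_mul_im_mono {p : ℝ} (hp : p ∈ Set.Ioo (0 : ℝ) 1) {v : ℕ → ℝ} {z : ℂ} {f : ℕ → ℂ}
    (hf : ∀ x, (stepRight p (x + 1) : ℂ) * f (x + 2)
      = (z + v (x + 1)) * f (x + 1) - stepLeft p (x + 1) * f x) :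
    Monotone fun x => flux p f x * z.im := by
  refine monotone_nat_of_le_succ fun x => ?_
  rw [flux_succ hp hf]
  have := mul_nonneg (mul_nonneg (weight_pos hp (x + 1)).le (sq_nonneg z.im))
    (Complex.normSq_nonneg (f (x + 1)))
  nlinarith

lemma im_eq_zero_of_aeval_dirichlet {p : ℝ} (hp : p ∈ Set.Ioo (0 : ℝ) 1) (v : ℕ → ℝ) (m : ℕ)
    {z : ℂ} (hz : aeval z (dirichlet p v m) = 0) : z.im = 0 := by
  by_contra him
  set f : ℕ → ℂ := fun x => aeval z (sol p v 0 1 x) with hfdef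
  have hf : ∀ x, (stepRight p (x + 1) : ℂ) * f (x + 2)
      = (z + v (x + 1)) * f (x + 1) - stepLeft p (x + 1) * f x := aeval_sol_rec hp v 0 1 z
  have f1 : f 1 = 1 := by simp [hfdef, sol]
  have h0 : flux p f 0 = 0 := by simp [flux, hfdef, sol]
  have h1 : 0 < flux p f 1 * z.im := by
    rw [flux_succ hp hf 0, h0, zero_add, zero_add, f1, map_one, mul_one]
    have := mul_pos (weight_pos hp 1) (pow_pos (abs_pos.mpr him) 2)
    rw [sq_abs] at this
    linarith
  obtain ⟨x, hx⟩ : ∃ x, 3 ^ m = x + 1 :=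
    ⟨3 ^ m - 1, (Nat.sub_add_cancel (Nat.one_le_pow _ _ (by norm_num))).symm⟩
  have hx0 : f (x + 1) = 0 := by rw [← hx]; exact hz
  rcases Nat.eq_zero_or_pos x with rfl | hpos
  · rw [f1] at hx0; exact one_ne_zero hx0
  · have := flux_mul_im_mono hp hf hpos
    simp only [flux, hx0, zero_mul, Complex.zero_im, mul_zero] at this
    simp only [flux] at h1
    linarith

lemma im_eq_zero_of_aeval_charFun {p : ℝ} (hp : p ∈ Set.Ioo (0 : ℝ) 1) (v : ℕ → ℝ) (l : ℕ)
    {z : ℂ} (hz : aeval z (charFun p v l) = 0) : z.im = 0 := by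
  by_contra him
  set f : ℕ → ℂ := fun x => aeval z (phi p v x) with hfdef
  have hf : ∀ x, (stepRight p (x + 1) : ℂ) * f (x + 2)
      = (z + v (x + 1)) * f (x + 1) - stepLeft p (x + 1) * f x :=
    aeval_sol_rec hp v 1 (X + C (v 0)) z
  have h0 : 0 < flux p f 0 * z.im := by
    have : 0 < z.im ^ 2 := by positivity
    simpa [flux, hfdef, phi_zero, phi_one, weight, stepRight, ← sq] using this
  obtain ⟨x, hx⟩ : ∃ x, 3 ^ l = x + 1 :=
    ⟨3 ^ l - 1, (Nat.sub_add_cancel (Nat.one_le_pow _ _ (by norm_num))).symm⟩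
  have hx0 : f x = (z + v 0) * f (x + 1) := by
    rw [charFun, hx, Nat.add_sub_cancel, map_sub, map_mul, map_add, aeval_X, aeval_C] at hz
    exact (sub_eq_zero.mp hz).symm
  have h1 : 0 < flux p f x * z.im := h0.trans_le (flux_mul_im_mono hp hf (Nat.zero_le x))
  -- The reflecting condition `hx0` makes the last flux minus a nonnegative quantity, against `h1`.
  have h2 : flux p f x * z.im
      = -(weight p x * stepRight p x * z.im ^ 2 * Complex.normSq (f (x + 1))) := by
    rw [flux, hx0]
    simp only [map_mul, map_add, Complex.mul_im, Complex.mul_re, Complex.add_re, Complex.add_im,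
      Complex.conj_re, Complex.conj_im, Complex.ofReal_re, Complex.ofReal_im, Complex.normSq_apply]
    ring
  have h3 := mul_nonneg (mul_nonneg (mul_pos (weight_pos hp x) (stepRight_pos hp x)).le
    (sq_nonneg z.im)) (Complex.normSq_nonneg (f (x + 1)))
  linarith

lemma splits_of_im_eq_zero {f : ℝ[X]} (hf : ∀ z : ℂ, aeval z f = 0 → z.im = 0) : f.Splits := by
  refine Splits.of_splits_map (algebraMap ℝ ℂ) (IsAlgClosed.splits _) fun z hz => ?_
  have hz' : aeval z f = 0 := by
    simpa [aeval_def, eval_map] using isRoot_of_mem_roots hz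
  exact ⟨z.re, Complex.ext (by simp) (by simp [hf z hz'])⟩

lemma splits_dirichlet {p : ℝ} (hp : p ∈ Set.Ioo (0 : ℝ) 1) (v : ℕ → ℝ) (m : ℕ) :
    (dirichlet p v m).Splits :=
  splits_of_im_eq_zero fun _ => im_eq_zero_of_aeval_dirichlet hp v m

lemma splits_charFun {p : ℝ} (hp : p ∈ Set.Ioo (0 : ℝ) 1) (v : ℕ → ℝ) (l : ℕ) :
    (charFun p v l).Splits :=
  splits_of_im_eq_zero fun _ => im_eq_zero_of_aeval_charFun hp v l

/-- Christoffel–Darboux: each step adds `weight * phi ^ 2`, so the expression is the squared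
weighted norm of the solution on `{0, …, x}`, whose term at `0` is `1`. -/
lemma wronskian_derivative_pos {p : ℝ} (hp : p ∈ Set.Ioo (0 : ℝ) 1) (v : ℕ → ℝ) (s : ℝ) (x : ℕ) :
    0 < weight p x * stepRight p x * ((derivative (phi p v (x + 1))).eval s * (phi p v x).eval s
      - (phi p v (x + 1)).eval s * (derivative (phi p v x)).eval s) := by
  induction x with
  | zero => simp [phi_zero, phi_one, weight, stepRight]
  | succ x ih =>
    have h1 := congrArg (eval s) (phi_rec hp v x)
    have h2 := congrArg (fun f => eval s (derivative f)) (phi_rec hp v x)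
    have hb := weight_balance hp x
    simp only [eval_mul, eval_sub, eval_add, eval_C, eval_X, derivative_mul, derivative_sub,
      derivative_add, derivative_X, derivative_C, zero_mul, zero_add,
      add_zero, one_mul] at h1 h2
    have h3 := mul_nonneg (weight_pos hp (x + 1)).le (sq_nonneg ((phi p v (x + 1)).eval s))
    refine (add_pos_of_pos_of_nonneg ih h3).trans_eq ?_
    linear_combination -weight p (x + 1) * ((phi p v (x + 1)).eval s * h2 -
      (derivative (phi p v (x + 1))).eval s * h1) - ((derivative (phi p v (x + 1))).eval s *
      (phi p v x).eval s - (phi p v (x + 1)).eval s * (derivative (phi p v x)).eval s) * hb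

/-- At a double root the boundary condition and its derivative would make the Wronskian equal to
minus a square. -/
lemma derivative_charFun_ne_zero {p : ℝ} (hp : p ∈ Set.Ioo (0 : ℝ) 1) (v : ℕ → ℝ) (l : ℕ) {s : ℝ}
    (hs : (charFun p v l).eval s = 0) : (derivative (charFun p v l)).eval s ≠ 0 := by
  intro hd
  obtain ⟨x, hx⟩ : ∃ x, 3 ^ l = x + 1 :=
    ⟨3 ^ l - 1, (Nat.sub_add_cancel (Nat.one_le_pow _ _ (by norm_num))).symm⟩
  have h1 := wronskian_derivative_pos hp v s x
  have h2 := pos_of_mul_pos_right h1 (mul_pos (weight_pos hp x) (stepRight_pos hp x)).le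
  rw [charFun, hx, Nat.add_sub_cancel] at hs hd
  simp only [eval_mul, eval_sub, eval_add, eval_C, eval_X, derivative_mul, derivative_sub,
    derivative_add, derivative_X, derivative_C, add_zero, one_mul] at hs hd
  have h3 : (derivative (phi p v (x + 1))).eval s * (phi p v x).eval s
      - (phi p v (x + 1)).eval s * (derivative (phi p v x)).eval s
      = -(phi p v (x + 1)).eval s ^ 2 := by
    linear_combination (phi p v (x + 1)).eval s * hd - (derivative (phi p v (x + 1))).eval s * hs
  linarith [sq_nonneg ((phi p v (x + 1)).eval s)]

/-! ### Degrees -/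

lemma natDegree_phi_le_and_coeff_pos {p : ℝ} (hp : p ∈ Set.Ioo (0 : ℝ) 1) (v : ℕ → ℝ) (x : ℕ) :
    (phi p v x).natDegree ≤ x ∧ 0 < (phi p v x).coeff x := by
  induction x using Nat.strong_induction_on with
  | _ x ih =>
    match x, ih with
    | 0, _ => simp [phi_zero]
    | 1, _ => simp [phi_one]
    | x + 2, ih =>
      obtain ⟨d1, c1⟩ := ih (x + 1) (by omega)
      obtain ⟨d0, -⟩ := ih x (by omega)
      have e : phi p v (x + 2) = C (stepRight p (x + 1))⁻¹ * ((X + C (v (x + 1))) * phi p v (x + 1)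
          - C (stepLeft p (x + 1)) * phi p v x) := rfl
      constructor
      · rw [e]
        refine (natDegree_C_mul_le _ _).trans ((natDegree_sub_le _ _).trans (max_le ?_ ?_))
        · refine natDegree_mul_le.trans ?_
          rw [natDegree_X_add_C]
          omega
        · exact (natDegree_C_mul_le _ _).trans (by omega)
      · rw [e, coeff_C_mul, coeff_sub, add_mul, coeff_add, coeff_X_mul, coeff_C_mul, coeff_C_mul,
          coeff_eq_zero_of_natDegree_lt (by omega : (phi p v x).natDegree < x + 2),
          coeff_eq_zero_of_natDegree_lt (by omega : (phi p v (x + 1)).natDegree < x + 1 + 1)]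
        have := stepRight_pos hp (x + 1)
        simpa using mul_pos (inv_pos.mpr this) c1

lemma natDegree_phi {p : ℝ} (hp : p ∈ Set.Ioo (0 : ℝ) 1) (v : ℕ → ℝ) (x : ℕ) :
    (phi p v x).natDegree = x :=
  natDegree_eq_of_le_of_coeff_ne_zero (natDegree_phi_le_and_coeff_pos hp v x).1
    (natDegree_phi_le_and_coeff_pos hp v x).2.ne'

lemma leadingCoeff_phi_pos {p : ℝ} (hp : p ∈ Set.Ioo (0 : ℝ) 1) (v : ℕ → ℝ) (x : ℕ) :
    0 < (phi p v x).leadingCoeff := by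
  rw [leadingCoeff, natDegree_phi hp]
  exact (natDegree_phi_le_and_coeff_pos hp v x).2

lemma natDegree_charFun {p : ℝ} (hp : p ∈ Set.Ioo (0 : ℝ) 1) (v : ℕ → ℝ) (l : ℕ) :
    (charFun p v l).natDegree = 3 ^ l + 1 := by
  have h0 : phi p v (3 ^ l) ≠ 0 := leadingCoeff_ne_zero.mp (leadingCoeff_phi_pos hp v _).ne'
  have h1 : ((X + C (v 0)) * phi p v (3 ^ l)).natDegree = 3 ^ l + 1 := by
    rw [natDegree_mul (X_add_C_ne_zero _) h0, natDegree_X_add_C, natDegree_phi hp, add_comm]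
  rw [charFun, natDegree_sub_eq_left_of_natDegree_lt, h1]
  rw [h1, natDegree_phi hp]
  exact Nat.lt_succ_of_le (Nat.sub_le _ _)

lemma charFun_ne_zero {p : ℝ} (hp : p ∈ Set.Ioo (0 : ℝ) 1) (v : ℕ → ℝ) (l : ℕ) :
    charFun p v l ≠ 0 := fun h => by
  have := natDegree_charFun hp v l
  simp [h] at this

lemma charFun_comp_ne_zero {p : ℝ} (hp : p ∈ Set.Ioo (0 : ℝ) 1) (v : ℕ → ℝ) (m k : ℕ) :
    (charFun p 0 k).comp (phi p v (3 ^ m)) ≠ 0 := fun h => by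
  have := natDegree_comp (p := charFun p 0 k) (q := phi p v (3 ^ m))
  rw [h, natDegree_charFun hp, natDegree_phi hp, natDegree_zero] at this
  have h3 : 0 < (3 ^ k + 1) * 3 ^ m := by positivity
  omega

lemma dirichlet_ne_zero {p : ℝ} (hp : p ∈ Set.Ioo (0 : ℝ) 1) {n : ℕ} {v : ℕ → ℝ}
    (hv : BlockSymmetric n v) {m : ℕ} (hm : n ≤ m) : dirichlet p v m ≠ 0 := fun h =>
  charFun_comp_ne_zero hp v m 0 (by rw [← dirichlet_mul_charFun hp hv hm, h, zero_mul])

lemma natDegree_dirichlet {p : ℝ} (hp : p ∈ Set.Ioo (0 : ℝ) 1) {n : ℕ} {v : ℕ → ℝ}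
    (hv : BlockSymmetric n v) {m : ℕ} (hm : n ≤ m) : (dirichlet p v m).natDegree + 1 = 3 ^ m := by
  have h := congrArg natDegree (dirichlet_mul_charFun hp hv hm 0)
  rw [add_zero, natDegree_mul (dirichlet_ne_zero hp hv hm) (charFun_ne_zero hp v m), natDegree_comp,
    natDegree_charFun hp, natDegree_charFun hp, natDegree_phi hp] at h
  omega

lemma natDegree_phi_pow_sub_C {p : ℝ} (hp : p ∈ Set.Ioo (0 : ℝ) 1) (v : ℕ → ℝ) (m : ℕ) (W : ℝ) :
    (phi p v (3 ^ m) - C W).natDegree = 3 ^ m := by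
  rw [natDegree_sub_C, natDegree_phi hp]

lemma phi_pow_sub_C_ne_zero {p : ℝ} (hp : p ∈ Set.Ioo (0 : ℝ) 1) (v : ℕ → ℝ) (m : ℕ) (W : ℝ) :
    phi p v (3 ^ m) - C W ≠ 0 := fun h => by
  have := natDegree_phi_pow_sub_C hp v m W
  rw [h, natDegree_zero] at this
  exact absurd this.symm (by positivity)

lemma leadingCoeff_phi_pow_sub_C_pos {p : ℝ} (hp : p ∈ Set.Ioo (0 : ℝ) 1) (v : ℕ → ℝ) (m : ℕ)
    (W : ℝ) : 0 < (phi p v (3 ^ m) - C W).leadingCoeff := by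
  have h : (C W).degree < (phi p v (3 ^ m)).degree := by
    refine degree_lt_degree ?_
    rw [natDegree_C, natDegree_phi hp]
    positivity
  rw [leadingCoeff_sub_of_degree_lt h]
  exact leadingCoeff_phi_pos hp v _

/-- The level sets of the spectral decimation polynomial at the energies of the finite Laplacians
are real. -/
lemma splits_phi_pow_sub_C {p : ℝ} (hp : p ∈ Set.Ioo (0 : ℝ) 1) {n : ℕ} {v : ℕ → ℝ}
    (hv : BlockSymmetric n v) {m : ℕ} (hm : n ≤ m) {k : ℕ} {W : ℝ}
    (hW : (charFun p 0 k).eval W = 0) : (phi p v (3 ^ m) - C W).Splits := by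
  refine Splits.of_dvd (g := (charFun p 0 k).comp (phi p v (3 ^ m))) ?_
    (charFun_comp_ne_zero hp v m k) ?_
  · rw [← dirichlet_mul_charFun hp hv hm]
    exact (splits_dirichlet hp v m).mul (splits_charFun hp v _)
  · obtain ⟨g, hg⟩ := dvd_iff_isRoot.mpr hW
    exact ⟨g.comp (phi p v (3 ^ m)), by rw [hg, mul_comp, sub_comp, X_comp, C_comp]⟩

lemma splits_phi_pow_sub_one {p : ℝ} (hp : p ∈ Set.Ioo (0 : ℝ) 1) {n : ℕ} {v : ℕ → ℝ}
    (hv : BlockSymmetric n v) {m : ℕ} (hm : n ≤ m) : (phi p v (3 ^ m) - C 1).Splits :=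
  splits_phi_pow_sub_C hp hv hm (k := 0) (by simp [charFun_zero_zero])

lemma splits_phi_pow_add_one {p : ℝ} (hp : p ∈ Set.Ioo (0 : ℝ) 1) {n : ℕ} {v : ℕ → ℝ}
    (hv : BlockSymmetric n v) {m : ℕ} (hm : n ≤ m) : (phi p v (3 ^ m) - C (-1)).Splits :=
  splits_phi_pow_sub_C hp hv hm (k := 0) (by simp [charFun_zero_zero])

/-! ### Growth outside `[-1, 1]` -/

/-- The recurrence writes `w` times the present value as a convex combination of the next and the
previous ones. The previous one is inductively no larger than the present one, so the next one must
supply the growth. -/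
lemma abs_mul_abs_phi_le {p : ℝ} (hp : p ∈ Set.Ioo (0 : ℝ) 1) {w : ℝ} (hw : 1 < |w|) (x : ℕ) :
    |w| * |(phi p 0 x).eval w| ≤ |(phi p 0 (x + 1)).eval w| := by
  induction x with
  | zero => simp [phi_zero, phi_one]
  | succ x ih =>
    have h := congrArg (eval w) (phi_rec hp 0 x)
    simp only [eval_mul, eval_sub, eval_add, eval_C, eval_X, Pi.zero_apply, add_zero] at h
    set a := (phi p 0 (x + 2)).eval w
    set b := (phi p 0 (x + 1)).eval w
    set c := (phi p 0 x).eval w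
    have hR := stepRight_pos hp (x + 1)
    have hL := stepLeft_pos hp x
    have hLR := stepLeft_add_stepRight p (x + 1)
    set R := stepRight p (x + 1)
    set L := stepLeft p (x + 1)
    have h1 : |w| * |b| ≤ R * |a| + L * |c| := by
      rw [← abs_mul, ← abs_of_pos hR, ← abs_of_pos hL, ← abs_mul, ← abs_mul,
        show w * b = R * a + L * c by linarith]
      exact abs_add_le _ _
    have h2 : |c| ≤ |b| := by nlinarith [abs_nonneg c]
    have h3 : L * |c| ≤ L * (|w| * |b|) := by
      apply mul_le_mul_of_nonneg_left _ hL.le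
      nlinarith [abs_nonneg b]
    have h4 : R * (|w| * |b|) ≤ R * |a| := by
      have : R * (|w| * |b|) = |w| * |b| - L * (|w| * |b|) := by
        rw [show R = 1 - L by linarith]; ring
      linarith
    exact le_of_mul_le_mul_left h4 hR

lemma abs_pow_le_abs_phi {p : ℝ} (hp : p ∈ Set.Ioo (0 : ℝ) 1) {w : ℝ} (hw : 1 < |w|) (x : ℕ) :
    |w| ^ x ≤ |(phi p 0 x).eval w| := by
  induction x with
  | zero => simp [phi_zero]
  | succ x ih =>
    rw [pow_succ']
    exact (mul_le_mul_of_nonneg_left ih (abs_nonneg _)).trans (abs_mul_abs_phi_le hp hw x)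

lemma abs_le_one_of_charFun_eq_zero {p : ℝ} (hp : p ∈ Set.Ioo (0 : ℝ) 1) {k : ℕ} {w : ℝ}
    (hw : (charFun p 0 k).eval w = 0) : |w| ≤ 1 := by
  by_contra! h
  obtain ⟨x, hx⟩ : ∃ x, 3 ^ k = x + 1 :=
    ⟨3 ^ k - 1, (Nat.sub_add_cancel (Nat.one_le_pow _ _ (by norm_num))).symm⟩
  rw [charFun, hx, Nat.add_sub_cancel] at hw
  simp only [eval_mul, eval_sub, eval_add, eval_C, eval_X, Pi.zero_apply, add_zero] at hw
  have h1 := abs_mul_abs_phi_le hp h x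
  have h2 : |w| * |(phi p 0 (x + 1)).eval w| = |(phi p 0 x).eval w| := by
    rw [← abs_mul, sub_eq_zero.mp hw]
  have h3 : 0 < |(phi p 0 x).eval w| :=
    (pow_pos (by linarith) x).trans_le (abs_pow_le_abs_phi hp h x)
  nlinarith [abs_nonneg ((phi p 0 (x + 1)).eval w)]

lemma one_lt_abs_phi_pow_mono {p : ℝ} (hp : p ∈ Set.Ioo (0 : ℝ) 1) {n : ℕ} {v : ℕ → ℝ}
    (hv : BlockSymmetric n v) {m m' : ℕ} (hm : n ≤ m) (hmm' : m ≤ m') {s : ℝ}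
    (h : 1 < |(phi p v (3 ^ m)).eval s|) : 1 < |(phi p v (3 ^ m')).eval s| := by
  obtain ⟨k, rfl⟩ := Nat.exists_eq_add_of_le hmm'
  rw [phi_pow_add hp hv hm, eval_comp]
  exact (one_lt_pow₀ h (by positivity)).trans_le (abs_pow_le_abs_phi hp h _)

/-! ### Counting roots -/

/-- Rolle's theorem gives a critical point between consecutive distinct roots, which
order-connectedness keeps in `s`; a root of multiplicity `r` contributes another `r - 1`. -/
lemma card_filter_roots_le_derivative (f : ℝ[X]) (s : Set ℝ) [s.OrdConnected]
    [DecidablePred (· ∈ s)] :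
    (f.roots.filter (· ∈ s)).card ≤ (f.derivative.roots.filter (· ∈ s)).card + 1 := by
  rcases eq_or_ne (derivative f) 0 with hf' | hf'
  · rw [eq_C_of_derivative_eq_zero hf']
    simp
  have hf : f ≠ 0 := ne_of_apply_ne derivative (by rwa [derivative_zero])
  set A := (f.roots.filter (· ∈ s)).toFinset with hA
  set B := (f.derivative.roots.filter (· ∈ s)).toFinset with hB
  have hAB : A.card ≤ (B \ A).card + 1 := by
    refine Finset.card_le_sdiff_of_interleaved fun x hx y hy hxy _ => ?_
    rw [hA, Multiset.mem_toFinset, Multiset.mem_filter, mem_roots hf] at hx hy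
    obtain ⟨z, hz1, hz2⟩ := exists_deriv_eq_zero hxy f.continuousOn (hx.1.trans hy.1.symm)
    refine ⟨z, ?_, hz1⟩
    rw [hB, Multiset.mem_toFinset, Multiset.mem_filter, mem_roots hf', IsRoot, ← f.deriv]
    exact ⟨hz2, Set.OrdConnected.out ‹_› hx.2 hy.2 (Set.Ioo_subset_Icc_self hz1)⟩
  have hcount : ∀ (g : ℝ[X]) (x : ℝ), x ∈ s →
      (g.roots.filter (· ∈ s)).count x = g.rootMultiplicity x := fun g x hx => by
    rw [Multiset.count_filter_of_pos hx, count_roots]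
  have hAs : ∀ x ∈ A, x ∈ s := fun x hx => by
    rw [hA, Multiset.mem_toFinset, Multiset.mem_filter] at hx; exact hx.2
  calc (f.roots.filter (· ∈ s)).card
      = ∑ x ∈ A, (f.roots.filter (· ∈ s)).count x := (Multiset.toFinset_sum_count_eq _).symm
    _ ≤ ∑ x ∈ A, ((f.derivative.roots.filter (· ∈ s)).count x + 1) := by
        refine Finset.sum_le_sum fun x hx => ?_
        rw [hcount _ _ (hAs x hx), hcount _ _ (hAs x hx)]
        exact Nat.sub_le_iff_le_add.mp (rootMultiplicity_sub_one_le_derivative_rootMultiplicity _ _)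
    _ = ∑ x ∈ A, (f.derivative.roots.filter (· ∈ s)).count x + A.card := by
        rw [Finset.sum_add_distrib, Finset.card_eq_sum_ones]
    _ ≤ ∑ x ∈ A, (f.derivative.roots.filter (· ∈ s)).count x
          + (∑ x ∈ B \ A, (f.derivative.roots.filter (· ∈ s)).count x + 1) := by
        gcongr
        refine hAB.trans (Nat.add_le_add_right ?_ 1)
        rw [Finset.card_eq_sum_ones]
        refine Finset.sum_le_sum fun x hx => ?_
        rw [Nat.succ_le_iff, Multiset.count_pos, ← Multiset.mem_toFinset]
        exact (Finset.mem_sdiff.1 hx).1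
    _ = (f.derivative.roots.filter (· ∈ s)).card + 1 := by
        rw [← add_assoc, ← Finset.sum_union Finset.disjoint_sdiff, Finset.union_sdiff_self_eq_union,
          ← Multiset.toFinset_sum_count_eq, ← Finset.sum_subset Finset.subset_union_right]
        intro x _ hx
        simpa only [hB, Multiset.mem_toFinset, Multiset.count_eq_zero] using hx

/-- The number of roots of `f` in `[a, ∞)`, with multiplicity. -/
def cnt (f : ℝ[X]) (a : ℝ) : ℕ := (f.roots.filter (· ∈ Set.Ici a)).card

lemma cnt_le_natDegree (f : ℝ[X]) (a : ℝ) : cnt f a ≤ f.natDegree :=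
  (Multiset.card_le_card (Multiset.filter_le _ _)).trans (card_roots' f)

lemma cnt_mul {f g : ℝ[X]} (h : f * g ≠ 0) (a : ℝ) : cnt (f * g) a = cnt f a + cnt g a := by
  rw [cnt, roots_mul h, Multiset.filter_add, Multiset.card_add, cnt, cnt]

lemma cnt_C_mul {c : ℝ} (hc : c ≠ 0) (f : ℝ[X]) (a : ℝ) : cnt (C c * f) a = cnt f a := by
  rw [cnt, roots_C_mul f hc, cnt]

lemma cnt_multisetProd {S : Multiset ℝ[X]} (h : ∀ f ∈ S, f ≠ 0) (a : ℝ) :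
    cnt S.prod a = (S.map fun f => cnt f a).sum := by
  induction S using Multiset.induction_on with
  | empty => simp [cnt]
  | cons f S ih =>
    have hS : ∀ f ∈ S, f ≠ 0 := fun g hg => h g (Multiset.mem_cons_of_mem hg)
    have hprod : S.prod ≠ 0 := Multiset.prod_ne_zero fun h0 => hS 0 h0 rfl
    rw [Multiset.prod_cons, cnt_mul (mul_ne_zero (h f (Multiset.mem_cons_self f S)) hprod), ih hS,
      Multiset.map_cons, Multiset.sum_cons]

/-- The second inequality is Rolle on `[a, ∞)`. The first is Rolle on the complement together with
the total: `f` has as many roots as its degree, its derivative at least one fewer. -/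
lemma cnt_derivative_bounds {f : ℝ[X]} (hf : f.Splits) (hd : f.natDegree ≠ 0) (a : ℝ) :
    cnt f.derivative a ≤ cnt f a ∧ cnt f a ≤ cnt f.derivative a + 1 := by
  have h1 := card_filter_roots_le_derivative f (Set.Ici a)
  have hc : ((Set.Ici a)ᶜ).OrdConnected := by rw [Set.compl_Ici]; infer_instance
  have h2 := card_filter_roots_le_derivative f (Set.Ici a)ᶜ
  have h3 : ∀ g : ℝ[X], (g.roots.filter (· ∈ Set.Ici a)).card
      + (g.roots.filter (· ∈ (Set.Ici a)ᶜ)).card = g.roots.card := fun g => by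
    rw [← Multiset.card_add]
    exact congrArg _ (Multiset.filter_add_not _ _)
  have h4 := h3 f
  have h5 := h3 f.derivative
  have h6 := hf.natDegree_eq_card_roots
  have h7 : f.derivative.roots.card + 1 ≤ f.natDegree :=
    Nat.succ_le_of_lt ((card_roots' _).trans_lt (natDegree_derivative_lt hd))
  unfold cnt
  omega

lemma neg_one_pow_cnt_mul_eval_pos {f : ℝ[X]} (hf : f.Splits) (hl : 0 < f.leadingCoeff) {a : ℝ}
    (ha : f.eval a ≠ 0) : 0 < (-1) ^ cnt f a * f.eval a := by
  have key : ∀ S : Multiset ℝ, a ∉ S →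
      0 < (-1 : ℝ) ^ (S.filter (· ∈ Set.Ici a)).card * (S.map (a - ·)).prod := by
    intro S
    induction S using Multiset.induction_on with
    | empty => simp
    | cons r S ih =>
      intro h
      rw [Multiset.mem_cons, not_or] at h
      have h' := ih h.2
      rw [Multiset.map_cons, Multiset.prod_cons]
      rcases lt_or_gt_of_ne h.1 with hr | hr
      · rw [Multiset.filter_cons_of_pos _ (show r ∈ Set.Ici a from hr.le), Multiset.card_cons,
          pow_succ]
        nlinarith [mul_pos (sub_pos.mpr hr) h']
      · rw [Multiset.filter_cons_of_neg _ (show ¬ r ∈ Set.Ici a from not_le.mpr hr)]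
        nlinarith [mul_pos (sub_pos.mpr hr) h']
  have hroots : a ∉ f.roots := fun h => ha (isRoot_of_mem_roots h)
  rw [hf.eval_eq_prod_roots a, mul_left_comm]
  exact mul_pos hl (key _ hroots)

/-- The two polynomials share a derivative, so their counts differ by at most one. A common sign at
`a` forces a common parity. -/
lemma cnt_eq_of_mul_pos {f : ℝ[X]} {c d : ℝ} (hf : (f - C c).Splits) (hg : (f - C d).Splits)
    (hd : f.natDegree ≠ 0) (hl : 0 < f.leadingCoeff) {a : ℝ}
    (ha : 0 < (f - C c).eval a * (f - C d).eval a) : cnt (f - C c) a = cnt (f - C d) a := by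
  have hlc : ∀ c, 0 < (f - C c).leadingCoeff := fun c => by
    rw [leadingCoeff_sub_of_degree_lt]
    · exact hl
    · exact degree_lt_degree (by rw [natDegree_C]; omega)
  have h1 := cnt_derivative_bounds hf (by rwa [natDegree_sub_C]) a
  have h2 := cnt_derivative_bounds hg (by rwa [natDegree_sub_C]) a
  rw [derivative_sub, derivative_C, sub_zero] at h1 h2
  have s1 := neg_one_pow_cnt_mul_eval_pos hf (hlc c) (left_ne_zero_of_mul ha.ne')
  have s2 := neg_one_pow_cnt_mul_eval_pos hg (hlc d) (right_ne_zero_of_mul ha.ne')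
  have hmul := mul_pos (mul_pos s1 s2) ha
  have hpar : 0 < (-1 : ℝ) ^ (cnt (f - C c) a + cnt (f - C d) a) := by
    rw [pow_add]
    have hsq : 0 < ((f - C c).eval a * (f - C d).eval a) ^ 2 := by positivity
    have : (-1 : ℝ) ^ cnt (f - C c) a * (f - C c).eval a
        * ((-1) ^ cnt (f - C d) a * (f - C d).eval a) * ((f - C c).eval a * (f - C d).eval a)
        = (-1 : ℝ) ^ cnt (f - C c) a * (-1) ^ cnt (f - C d) a
          * ((f - C c).eval a * (f - C d).eval a) ^ 2 := by ring
    rw [this] at hmul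
    exact pos_of_mul_pos_left hmul hsq.le
  rcases Nat.even_or_odd (cnt (f - C c) a + cnt (f - C d) a) with he | ho
  · rw [Nat.even_iff] at he
    omega
  · rw [ho.neg_one_pow] at hpar
    linarith

lemma natDegree_phi_pow_ne_zero {p : ℝ} (hp : p ∈ Set.Ioo (0 : ℝ) 1) (v : ℕ → ℝ) (m : ℕ) :
    (phi p v (3 ^ m)).natDegree ≠ 0 := by
  rw [natDegree_phi hp]
  positivity

/-- Splitting `charFun p 0 k` over its roots `W` turns the composition with `phi p v (3 ^ m)` into a
product of level-set polynomials, and counts add over factors. -/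
lemma cnt_charFun_add {p : ℝ} (hp : p ∈ Set.Ioo (0 : ℝ) 1) {n : ℕ} {v : ℕ → ℝ}
    (hv : BlockSymmetric n v) {m : ℕ} (hm : n ≤ m) (k : ℕ) (a : ℝ) :
    cnt (dirichlet p v m) a + cnt (charFun p v (m + k)) a
      = ((charFun p 0 k).roots.map fun W => cnt (phi p v (3 ^ m) - C W) a).sum := by
  have hne := charFun_comp_ne_zero hp v m k
  rw [← dirichlet_mul_charFun hp hv hm] at hne
  rw [← cnt_mul hne, dirichlet_mul_charFun hp hv hm]
  conv_lhs => rw [(splits_charFun hp 0 k).eq_prod_roots, mul_comp, C_comp,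
    cnt_C_mul (leadingCoeff_ne_zero.mpr (charFun_ne_zero hp 0 k)), multiset_prod_comp,
    Multiset.map_map]
  rw [cnt_multisetProd, Multiset.map_map]
  · simp
  · intro f hf
    obtain ⟨W, -, rfl⟩ := Multiset.mem_map.mp hf
    simpa using phi_pow_sub_C_ne_zero hp v m W

lemma card_roots_charFun {p : ℝ} (hp : p ∈ Set.Ioo (0 : ℝ) 1) (v : ℕ → ℝ) (l : ℕ) :
    (charFun p v l).roots.card = 3 ^ l + 1 := by
  rw [← (splits_charFun hp v l).natDegree_eq_card_roots, natDegree_charFun hp]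

/-- The number of energies of a finite truncation, up to an error that is small for large `m`, `k`. -/
lemma abs_cnt_charFun_sub_le {p : ℝ} (hp : p ∈ Set.Ioo (0 : ℝ) 1) {n : ℕ} {v : ℕ → ℝ}
    (hv : BlockSymmetric n v) {m : ℕ} (hm : n ≤ m) (k : ℕ) (a : ℝ) :
    |(cnt (charFun p v (m + k)) a : ℝ) - (3 ^ k + 1) * cnt (phi p v (3 ^ m) - C 1) a|
      ≤ 3 ^ k + 1 + 3 ^ m := by
  have h := cnt_charFun_add hp hv hm k a
  have hd := cnt_le_natDegree (dirichlet p v m) a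
  have hd' := natDegree_dirichlet hp hv hm
  have key : ∀ W ∈ (charFun p 0 k).roots,
      cnt (phi p v (3 ^ m) - C W) a ≤ cnt (phi p v (3 ^ m) - C 1) a + 1 ∧
        cnt (phi p v (3 ^ m) - C 1) a ≤ cnt (phi p v (3 ^ m) - C W) a + 1 := by
    intro W hW
    have h1 := cnt_derivative_bounds (splits_phi_pow_sub_C hp hv hm (isRoot_of_mem_roots hW))
      (by rw [natDegree_sub_C]; exact natDegree_phi_pow_ne_zero hp v m) a
    have h2 := cnt_derivative_bounds (splits_phi_pow_sub_one hp hv hm)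
      (by rw [natDegree_sub_C]; exact natDegree_phi_pow_ne_zero hp v m) a
    rw [derivative_sub, derivative_C, sub_zero] at h1 h2
    omega
  have hcard := card_roots_charFun hp 0 k
  have up : ((charFun p 0 k).roots.map fun W => cnt (phi p v (3 ^ m) - C W) a).sum
      ≤ (3 ^ k + 1) * (cnt (phi p v (3 ^ m) - C 1) a + 1) := by
    rw [← hcard, ← smul_eq_mul, ← Multiset.card_map (fun W => cnt (phi p v (3 ^ m) - C W) a)]
    refine Multiset.sum_le_card_nsmul _ _ fun x hx => ?_
    obtain ⟨W, hW, rfl⟩ := Multiset.mem_map.mp hx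
    exact (key W hW).1
  have lo : (3 ^ k + 1) * cnt (phi p v (3 ^ m) - C 1) a
      ≤ ((charFun p 0 k).roots.map fun W => cnt (phi p v (3 ^ m) - C W) a).sum + (3 ^ k + 1) := by
    have h1 : (3 ^ k + 1) * cnt (phi p v (3 ^ m) - C 1) a
        = ((charFun p 0 k).roots.map fun _ => cnt (phi p v (3 ^ m) - C 1) a).sum := by
      rw [Multiset.map_const', Multiset.sum_replicate, hcard, smul_eq_mul]
    have h2 : (3 ^ k + 1) = ((charFun p 0 k).roots.map fun _ => 1).sum := by
      rw [Multiset.map_const', Multiset.sum_replicate, hcard, smul_eq_mul, mul_one]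
    rw [h1, h2, ← Multiset.sum_map_add]
    exact Multiset.sum_map_le_sum_map _ _ fun W hW => (key W hW).2
  have hd2 : cnt (dirichlet p v m) a ≤ 3 ^ m := by omega
  rw [← h] at up lo
  have up' : (cnt (dirichlet p v m) a : ℝ) + cnt (charFun p v (m + k)) a
      ≤ (3 ^ k + 1) * (cnt (phi p v (3 ^ m) - C 1) a + 1) := by exact_mod_cast up
  have lo' : (3 ^ k + 1 : ℝ) * cnt (phi p v (3 ^ m) - C 1) a
      ≤ cnt (dirichlet p v m) a + cnt (charFun p v (m + k)) a + (3 ^ k + 1) := by exact_mod_cast lo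
  have hd3 : (cnt (dirichlet p v m) a : ℝ) ≤ 3 ^ m := by exact_mod_cast hd2
  have hd4 : (0 : ℝ) ≤ cnt (dirichlet p v m) a := Nat.cast_nonneg _
  have h3m : (0 : ℝ) ≤ 3 ^ m := by positivity
  rw [abs_le]
  constructor <;> nlinarith

/-- The roots `W` lie in `[-1, 1]`, so a value of modulus above `1` lies on the same side of `W` as
of `1`. -/
lemma cnt_phi_pow_eq_of_one_lt {p : ℝ} (hp : p ∈ Set.Ioo (0 : ℝ) 1) {n : ℕ} {v : ℕ → ℝ}
    (hv : BlockSymmetric n v) {m : ℕ} (hm : n ≤ m) {a : ℝ}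
    (ha : 1 < |(phi p v (3 ^ m)).eval a|) {k : ℕ} {W : ℝ} (hW : (charFun p 0 k).eval W = 0) :
    cnt (phi p v (3 ^ m) - C W) a = cnt (phi p v (3 ^ m) - C 1) a := by
  refine cnt_eq_of_mul_pos (splits_phi_pow_sub_C hp hv hm hW) (splits_phi_pow_sub_one hp hv hm)
    (natDegree_phi_pow_ne_zero hp v m) (leadingCoeff_phi_pos hp v _) ?_
  have hW1 := abs_le.mp (abs_le_one_of_charFun_eq_zero hp hW)
  rw [eval_sub, eval_sub, eval_C, eval_C]
  rcases lt_abs.mp ha with h | h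
  · exact mul_pos (by linarith) (by linarith)
  · exact mul_pos_of_neg_of_neg (by linarith) (by linarith)

/-- The exact number of energies of a finite truncation beyond an escaping one. -/
lemma cnt_charFun_of_one_lt {p : ℝ} (hp : p ∈ Set.Ioo (0 : ℝ) 1) {n : ℕ} {v : ℕ → ℝ}
    (hv : BlockSymmetric n v) {m : ℕ} (hm : n ≤ m) {a : ℝ}
    (ha : 1 < |(phi p v (3 ^ m)).eval a|) (k : ℕ) :
    cnt (dirichlet p v m) a + cnt (charFun p v (m + k)) a
      = (3 ^ k + 1) * cnt (phi p v (3 ^ m) - C 1) a := by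
  rw [cnt_charFun_add hp hv hm, Multiset.map_congr rfl fun W hW =>
    cnt_phi_pow_eq_of_one_lt hp hv hm ha (isRoot_of_mem_roots hW), Multiset.map_const',
    Multiset.sum_replicate, card_roots_charFun hp, smul_eq_mul]

/-! ### The spectrum of the truncations -/

lemma truncation_mulVec (p : ℝ) (v : ℕ → ℝ) (l : ℕ) (g : ℕ → ℝ) (x : Fin (3 ^ l + 1)) :
    (truncation p v l).mulVec (fun y => g y) x =
      if (x : ℕ) = 3 ^ l then v x * g x - g (x - 1)
      else v x * g x - stepLeft p x * g (x - 1) - stepRight p x * g (x + 1) := by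
  have hx : (x : ℕ) < 3 ^ l + 1 := x.2
  have hpos : 0 < 3 ^ l := by positivity
  have hval : ∀ y : Fin (3 ^ l + 1), (x = y) = ((x : ℕ) = y) := fun y => by rw [Fin.ext_iff]
  simp only [Matrix.mulVec, dotProduct, truncation, hval]
  rw [Fin.sum_univ_eq_sum_range (fun y => (if (x : ℕ) = y then v x
    else if (x : ℕ) = 3 ^ l then (if y + 1 = 3 ^ l then -1 else 0) else -trans p x y) * g y)]
  split_ifs with h
  · rw [Finset.sum_congr rfl (g := fun y => (if (x : ℕ) = y then v x * g y else 0)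
      + if (x : ℕ) - 1 = y then -g y else 0)]
    · rw [Finset.sum_add_distrib, Finset.sum_ite_eq, Finset.sum_ite_eq,
        if_pos (Finset.mem_range.mpr hx), if_pos (Finset.mem_range.mpr (by omega))]
      ring
    · intro y _
      by_cases h1 : (x : ℕ) = y
      · rw [if_pos h1, if_pos h1, if_neg (by omega), add_zero]
      · rw [if_neg h1, if_neg h1, zero_add]
        by_cases h2 : y + 1 = 3 ^ l
        · rw [if_pos h2, if_pos (by omega), neg_one_mul]
        · rw [if_neg h2, if_neg (by omega), zero_mul]
  · rw [Finset.sum_congr rfl (g := fun y => ((if (x : ℕ) = y then v x * g y else 0)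
      + if (x : ℕ) - 1 = y then -(stepLeft p x * g y) else 0)
      + if (x : ℕ) + 1 = y then -(stepRight p x * g y) else 0)]
    · rw [Finset.sum_add_distrib, Finset.sum_add_distrib, Finset.sum_ite_eq, Finset.sum_ite_eq,
        Finset.sum_ite_eq, if_pos (Finset.mem_range.mpr hx),
        if_pos (Finset.mem_range.mpr (by omega)), if_pos (Finset.mem_range.mpr (by omega))]
      ring
    · intro y _
      -- At `x = 0` the truncated index `x - 1` coincides with the diagonal one; this is harmless
      -- because `stepLeft p 0 = 0`.
      rcases Nat.eq_zero_or_pos (x : ℕ) with h0 | h0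
      · rw [h0, trans]
        by_cases h1 : y = 0
        · simp [h1, stepLeft]
        · by_cases h2 : y = 1
          · simp [h2]
          · rw [if_neg (by omega), if_neg (by omega), if_neg (by omega), if_neg (by omega),
              if_neg (by omega), if_neg (by omega)]
            ring
      · rw [trans]
        by_cases h1 : (x : ℕ) = y
        · rw [if_pos h1, if_pos h1, if_neg (by omega), if_neg (by omega)]
          ring
        · rw [if_neg h1, if_neg h1]
          by_cases h2 : y = x + 1
          · rw [if_pos h2, if_neg (by omega), if_pos h2.symm]
            ring
          · rw [if_neg h2, if_neg (Ne.symm h2)]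
            by_cases h3 : (x : ℕ) = y + 1
            · rw [if_pos h3, if_pos (by omega)]
              ring
            · rw [if_neg h3, if_neg (by omega)]
              ring

lemma mem_spectrum_iff_exists_mulVec {ι : Type*} [Fintype ι] [DecidableEq ι] (M : Matrix ι ι ℝ)
    (E : ℝ) : E ∈ spectrum ℝ M ↔ ∃ f ≠ 0, M.mulVec f = E • f := by
  rw [spectrum.mem_iff, Matrix.isUnit_iff_isUnit_det, isUnit_iff_ne_zero, not_not,
    ← Matrix.exists_mulVec_eq_zero_iff]
  refine exists_congr fun f => and_congr_right fun _ => ?_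
  rw [Matrix.sub_mulVec, sub_eq_zero, Algebra.algebraMap_eq_smul_one, Matrix.smul_mulVec,
    Matrix.one_mulVec, eq_comm]

lemma eval_phi_rec {p : ℝ} (hp : p ∈ Set.Ioo (0 : ℝ) 1) (v : ℕ → ℝ) (s : ℝ) (x : ℕ) :
    stepRight p x * (phi p v (x + 1)).eval s
      = (s + v x) * (phi p v x).eval s - stepLeft p x * (phi p v (x - 1)).eval s := by
  rcases x with _ | x
  · simp [stepLeft, stepRight, phi_zero, phi_one]
  · have h := congrArg (eval s) (phi_rec hp v x)
    simp only [eval_mul, eval_sub, eval_add, eval_C, eval_X] at h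
    exact h

/-- All rows but the last force an eigenvector to be a multiple of `phi`, and the last row is the
boundary condition. That row carries `v (3 ^ l)` while `charFun` is written with `v 0`, whence `hv`.
-/
lemma mem_spectrum_truncation {p : ℝ} (hp : p ∈ Set.Ioo (0 : ℝ) 1) {v : ℕ → ℝ} {l : ℕ}
    (hv : v (3 ^ l) = v 0) (E : ℝ) :
    E ∈ spectrum ℝ (truncation p v l) ↔ (charFun p v l).eval (-E) = 0 := by
  have hpos : 0 < 3 ^ l := by positivity
  have hchar : (charFun p v l).eval (-E) = (v 0 - E) * (phi p v (3 ^ l)).eval (-E)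
      - (phi p v (3 ^ l - 1)).eval (-E) := by
    simp only [charFun, eval_mul, eval_sub, eval_add, eval_C, eval_X]
    ring
  rw [mem_spectrum_iff_exists_mulVec]
  constructor
  · rintro ⟨f, hf0, hf⟩
    set g : ℕ → ℝ := fun x => if h : x < 3 ^ l + 1 then f ⟨x, h⟩ else 0 with hg
    have hfg : f = fun y : Fin (3 ^ l + 1) => g y := by
      funext y
      simp only [hg, y.2, dif_pos]
    have hrow : ∀ x (hx : x < 3 ^ l + 1), (if x = 3 ^ l then v x * g x - g (x - 1)
        else v x * g x - stepLeft p x * g (x - 1) - stepRight p x * g (x + 1)) = E * g x := by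
      intro x hx
      have h := congrFun hf ⟨x, hx⟩
      rw [hfg, truncation_mulVec] at h
      exact h
    have hsol : ∀ x ≤ 3 ^ l, g x = g 0 * (phi p v x).eval (-E) := by
      intro x
      induction x using Nat.strong_induction_on with
      | _ x ih =>
        intro hx
        rcases x with _ | x
        · simp [phi_zero]
        · have h := hrow x (by omega)
          rw [if_neg (by omega)] at h
          have h1 := ih x (by omega) (by omega)
          have h2 : g (x - 1) = g 0 * (phi p v (x - 1)).eval (-E) := ih (x - 1) (by omega) (by omega)
          have h3 := eval_phi_rec hp v (-E) x
          apply mul_left_cancel₀ (stepRight_pos hp x).ne'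
          rw [h1, h2] at h
          linear_combination -h - g 0 * h3
    have hg0 : g 0 ≠ 0 := by
      intro h0
      apply hf0
      rw [hfg]
      funext y
      rw [hsol y (Nat.le_of_lt_succ y.2), h0, zero_mul]
      rfl
    have h := hrow (3 ^ l) (by omega)
    rw [if_pos rfl, hsol _ le_rfl, hsol _ (Nat.sub_le _ _), hv] at h
    apply mul_left_cancel₀ hg0
    rw [hchar]
    linear_combination h
  · intro h
    refine ⟨fun y => (phi p v y).eval (-E), ?_, ?_⟩
    · intro h0
      have := congrFun h0 0
      simp [phi_zero] at this
    · funext x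
      rw [truncation_mulVec p v l fun y => (phi p v y).eval (-E)]
      simp only [Pi.smul_apply, smul_eq_mul]
      split_ifs with hx
      · rw [hchar] at h
        rw [hx, hv]
        linear_combination h
      · linear_combination -eval_phi_rec hp v (-E) x

/-- `finiteDensity` sums over the spectrum as a set; simplicity makes this the same as counting
roots with multiplicity. -/
lemma nodup_roots_charFun {p : ℝ} (hp : p ∈ Set.Ioo (0 : ℝ) 1) (v : ℕ → ℝ) (l : ℕ) :
    (charFun p v l).roots.Nodup := by
  rw [Multiset.nodup_iff_count_le_one]
  intro s
  rw [count_roots]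
  by_contra! h
  have h1 := (one_lt_rootMultiplicity_iff_isRoot (charFun_ne_zero hp v l)).mp h
  exact derivative_charFun_ne_zero hp v l h1.1 h1.2

lemma finiteDensity_truncation_apply {p : ℝ} (hp : p ∈ Set.Ioo (0 : ℝ) 1) {v : ℕ → ℝ} {l : ℕ}
    (hv : v (3 ^ l) = v 0) {s : Set ℝ} (hs : MeasurableSet s) [DecidablePred (· ∈ s)] :
    finiteDensity (truncation p v l) s
      = ((3 : ℝ≥0∞) ^ l + 1)⁻¹ * ((charFun p v l).roots.filter (fun r => -r ∈ s)).card := by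
  set R : Finset ℝ := (charFun p v l).roots.toFinset.map (Equiv.neg ℝ).toEmbedding with hR
  have hspec : spectrum ℝ (truncation p v l) = (R : Set ℝ) := by
    ext E
    rw [mem_spectrum_truncation hp hv, hR, Finset.mem_coe, Finset.mem_map_equiv,
      Multiset.mem_toFinset, mem_roots (charFun_ne_zero hp v l), Equiv.neg_symm, Equiv.neg_apply,
      IsRoot]
  rw [finiteDensity, Measure.smul_apply, smul_eq_mul, Measure.sum_apply _ hs,
    tsum_congr_set_coe (fun E => Measure.dirac E s) hspec,
    Finset.tsum_subtype' R fun E => Measure.dirac E s, Finset.sum_map]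
  congr 1
  have h1 : ∀ r ∈ (charFun p v l).roots.toFinset,
      Measure.dirac ((Equiv.neg ℝ).toEmbedding r) s = if -r ∈ s then 1 else 0 := by
    intro r _
    rw [Measure.dirac_apply' _ hs, Set.indicator_apply]
    rfl
  rw [Finset.sum_congr rfl h1, Finset.sum_boole, ← Multiset.toFinset_filter,
    Multiset.toFinset_card_of_nodup ((nodup_roots_charFun hp v l).filter _)]

lemma isProbabilityMeasure_finiteDensity {p : ℝ} (hp : p ∈ Set.Ioo (0 : ℝ) 1) {v : ℕ → ℝ} {l : ℕ}
    (hv : v (3 ^ l) = v 0) : IsProbabilityMeasure (finiteDensity (truncation p v l)) := by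
  constructor
  classical
  rw [finiteDensity_truncation_apply hp hv MeasurableSet.univ]
  simp only [Set.mem_univ, Multiset.filter_true, card_roots_charFun hp]
  push_cast
  exact ENNReal.inv_mul_cancel (by positivity) (by finiteness)

lemma finiteDensity_real_Iic {p : ℝ} (hp : p ∈ Set.Ioo (0 : ℝ) 1) {v : ℕ → ℝ} {l : ℕ}
    (hv : v (3 ^ l) = v 0) (x : ℝ) :
    (finiteDensity (truncation p v l)).real (Set.Iic x)
      = cnt (charFun p v l) (-x) / (3 ^ l + 1) := by
  rw [measureReal_def, finiteDensity_truncation_apply hp hv measurableSet_Iic, ENNReal.toReal_mul,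
    ENNReal.toReal_inv, ENNReal.toReal_add (by finiteness) (by finiteness), ENNReal.toReal_pow,
    ENNReal.toReal_natCast, cnt, div_eq_inv_mul]
  simp [neg_le]

/-! ### Convergence of measures from convergence of distribution functions -/

/-- Uniformity carries right continuity and the limits at `±∞` over to `N`, so no mass is lost and
`N` is a distribution function. Convergence on the π-system of half-open intervals then gives weak
convergence. -/
lemma exists_measure_of_tendstoUniformly {μ : ℕ → Measure ℝ} [∀ l, IsProbabilityMeasure (μ l)]
    {N : ℝ → ℝ} (h : TendstoUniformly (fun l x => (μ l).real (Set.Iic x)) N atTop) :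
    ∃ ν : Measure ℝ, IsProbabilityMeasure ν ∧ (∀ x, ν.real (Set.Iic x) = N x) ∧
      ∀ f : ℝ →ᵇ ℝ, Tendsto (fun l => ∫ t, f t ∂μ l) atTop (𝓝 (∫ t, f t ∂ν)) := by
  have hlim : ∀ x, Tendsto (fun l => (μ l).real (Set.Iic x)) atTop (𝓝 (N x)) := h.tendsto_at
  have hcdf : ∀ l x, (μ l).real (Set.Iic x) = ProbabilityTheory.cdf (μ l) x := fun l x =>
    (ProbabilityTheory.cdf_eq_real (μ l) x).symm
  have hmono : Monotone N := fun a b hab => le_of_tendsto_of_tendsto' (hlim a) (hlim b) fun l =>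
    measureReal_mono (Set.Iic_subset_Iic.mpr hab)
  have hright : ∀ x, ContinuousWithinAt N (Set.Ici x) x := by
    intro x
    refine continuousWithinAt_of_locally_uniform_approx_of_continuousWithinAt
      (Set.self_mem_Ici) fun u hu => ?_
    obtain ⟨l, hl⟩ := (h u hu).exists
    refine ⟨Set.univ, univ_mem, fun y => (μ l).real (Set.Iic y), ?_, fun y _ => hl y⟩
    simp_rw [hcdf]
    exact (ProbabilityTheory.cdf (μ l)).right_continuous x
  have hbot : Tendsto N atBot (𝓝 0) := by
    refine h.tendsto_of_eventually_tendsto (L := fun _ => 0) (Eventually.of_forall fun l => ?_)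
      tendsto_const_nhds
    simp_rw [hcdf]
    exact ProbabilityTheory.tendsto_cdf_atBot (μ l)
  have htop : Tendsto N atTop (𝓝 1) := by
    refine h.tendsto_of_eventually_tendsto (L := fun _ => 1) (Eventually.of_forall fun l => ?_)
      tendsto_const_nhds
    simp_rw [hcdf]
    exact ProbabilityTheory.tendsto_cdf_atTop (μ l)
  let S : StieltjesFunction ℝ := ⟨N, hmono, hright⟩
  have hprob : IsProbabilityMeasure S.measure := S.isProbabilityMeasure hbot htop
  have hIic : ∀ x, S.measure.real (Set.Iic x) = N x := by
    intro x
    have h0 : 0 ≤ N x := ge_of_tendsto' (hlim x) fun _ => measureReal_nonneg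
    rw [measureReal_def, S.measure_Iic hbot, sub_zero, ENNReal.toReal_ofReal h0]
  refine ⟨S.measure, hprob, hIic, ?_⟩
  let P : ℕ → ProbabilityMeasure ℝ := fun l => ⟨μ l, inferInstance⟩
  let Q : ProbabilityMeasure ℝ := ⟨S.measure, hprob⟩
  have hweak : Tendsto P atTop (𝓝 Q) := by
    refine (isPiSystem_Ioc_mem Set.univ Set.univ).tendsto_probabilityMeasure_of_tendsto_of_mem
      ?_ ?_ ?_
    · rintro _ ⟨a, -, b, -, -, rfl⟩
      exact measurableSet_Ioc
    · intro u hu x hx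
      obtain ⟨a, b, ⟨hax, hxb⟩, hab⟩ := mem_nhds_iff_exists_Ioo_subset.mp (hu.mem_nhds hx)
      refine ⟨_, ⟨a, trivial, (x + b) / 2, trivial, by linarith, rfl⟩,
        Ioc_mem_nhds hax (by linarith), fun y hy => hab ⟨hy.1, ?_⟩⟩
      linarith [hy.2]
    · rintro _ ⟨a, -, b, -, hab, rfl⟩
      have hIoc : ∀ (ρ : Measure ℝ) [IsProbabilityMeasure ρ],
          ρ.real (Set.Ioc a b) = ρ.real (Set.Iic b) - ρ.real (Set.Iic a) := fun ρ _ => by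
        rw [← Set.Iic_sdiff_Iic, measureReal_sdiff (Set.Iic_subset_Iic.mpr hab.le) measurableSet_Iic]
      rw [← NNReal.tendsto_coe]
      change Tendsto (fun l => (μ l).real (Set.Ioc a b)) atTop (𝓝 (S.measure.real (Set.Ioc a b)))
      simp_rw [hIoc, hIic]
      exact (hlim b).sub (hlim a)
  exact ProbabilityMeasure.tendsto_iff_forall_integral_tendsto.mp hweak

/-! ### The density of states -/

/-- The normalizations `(3 ^ k + 1) * 3 ^ m` and `3 ^ (m + k) + 1` differ by `3 ^ m - 1`; the
summand `3 ^ m` next to `B` pays for this. -/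
lemma abs_div_sub_div_le {c j B : ℝ} {m k : ℕ} (hB : 0 ≤ B) (hj0 : 0 ≤ j) (hj : j ≤ 3 ^ m)
    (h : |c - (3 ^ k + 1) * j| ≤ B) :
    |c / (3 ^ (m + k) + 1) - j / 3 ^ m| ≤ (B + 3 ^ m) / 3 ^ (m + k) := by
  have hm : (1 : ℝ) ≤ 3 ^ m := one_le_pow₀ (by norm_num)
  have hpos : (0 : ℝ) < 3 ^ (m + k) := by positivity
  have e : c / (3 ^ (m + k) + 1) - j / 3 ^ m
      = ((c - (3 ^ k + 1) * j) + j * (3 ^ m - 1) / 3 ^ m) / (3 ^ (m + k) + 1) := by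
    rw [pow_add]
    field_simp
    ring
  have h1 : |j * (3 ^ m - 1) / 3 ^ m| ≤ 3 ^ m := by
    rw [abs_of_nonneg (div_nonneg (mul_nonneg hj0 (by linarith)) (by linarith)),
      div_le_iff₀ (by linarith)]
    nlinarith
  rw [e, abs_div, abs_of_pos (by linarith : (0 : ℝ) < 3 ^ (m + k) + 1)]
  exact div_le_div₀ (by linarith) ((abs_add_le _ _).trans (add_le_add h h1)) hpos (by linarith)

lemma cnt_phi_pow_le {p : ℝ} (hp : p ∈ Set.Ioo (0 : ℝ) 1) (v : ℕ → ℝ) (m : ℕ) (W a : ℝ) :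
    (cnt (phi p v (3 ^ m) - C W) a : ℝ) ≤ 3 ^ m := by
  have h := cnt_le_natDegree (phi p v (3 ^ m) - C W) a
  rw [natDegree_phi_pow_sub_C hp] at h
  exact_mod_cast h

/-- Existence of the density of states, and its values on escaping energies. -/
theorem exists_isDensityOfStates {p : ℝ} (hp : p ∈ Set.Ioo (0 : ℝ) 1) {n : ℕ} {v : ℕ → ℝ}
    (hv : BlockSymmetric n v) :
    ∃ ν : Measure ℝ, IsDensityOfStates (truncation p v) ν ∧
      ∀ m, n ≤ m → ∀ x : ℝ, 1 < |(phi p v (3 ^ m)).eval (-x)| →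
        ν.real (Set.Iic x) = cnt (phi p v (3 ^ m) - C 1) (-x) / 3 ^ m := by
  have hv0 : ∀ l, n ≤ l → v (3 ^ l) = v 0 := fun l hl => by simpa using hv.apply_mul hl 1
  set F : ℕ → ℝ → ℝ := fun l x => cnt (charFun p v l) (-x) / (3 ^ l + 1) with hF
  -- With `l = m + k` and `2 * m ≤ l` one has `3 ^ m ≤ 3 ^ k`, so the error `3 ^ k + 1 + 2 * 3 ^ m`
  -- is at most `4 * 3 ^ k`.
  have happrox : ∀ m, n ≤ m → ∀ l, 2 * m ≤ l → ∀ x,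
      |F l x - cnt (phi p v (3 ^ m) - C 1) (-x) / 3 ^ m| ≤ 4 / 3 ^ m := by
    intro m hm l hl x
    obtain ⟨k, rfl⟩ := Nat.exists_eq_add_of_le (show m ≤ l by omega)
    refine (abs_div_sub_div_le (by positivity) (Nat.cast_nonneg _) (cnt_phi_pow_le hp v m 1 _)
      (abs_cnt_charFun_sub_le hp hv hm k (-x))).trans ?_
    have h1 : (3 : ℝ) ^ m ≤ 3 ^ k := pow_le_pow_right₀ (by norm_num) (by omega)
    have h2 : (1 : ℝ) ≤ 3 ^ m := one_le_pow₀ (by norm_num)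
    rw [pow_add, div_le_div_iff₀ (by positivity) (by positivity)]
    nlinarith
  have hsmall : ∀ ε > 0, ∃ m, n ≤ m ∧ (8 : ℝ) / 3 ^ m < ε := by
    intro ε hε
    have h : Tendsto (fun m : ℕ => (8 : ℝ) / 3 ^ m) atTop (𝓝 0) :=
      tendsto_const_nhds.div_atTop (tendsto_pow_atTop_atTop_of_one_lt (by norm_num))
    obtain ⟨m, hm⟩ := ((h.eventually_lt_const hε).and (eventually_ge_atTop n)).exists
    exact ⟨m, hm.2, hm.1⟩
  have hcauchy : UniformCauchySeqOn F atTop Set.univ := by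
    rw [Metric.uniformCauchySeqOn_iff]
    intro ε hε
    obtain ⟨m, hm, hmε⟩ := hsmall ε hε
    refine ⟨2 * m, fun l hl l' hl' x _ => ?_⟩
    have h1 := happrox m hm l hl x
    have h2 := happrox m hm l' hl' x
    rw [Real.dist_eq]
    rw [abs_le] at h1 h2
    have h3 : (8 : ℝ) / 3 ^ m = 4 / 3 ^ m + 4 / 3 ^ m := by ring
    rw [abs_lt]
    constructor <;> linarith
  have hlim : ∀ x, ∃ N, Tendsto (fun l => F l x) atTop (𝓝 N) := fun x =>
    cauchySeq_tendsto_of_complete (hcauchy.cauchy_map (Set.mem_univ x))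
  choose N hN using hlim
  have hunif : TendstoUniformly F N atTop :=
    tendstoUniformlyOn_univ.mp (hcauchy.tendstoUniformlyOn_of_tendsto fun x _ => hN x)
  -- The spectrum is identified only when `v (3 ^ l) = v 0`, known for `l ≥ n`; hence the shift of
  -- the sequence by `n`.
  have hprob : ∀ l, IsProbabilityMeasure (finiteDensity (truncation p v (l + n))) := fun l =>
    isProbabilityMeasure_finiteDensity hp (hv0 _ (Nat.le_add_left n l))
  have hunif' : TendstoUniformly
      (fun l x => (finiteDensity (truncation p v (l + n))).real (Set.Iic x)) N atTop := by
    have e : (fun l x => (finiteDensity (truncation p v (l + n))).real (Set.Iic x))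
        = fun l => F (l + n) := by
      funext l x
      exact finiteDensity_real_Iic hp (hv0 _ (Nat.le_add_left n l)) x
    rw [e]
    intro u hu
    exact (tendsto_add_atTop_nat n).eventually (hunif u hu)
  obtain ⟨ν, hν, hIic, hweak⟩ := exists_measure_of_tendstoUniformly hunif'
  refine ⟨ν, ⟨hν, fun f => ?_⟩, fun m hm x hx => ?_⟩
  · exact (tendsto_add_atTop_iff_nat n).mp (hweak f)
  · rw [hIic]
    refine tendsto_nhds_unique ((tendsto_add_atTop_iff_nat m).mpr (hN x)) ?_
    rw [tendsto_iff_dist_tendsto_zero]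
    have h0 : Tendsto (fun k : ℕ => (2 : ℝ) / 3 ^ k) atTop (𝓝 0) :=
      tendsto_const_nhds.div_atTop (tendsto_pow_atTop_atTop_of_one_lt (by norm_num))
    refine squeeze_zero (fun _ => dist_nonneg) (fun k => ?_) h0
    have h1 := cnt_charFun_of_one_lt hp hv hm hx k
    have h2 := (cnt_le_natDegree (dirichlet p v m) (-x)).trans
      ((Nat.le_succ _).trans_eq (natDegree_dirichlet hp hv hm))
    have h1' : (cnt (dirichlet p v m) (-x) : ℝ) + cnt (charFun p v (m + k)) (-x)
        = (3 ^ k + 1) * cnt (phi p v (3 ^ m) - C 1) (-x) := by exact_mod_cast h1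
    have h2' : (cnt (dirichlet p v m) (-x) : ℝ) ≤ 3 ^ m := by exact_mod_cast h2
    -- On an escaping energy only the Dirichlet count is left as error; its bound does not depend on
    -- `k`, so it disappears after normalization.
    have h3 : |(cnt (charFun p v (m + k)) (-x) : ℝ)
        - (3 ^ k + 1) * cnt (phi p v (3 ^ m) - C 1) (-x)| ≤ 3 ^ m := by
      rw [← h1', abs_le]
      have : (0 : ℝ) ≤ cnt (dirichlet p v m) (-x) := Nat.cast_nonneg _
      constructor <;> linarith [pow_pos (three_pos : (0 : ℝ) < 3) m]
    rw [Real.dist_eq, add_comm k m]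
    refine (abs_div_sub_div_le (by positivity) (Nat.cast_nonneg _) (cnt_phi_pow_le hp v m 1 _)
      h3).trans_eq ?_
    rw [pow_add]
    field_simp
    ring

/-! ### Zeros accumulate at bounded orbits -/

lemma exists_root_of_cnt_lt {f : ℝ[X]} {a b : ℝ} (h : cnt f b < cnt f a) :
    ∃ t ∈ Set.Ico a b, f.eval t = 0 := by
  by_contra! hne
  have : f.roots.filter (· ∈ Set.Ici a) ≤ f.roots.filter (· ∈ Set.Ici b) := by
    rw [Multiset.le_filter]
    refine ⟨Multiset.filter_le _ _, fun r hr => ?_⟩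
    obtain ⟨h1, h2⟩ := Multiset.mem_filter.mp hr
    by_contra h3
    exact hne r ⟨h2, not_le.mp h3⟩ (isRoot_of_mem_roots h1)
  exact absurd (Multiset.card_le_card this) (not_le.mpr h)

lemma cnt_lt_of_root {f : ℝ[X]} (hf : f ≠ 0) {a b t : ℝ} (ht : t ∈ Set.Ico a b)
    (h : f.eval t = 0) : cnt f b < cnt f a := by
  refine Multiset.card_lt_card (lt_of_le_of_ne ?_ fun heq => ?_)
  · exact Multiset.monotone_filter_right _ fun _ hr => (ht.1.trans ht.2.le).trans hr
  · have h1 : t ∈ f.roots.filter (· ∈ Set.Ici a) :=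
      Multiset.mem_filter.mpr ⟨(mem_roots hf).mpr h, ht.1⟩
    rw [← heq] at h1
    exact absurd (Multiset.mem_filter.mp h1).2 (not_le.mpr ht.2)

/-- At escaping points the counts for the levels `1` and `-1` agree, so on `[a, b)` one level is
attained only if the other is. Entering `[-1, 1]` attains one of them, hence both, and the
intermediate value theorem gives the zero. -/
lemma exists_zero_of_one_lt {p : ℝ} (hp : p ∈ Set.Ioo (0 : ℝ) 1) {n : ℕ} {v : ℕ → ℝ}
    (hv : BlockSymmetric n v) {m : ℕ} (hm : n ≤ m) {a x b : ℝ} (hax : a ≤ x) (hxb : x ≤ b)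
    (ha : 1 < |(phi p v (3 ^ m)).eval a|) (hb : 1 < |(phi p v (3 ^ m)).eval b|)
    (hx : |(phi p v (3 ^ m)).eval x| ≤ 1) : ∃ t ∈ Set.Icc a b, (phi p v (3 ^ m)).eval t = 0 := by
  set Q := phi p v (3 ^ m) with hQ
  have hcnt : ∀ c, 1 < |Q.eval c| → cnt (Q - C 1) c = cnt (Q - C (-1)) c := fun c hc =>
    (cnt_phi_pow_eq_of_one_lt hp hv hm hc (k := 0) (by simp [charFun_zero_zero])).symm
  obtain ⟨t, ht, hQt⟩ : ∃ t ∈ Set.Icc a x, |Q.eval t| = 1 :=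
    intermediate_value_Icc' hax Q.continuous.abs.continuousOn ⟨hx, ha.le⟩
  have hxb' : x < b := lt_of_le_of_ne hxb fun h => by rw [h] at hx; linarith
  have htab : t ∈ Set.Ico a b := ⟨ht.1, ht.2.trans_lt hxb'⟩
  have hroot : ∀ c d : ℝ, (∀ y, 1 < |Q.eval y| → cnt (Q - C c) y = cnt (Q - C d) y) →
      Q.eval t = c → ∃ t' ∈ Set.Ico a b, Q.eval t' = d := by
    intro c d hcd hc
    have h := cnt_lt_of_root (phi_pow_sub_C_ne_zero hp v m c) htab (by simp [← hQ, hc])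
    rw [← hQ, hcd a ha, hcd b hb] at h
    obtain ⟨t', ht', h'⟩ := exists_root_of_cnt_lt h
    exact ⟨t', ht', by simpa [sub_eq_zero] using h'⟩
  have hsub : ∀ {t'}, t' ∈ Set.Ico a b → Set.uIcc t t' ⊆ Set.Icc a b := fun ht' =>
    Set.uIcc_subset_Icc (Set.Ico_subset_Icc_self htab) (Set.Ico_subset_Icc_self ht')
  rcases eq_or_eq_neg_of_abs_eq hQt with h1 | h1
  · obtain ⟨t', ht', h'⟩ := hroot 1 (-1) hcnt h1
    obtain ⟨z, hz, hz0⟩ := intermediate_value_uIcc (a := t) (b := t') Q.continuous.continuousOn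
      (show (0 : ℝ) ∈ Set.uIcc (Q.eval t) (Q.eval t') by
        rw [h1, h']; exact Set.mem_uIcc.mpr (Or.inr ⟨by norm_num, by norm_num⟩))
    exact ⟨z, hsub ht' hz, hz0⟩
  · obtain ⟨t', ht', h'⟩ := hroot (-1) 1 (fun y hy => (hcnt y hy).symm) h1
    obtain ⟨z, hz, hz0⟩ := intermediate_value_uIcc (a := t) (b := t') Q.continuous.continuousOn
      (show (0 : ℝ) ∈ Set.uIcc (Q.eval t) (Q.eval t') by
        rw [h1, h']; exact Set.mem_uIcc.mpr (Or.inl ⟨by norm_num, by norm_num⟩))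
    exact ⟨z, hsub ht' hz, hz0⟩

/-! ### The decimation cubic as an expanding map. -/

lemma phi_pow_succ {p : ℝ} (hp : p ∈ Set.Ioo (0 : ℝ) 1) {n : ℕ} {v : ℕ → ℝ}
    (hv : BlockSymmetric n v) {m : ℕ} (hm : n ≤ m) :
    phi p v (3 ^ (m + 1)) = (phi p 0 3).comp (phi p v (3 ^ m)) := by
  simpa using phi_pow_add hp hv hm 1

lemma eval_phi_pow_succ {p : ℝ} (hp : p ∈ Set.Ioo (0 : ℝ) 1) {n : ℕ} {v : ℕ → ℝ}
    (hv : BlockSymmetric n v) {m : ℕ} (hm : n ≤ m) (t : ℝ) :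
    p * (1 - p) * (phi p v (3 ^ (m + 1))).eval t = (phi p v (3 ^ m)).eval t *
      ((phi p v (3 ^ m)).eval t ^ 2 - 1 + p * (1 - p)) := by
  rw [phi_pow_succ hp hv hm, eval_comp, phi_zero_three hp]

lemma eval_derivative_phi_pow_succ {p : ℝ} (hp : p ∈ Set.Ioo (0 : ℝ) 1) {n : ℕ} {v : ℕ → ℝ}
    (hv : BlockSymmetric n v) {m : ℕ} (hm : n ≤ m) (t : ℝ) :
    p * (1 - p) * (derivative (phi p v (3 ^ (m + 1)))).eval t
      = (derivative (phi p v (3 ^ m))).eval t *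
        (3 * (phi p v (3 ^ m)).eval t ^ 2 - 1 + p * (1 - p)) := by
  have h : C (p * (1 - p)) * phi p v (3 ^ (m + 1))
      = phi p v (3 ^ m) * (phi p v (3 ^ m) ^ 2 - C (1 - p * (1 - p))) := by
    refine Polynomial.funext fun t => ?_
    simp only [eval_mul, eval_sub, eval_pow, eval_C]
    rw [eval_phi_pow_succ hp hv hm]
    ring
  have h' := congrArg (fun f => eval t (derivative f)) h
  simp only [derivative_mul, derivative_C, derivative_sub, derivative_pow, eval_mul, eval_add,
    eval_sub, eval_pow, eval_C, eval_zero, zero_mul, zero_add] at h'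
  rw [h']
  norm_num
  ring

lemma pq_pos {p : ℝ} (hp : p ∈ Set.Ioo (0 : ℝ) 1) : 0 < p * (1 - p) :=
  mul_pos hp.1 (by linarith [hp.2])

lemma pq_le (p : ℝ) : p * (1 - p) ≤ 1 / 4 := by nlinarith [sq_nonneg (p - 1 / 2)]

/-- The spectral decimation polynomial expands the metric `dw / √(1 - w²)` by the factor `3`. -/
lemma nine_mul_le_derivative_sq {p : ℝ} (hp : p ∈ Set.Ioo (0 : ℝ) 1) {n : ℕ} {v : ℕ → ℝ}
    (hv : BlockSymmetric n v) {m : ℕ} (hm : n ≤ m) {t : ℝ}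
    (ht : |(phi p v (3 ^ m)).eval t| ≤ 1) :
    9 * (1 - (phi p v (3 ^ (m + 1))).eval t ^ 2) * (derivative (phi p v (3 ^ m))).eval t ^ 2
      ≤ (1 - (phi p v (3 ^ m)).eval t ^ 2)
        * (derivative (phi p v (3 ^ (m + 1)))).eval t ^ 2 := by
  have h1 := eval_phi_pow_succ hp hv hm t
  have h2 := eval_derivative_phi_pow_succ hp hv hm t
  set W := (phi p v (3 ^ (m + 1))).eval t
  set w := (phi p v (3 ^ m)).eval t
  set D := (derivative (phi p v (3 ^ (m + 1)))).eval t
  set d := (derivative (phi p v (3 ^ m))).eval t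
  have hq := pq_pos hp
  have hq4 := pq_le p
  have hw : w ^ 2 ≤ 1 := (sq_le_one_iff_abs_le_one w).mpr ht
  -- The excess over expansion by exactly `3` carries the factor `1 - 4 p (1 - p) ≥ 0`, which
  -- vanishes in the Chebyshev case `p = 1/2`.
  have key : (p * (1 - p)) ^ 2 * ((1 - w ^ 2) * D ^ 2 - 9 * (1 - W ^ 2) * d ^ 2)
      = (1 - w ^ 2) * d ^ 2 * ((1 - 4 * (p * (1 - p))) * (3 * w ^ 2 + 1 + 2 * (p * (1 - p)))) := by
    linear_combination (1 - w ^ 2) * (p * (1 - p) * D + d * (3 * w ^ 2 - 1 + p * (1 - p))) * h2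
      + 9 * d ^ 2 * (p * (1 - p) * W + w * (w ^ 2 - 1 + p * (1 - p))) * h1
  have h3 : 0 ≤ (1 - w ^ 2) * d ^ 2
      * ((1 - 4 * (p * (1 - p))) * (3 * w ^ 2 + 1 + 2 * (p * (1 - p)))) :=
    mul_nonneg (mul_nonneg (by linarith) (sq_nonneg d))
      (mul_nonneg (by linarith) (by nlinarith [sq_nonneg w]))
  rw [← key] at h3
  have := nonneg_of_mul_nonneg_right h3 (by positivity)
  linarith

lemma exists_eval_ne_zero_of_lt {f : ℝ[X]} (hf : f ≠ 0) {c d : ℝ} (hcd : c < d) :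
    ∃ t ∈ Set.Ioo c d, f.eval t ≠ 0 := by
  by_contra! h
  refine hf (f.eq_zero_of_infinite_isRoot ((Set.Ioo_infinite hcd).mono fun t ht => h t ht))

/-- The points `±1` are repelling: with `q = p (1 - p)`, `q (1 - |W|) = (1 - |w|) (w ^ 2 + |w| +
q)`. Equal signs force `w ^ 2 > 1 - q ≥ 3/4`, so the last factor is at least `3 q`. -/
lemma three_mul_one_sub_abs_le {p : ℝ} (hp : p ∈ Set.Ioo (0 : ℝ) 1) {w W : ℝ}
    (h : p * (1 - p) * W = w * (w ^ 2 - 1 + p * (1 - p))) (hw : |w| ≤ 1) (hpos : 0 < w * W) :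
    3 * (1 - |w|) ≤ 1 - |W| := by
  have hq := pq_pos hp
  have hq4 := pq_le p
  have hw2 : 0 < w ^ 2 - 1 + p * (1 - p) := by
    have h1 : 0 < w ^ 2 * (w ^ 2 - 1 + p * (1 - p)) := by
      have : w ^ 2 * (w ^ 2 - 1 + p * (1 - p)) = p * (1 - p) * (w * W) := by
        linear_combination -w * h
      rw [this]
      exact mul_pos hq hpos
    exact pos_of_mul_pos_right h1 (sq_nonneg w)
  have habs : p * (1 - p) * |W| = |w| * (|w| ^ 2 - 1 + p * (1 - p)) := by
    rw [sq_abs, ← abs_of_pos hw2, ← abs_mul, ← h, abs_mul, abs_of_pos hq]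
  have h0 := abs_nonneg w
  rw [← sq_abs] at hw2
  set x := |w|
  have hx : 1 / 2 ≤ x := by nlinarith
  have : p * (1 - p) * (1 - |W|) = (1 - x) * (x ^ 2 + x + p * (1 - p)) := by
    linear_combination -habs
  have h2 : p * (1 - p) * (3 * (1 - x)) ≤ p * (1 - p) * (1 - |W|) := by
    rw [this]
    nlinarith [mul_nonneg (sub_nonneg.mpr hw) (sq_nonneg x)]
  exact le_of_mul_le_mul_left h2 hq

/-- Since `±1` are fixed by the cubic, modulus one at `t` persists with constant sign. Without
zeros, consecutive iterates then share their sign on the whole interval, so at a point of modulus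
below one the distance to modulus one would triple forever. -/
lemma abs_eval_lt_one_of_avoids_zero {p : ℝ} (hp : p ∈ Set.Ioo (0 : ℝ) 1) {n : ℕ} {v : ℕ → ℝ}
    (hv : BlockSymmetric n v) {c d : ℝ}
    (hle : ∀ m, n ≤ m → ∀ t ∈ Set.Ioo c d, |(phi p v (3 ^ m)).eval t| ≤ 1)
    (hne : ∀ m, n ≤ m → ∀ t ∈ Set.Ioo c d, (phi p v (3 ^ m)).eval t ≠ 0) {m : ℕ} (hm : n ≤ m)
    {t : ℝ} (ht : t ∈ Set.Ioo c d) : |(phi p v (3 ^ m)).eval t| < 1 := by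
  refine lt_of_le_of_ne (hle m hm t ht) fun h1 => ?_
  have hq := pq_pos hp
  have hone : ∀ j, |(phi p v (3 ^ (m + j))).eval t| = 1 ∧
      (phi p v (3 ^ (m + j + 1))).eval t = (phi p v (3 ^ (m + j))).eval t := by
    intro j
    have step : ∀ j, |(phi p v (3 ^ (m + j))).eval t| = 1 →
        (phi p v (3 ^ (m + j + 1))).eval t = (phi p v (3 ^ (m + j))).eval t := by
      intro j hj
      have h := eval_phi_pow_succ hp hv (hm.trans (Nat.le_add_right m j)) t
      rw [← sq_abs ((phi p v (3 ^ (m + j))).eval t), hj] at h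
      apply mul_left_cancel₀ hq.ne'
      linear_combination h
    induction j with
    | zero => exact ⟨h1, step 0 h1⟩
    | succ j ih =>
      have h2 : |(phi p v (3 ^ (m + (j + 1)))).eval t| = 1 := by
        rw [← add_assoc, ih.2, ih.1]
      exact ⟨h2, step (j + 1) h2⟩
  have hcd : c < d := ht.1.trans ht.2
  have hpoly : phi p v (3 ^ m) ^ 2 - 1 ≠ 0 := by
    rw [← dirichlet_mul_charFun_self hp hv hm]
    exact mul_ne_zero (dirichlet_ne_zero hp hv hm) (charFun_ne_zero hp v m)
  obtain ⟨t₁, ht₁, hQ₁⟩ := exists_eval_ne_zero_of_lt hpoly hcd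
  have hlt : |(phi p v (3 ^ m)).eval t₁| < 1 := by
    refine lt_of_le_of_ne (hle m hm t₁ ht₁) fun h => hQ₁ ?_
    rw [eval_sub, eval_pow, eval_one, ← sq_abs, h]
    norm_num
  have hpos : ∀ j, 0 < (phi p v (3 ^ (m + j))).eval t₁ * (phi p v (3 ^ (m + j + 1))).eval t₁ := by
    intro j
    by_contra! hneg
    have hpost : 0 < (phi p v (3 ^ (m + j))).eval t * (phi p v (3 ^ (m + j + 1))).eval t := by
      rw [(hone j).2, ← abs_mul_abs_self, (hone j).1]
      norm_num
    obtain ⟨z, hz, hz0⟩ := intermediate_value_uIcc (a := t₁) (b := t)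
      (f := fun y => (phi p v (3 ^ (m + j))).eval y * (phi p v (3 ^ (m + j + 1))).eval y)
      ((phi p v _).continuous.mul (phi p v _).continuous).continuousOn
      (Set.mem_uIcc.mpr (Or.inl ⟨hneg, hpost.le⟩))
    have hzJ : z ∈ Set.Ioo c d := Set.OrdConnected.uIcc_subset Set.ordConnected_Ioo ht₁ ht hz
    rcases mul_eq_zero.mp hz0 with h | h
    · exact hne _ (by omega) z hzJ h
    · exact hne _ (by omega) z hzJ h
  have hgrow : ∀ j, 3 ^ j * (1 - |(phi p v (3 ^ m)).eval t₁|)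
      ≤ 1 - |(phi p v (3 ^ (m + j))).eval t₁| := by
    intro j
    induction j with
    | zero => simp
    | succ j ih =>
      have h := three_mul_one_sub_abs_le hp
        (eval_phi_pow_succ hp hv (hm.trans (Nat.le_add_right m j)) t₁)
        (hle _ (by omega) t₁ ht₁) (hpos j)
      rw [pow_succ, ← add_assoc]
      linarith
  obtain ⟨j, hj⟩ := pow_unbounded_of_one_lt (1 / (1 - |(phi p v (3 ^ m)).eval t₁|))
    (by norm_num : (1 : ℝ) < 3)
  rw [div_lt_iff₀ (by linarith)] at hj
  linarith [hgrow j, abs_nonneg ((phi p v (3 ^ (m + j))).eval t₁)]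

/-- Without zeros the iterates stay in `(-1, 1)`, so their arcsines are differentiable. By the
expansion the slopes grow like `3 ^ j` on a fixed subinterval, whereas an arcsine can vary by at
most `π`. -/
lemma exists_zero_or_one_lt {p : ℝ} (hp : p ∈ Set.Ioo (0 : ℝ) 1) {n : ℕ} {v : ℕ → ℝ}
    (hv : BlockSymmetric n v) {c d : ℝ} (hcd : c < d)
    (hle : ∀ m, n ≤ m → ∀ t ∈ Set.Ioo c d, |(phi p v (3 ^ m)).eval t| ≤ 1) :
    ∃ m, n ≤ m ∧ ∃ t ∈ Set.Ioo c d, (phi p v (3 ^ m)).eval t = 0 := by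
  by_contra! hne
  have hlt := fun m (hm : n ≤ m) t (ht : t ∈ Set.Ioo c d) =>
    abs_eval_lt_one_of_avoids_zero hp hv hle hne hm ht
  have hder : derivative (phi p v (3 ^ n)) ≠ 0 := fun h =>
    natDegree_phi_pow_ne_zero hp v n (derivative_eq_zero.mp h)
  obtain ⟨t₀, ht₀, hd₀⟩ := exists_eval_ne_zero_of_lt hder hcd
  set κ := |(derivative (phi p v (3 ^ n))).eval t₀| / 2 with hκ
  have hκ0 : 0 < κ := by positivity
  have hev : ∀ᶠ t in 𝓝 t₀, t ∈ Set.Ioo c d ∧ κ < |(derivative (phi p v (3 ^ n))).eval t| :=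
    (isOpen_Ioo.eventually_mem ht₀).and (((derivative (phi p v (3 ^ n))).continuous.abs.tendsto t₀
      ).eventually_const_lt (half_lt_self (abs_pos.mpr hd₀)))
  obtain ⟨a, b, ⟨hat, htb⟩, hab⟩ := mem_nhds_iff_exists_Ioo_subset.mp hev
  have hgrow : ∀ j, ∀ t ∈ Set.Ioo a b,
      9 ^ j * κ ^ 2 * (1 - (phi p v (3 ^ (n + j))).eval t ^ 2)
        ≤ (derivative (phi p v (3 ^ (n + j)))).eval t ^ 2 := by
    intro j t ht
    obtain ⟨htJ, htκ⟩ := hab ht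
    induction j with
    | zero =>
      have h1 : κ ^ 2 ≤ (derivative (phi p v (3 ^ n))).eval t ^ 2 := by
        rw [← sq_abs ((derivative (phi p v (3 ^ n))).eval t)]
        gcongr
      have := mul_nonneg (sq_nonneg κ) (sq_nonneg ((phi p v (3 ^ n)).eval t))
      simp only [add_zero, pow_zero, one_mul]
      linarith
    | succ j ih =>
      have hj := hlt (n + j) (Nat.le_add_right n j) t htJ
      have hj1 := hlt (n + (j + 1)) (Nat.le_add_right n _) t htJ
      have h := nine_mul_le_derivative_sq hp hv (Nat.le_add_right n j) hj.le
      rw [← sq_lt_one_iff_abs_lt_one] at hj hj1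
      rw [add_assoc] at h
      have h3 : (1 - (phi p v (3 ^ (n + j))).eval t ^ 2) *
          (9 ^ (j + 1) * κ ^ 2 * (1 - (phi p v (3 ^ (n + (j + 1)))).eval t ^ 2))
          ≤ (1 - (phi p v (3 ^ (n + j))).eval t ^ 2) *
            (derivative (phi p v (3 ^ (n + (j + 1))))).eval t ^ 2 := by
        refine le_trans ?_ h
        have := mul_le_mul_of_nonneg_left ih
          (by linarith : 0 ≤ 9 * (1 - (phi p v (3 ^ (n + (j + 1)))).eval t ^ 2))
        refine le_trans (le_of_eq ?_) this
        ring
      exact le_of_mul_le_mul_left h3 (by linarith)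
  set a' := (a + t₀) / 2
  have haa' : a < a' := by simp only [a']; linarith
  have ha't : a' < t₀ := by simp only [a']; linarith
  have hsub : ∀ t ∈ Set.Icc a' t₀, t ∈ Set.Ioo a b := fun t ht =>
    ⟨haa'.trans_le ht.1, ht.2.trans_lt htb⟩
  obtain ⟨j, hj⟩ := pow_unbounded_of_one_lt (Real.pi / (κ * (t₀ - a'))) (by norm_num : (1 : ℝ) < 3)
  rw [div_lt_iff₀ (mul_pos hκ0 (by linarith))] at hj
  have hderiv : ∀ t ∈ Set.Icc a' t₀, HasDerivAt (fun y => Real.arcsin ((phi p v (3 ^ (n + j))).eval y))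
      (1 / √(1 - (phi p v (3 ^ (n + j))).eval t ^ 2)
        * (derivative (phi p v (3 ^ (n + j)))).eval t) t := by
    intro t ht
    have h := abs_lt.mp (hlt (n + j) (Nat.le_add_right n j) t (hab (hsub t ht)).1)
    exact (Real.hasDerivAt_arcsin h.1.ne' h.2.ne).comp t ((phi p v (3 ^ (n + j))).hasDerivAt t)
  obtain ⟨e, he, hslope⟩ := exists_hasDerivAt_eq_slope _ _ ha't
    (fun t ht => (hderiv t ht).continuousAt.continuousWithinAt)
    (fun t ht => hderiv t (Set.Ioo_subset_Icc_self ht))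
  have he' := hab (hsub e (Set.Ioo_subset_Icc_self he))
  have hlt' := (sq_lt_one_iff_abs_lt_one _).mpr (hlt (n + j) (Nat.le_add_right n j) e he'.1)
  have hs : 0 < √(1 - (phi p v (3 ^ (n + j))).eval e ^ 2) := Real.sqrt_pos.mpr (by linarith)
  have hbig : 3 ^ j * κ ≤ |1 / √(1 - (phi p v (3 ^ (n + j))).eval e ^ 2)
        * (derivative (phi p v (3 ^ (n + j)))).eval e| := by
    rw [one_div_mul_eq_div, abs_div, abs_of_pos hs, le_div_iff₀ hs]
    refine (le_abs_self _).trans (abs_le_of_sq_le_sq ?_ (abs_nonneg _))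
    rw [mul_pow, mul_pow, Real.sq_sqrt (by linarith), sq_abs, ← pow_mul, mul_comm j 2, pow_mul]
    norm_num only
    exact hgrow j e (hsub e (Set.Ioo_subset_Icc_self he))
  rw [hslope, abs_div, abs_of_pos (by linarith : 0 < t₀ - a'), le_div_iff₀ (by linarith)] at hbig
  have h1 := Real.arcsin_mem_Icc ((phi p v (3 ^ (n + j))).eval t₀)
  have h2 := Real.arcsin_mem_Icc ((phi p v (3 ^ (n + j))).eval a')
  have h3 : |Real.arcsin ((phi p v (3 ^ (n + j))).eval t₀)
      - Real.arcsin ((phi p v (3 ^ (n + j))).eval a')| ≤ Real.pi := by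
    rw [abs_le]
    constructor <;> linarith [h1.1, h1.2, h2.1, h2.2]
  linarith

/-- If the decimated orbit of `s` stays in `[-1, 1]`, then orbits through `0` start arbitrarily
close to `s`. -/
lemma exists_zero_near {p : ℝ} (hp : p ∈ Set.Ioo (0 : ℝ) 1) {n : ℕ} {v : ℕ → ℝ}
    (hv : BlockSymmetric n v) {s : ℝ} (hs : ∀ m, n ≤ m → |(phi p v (3 ^ m)).eval s| ≤ 1) {δ : ℝ}
    (hδ : 0 < δ) : ∃ m, n ≤ m ∧ ∃ t, |t - s| < δ ∧ (phi p v (3 ^ m)).eval t = 0 := by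
  by_contra! hne
  -- Escape on both sides of `s` can be brought to a common level, where it forces a zero in
  -- between. So one side never escapes.
  have hside : (∀ m, n ≤ m → ∀ t ∈ Set.Ioo s (s + δ), |(phi p v (3 ^ m)).eval t| ≤ 1) ∨
      ∀ m, n ≤ m → ∀ t ∈ Set.Ioo (s - δ) s, |(phi p v (3 ^ m)).eval t| ≤ 1 := by
    by_contra! h
    obtain ⟨⟨m₁, hm₁, b, hb, hb1⟩, m₂, hm₂, a, ha, ha1⟩ := h
    have hm : n ≤ max m₁ m₂ := hm₁.trans (le_max_left _ _)
    obtain ⟨t, ht, ht0⟩ := exists_zero_of_one_lt hp hv hm ha.2.le hb.1.le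
      (one_lt_abs_phi_pow_mono hp hv hm₂ (le_max_right _ _) ha1)
      (one_lt_abs_phi_pow_mono hp hv hm₁ (le_max_left _ _) hb1) (hs _ hm)
    refine hne _ hm t ?_ ht0
    rw [abs_lt]
    constructor <;> linarith [ht.1, ht.2, ha.1, hb.2]
  rcases hside with h | h
  · obtain ⟨m, hm, t, ht, h0⟩ := exists_zero_or_one_lt hp hv (by linarith) h
    exact hne m hm t (abs_lt.mpr ⟨by linarith [ht.1], by linarith [ht.2]⟩) h0
  · obtain ⟨m, hm, t, ht, h0⟩ := exists_zero_or_one_lt hp hv (by linarith) h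
    exact hne m hm t (abs_lt.mpr ⟨by linarith [ht.1], by linarith [ht.2]⟩) h0

/-! ### Polynomial growth of the solution over an orbit through `0` -/

/-- The factors `1 - p` for entering and leaving a block of length three cancel, and the weights at
its two interior points coincide. -/
lemma weight_three_mul {p : ℝ} (hp : p ∈ Set.Ioo (0 : ℝ) 1) (y : ℕ) :
    weight p (3 * y) = weight p y := by
  induction y with
  | zero => rfl
  | succ y ih =>
    have hq : (0 : ℝ) < 1 - p := by linarith [hp.2]
    have hp0 := hp.1
    have b0 := weight_balance hp (3 * y)
    have b1 := weight_balance hp (3 * y + 1)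
    have b2 := weight_balance hp (3 * y + 2)
    have b := weight_balance hp y
    have e3 : 3 * y + 2 + 1 = 3 * (y + 1) := by ring
    have r0 : stepRight p (3 * y) = stepRight p y := by simpa using stepRight_pow_mul_self p 1 y
    have l3 : stepLeft p (3 * (y + 1)) = stepLeft p (y + 1) := by
      simpa using stepLeft_pow_mul_self p 1 (y + 1)
    have r1 : stepRight p (3 * y + 1) = p := by
      simpa using stepRight_pow_mul p 0 (c := 3 * y + 1) (by omega)
    have l1 : stepLeft p (3 * y + 1) = 1 - p := by
      simpa using stepLeft_pow_mul p 0 (c := 3 * y + 1) (by omega)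
    have r2 : stepRight p (3 * y + 2) = 1 - p := by
      simpa using stepRight_pow_mul p 0 (c := 3 * y + 2) (by omega)
    have l2 : stepLeft p (3 * y + 1 + 1) = p := by
      simpa using stepLeft_pow_mul p 0 (c := 3 * y + 2) (by omega)
    rw [l1, r0, ih] at b0
    rw [l2, r1] at b1
    rw [e3, l3, r2] at b2
    have h1 : weight p (3 * y + 2) = weight p (3 * y + 1) := mul_right_cancel₀ hp0.ne' b1
    apply mul_right_cancel₀ (stepLeft_pos hp y).ne'
    rw [b2, h1, b0, b]

lemma weight_pow_mul {p : ℝ} (hp : p ∈ Set.Ioo (0 : ℝ) 1) (m y : ℕ) :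
    weight p (3 ^ m * y) = weight p y := by
  induction m with
  | zero => simp
  | succ m ih => rw [pow_succ', mul_assoc, weight_three_mul hp, ih]

lemma min_le_stepRight {p : ℝ} (hp : p ∈ Set.Ioo (0 : ℝ) 1) (x : ℕ) :
    min p (1 - p) ≤ stepRight p x := by
  unfold stepRight
  split_ifs
  · exact (min_le_left _ _).trans hp.2.le
  · exact min_le_left _ _
  · exact min_le_right _ _

lemma min_le_stepLeft (p : ℝ) (x : ℕ) : min p (1 - p) ≤ stepLeft p (x + 1) := by
  unfold stepLeft
  rw [if_neg (Nat.succ_ne_zero x)]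
  split_ifs
  · exact min_le_right _ _
  · exact min_le_left _ _

lemma min_pos_of_mem {p : ℝ} (hp : p ∈ Set.Ioo (0 : ℝ) 1) : 0 < min p (1 - p) :=
  lt_min hp.1 (by linarith [hp.2])

lemma weight_succ_le {p : ℝ} (hp : p ∈ Set.Ioo (0 : ℝ) 1) (x : ℕ) :
    weight p (x + 1) ≤ (min p (1 - p))⁻¹ * weight p x := by
  rw [inv_mul_eq_div, le_div_iff₀ (min_pos_of_mem hp)]
  calc weight p (x + 1) * min p (1 - p) ≤ weight p (x + 1) * stepLeft p (x + 1) :=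
        mul_le_mul_of_nonneg_left (min_le_stepLeft p x) (weight_pos hp _).le
    _ = weight p x * stepRight p x := weight_balance hp x
    _ ≤ weight p x := mul_le_of_le_one_right (weight_pos hp x).le (stepRight_le hp x)

lemma weight_le_succ {p : ℝ} (hp : p ∈ Set.Ioo (0 : ℝ) 1) (x : ℕ) :
    weight p x ≤ (min p (1 - p))⁻¹ * weight p (x + 1) := by
  rw [inv_mul_eq_div, le_div_iff₀ (min_pos_of_mem hp)]
  calc weight p x * min p (1 - p) ≤ weight p x * stepRight p x :=
        mul_le_mul_of_nonneg_left (min_le_stepRight hp x) (weight_pos hp _).le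
    _ = weight p (x + 1) * stepLeft p (x + 1) := (weight_balance hp x).symm
    _ ≤ weight p (x + 1) := mul_le_of_le_one_right (weight_pos hp _).le (stepLeft_le hp _)

lemma one_le_inv_min {p : ℝ} (hp : p ∈ Set.Ioo (0 : ℝ) 1) : 1 ≤ (min p (1 - p))⁻¹ :=
  (one_le_inv₀ (min_pos_of_mem hp)).mpr ((min_le_left _ _).trans hp.2.le)

lemma weight_add_le {p : ℝ} (hp : p ∈ Set.Ioo (0 : ℝ) 1) (x i : ℕ) :
    weight p (x + i) ≤ (min p (1 - p))⁻¹ ^ i * weight p x := by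
  induction i with
  | zero => simp
  | succ i ih =>
    rw [← add_assoc, pow_succ', mul_assoc]
    exact (weight_succ_le hp _).trans
      (mul_le_mul_of_nonneg_left ih (inv_nonneg.mpr (min_pos_of_mem hp).le))

lemma weight_block_le {p : ℝ} (hp : p ∈ Set.Ioo (0 : ℝ) 1) (m y : ℕ) {i : ℕ} (hi : i ≤ 3 ^ m) :
    weight p (3 ^ m * y + i) ≤ (min p (1 - p))⁻¹ ^ 3 ^ m * weight p y := by
  refine (weight_add_le hp _ i).trans ?_
  rw [weight_pow_mul hp]
  exact mul_le_mul_of_nonneg_right (pow_le_pow_right₀ (one_le_inv_min hp) hi) (weight_pos hp y).le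

/-- Each ternary digit costs a factor `2 * B`, which amounts to polynomial growth in `y`. Multiples
of three are treated apart through `h3`, so that the neighbour `z + 1` is used only when it is still
at most `3 ^ k`. -/
lemma le_mul_pow_of_ternary {a : ℕ → ℝ} {B D : ℝ} (ha : ∀ y, 0 ≤ a y) (hB : 1 ≤ B) (h0 : a 0 ≤ D)
    (h1 : a 1 ≤ D) (h3 : ∀ y, a (3 * y) ≤ a y)
    (h : ∀ y i, i < 3 → a (3 * y + i) ≤ B * (a y + a (y + 1))) (k : ℕ) :
    ∀ y ≤ 3 ^ k, a y ≤ D * (2 * B) ^ k := by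
  have hD : 0 ≤ D := (ha 0).trans h0
  induction k with
  | zero =>
    intro y hy
    simp only [pow_zero, mul_one] at hy ⊢
    interval_cases y <;> assumption
  | succ k ih =>
    intro y hy
    have hDk : 0 ≤ D * (2 * B) ^ k := by positivity
    rw [pow_succ, ← mul_assoc]
    obtain ⟨z, i, hi, rfl⟩ : ∃ z i, i < 3 ∧ y = 3 * z + i :=
      ⟨y / 3, y % 3, Nat.mod_lt _ (by norm_num), (Nat.div_add_mod y 3).symm⟩
    rw [pow_succ] at hy
    rcases Nat.eq_zero_or_pos i with rfl | hpos
    · have := ih z (by omega)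
      rw [add_zero]
      nlinarith [h3 z]
    · have e1 := ih z (by omega)
      have e2 := ih (z + 1) (by omega)
      nlinarith [h z i hi]

/-- At a zero of `phi p v (3 ^ m)` the block ends carry the values of `phi p 0` at parameter `0`.
There `dirichlet * charFun = -1`, so `dirichlet` does not vanish and the ends control the interior.
-/
lemma exists_abs_phi_block_le {p : ℝ} (hp : p ∈ Set.Ioo (0 : ℝ) 1) {n : ℕ} {v : ℕ → ℝ}
    (hv : BlockSymmetric n v) {m : ℕ} (hm : n ≤ m) {s : ℝ} (hs : (phi p v (3 ^ m)).eval s = 0) :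
    ∃ B : ℝ, 1 ≤ B ∧ ∀ y i, i ≤ 3 ^ m → |(phi p v (3 ^ m * y + i)).eval s|
      ≤ B * (|(phi p 0 y).eval 0| + |(phi p 0 (y + 1)).eval 0|) := by
  have hS : (dirichlet p v m).eval s ≠ 0 := by
    intro h0
    have h := congrArg (eval s) (dirichlet_mul_charFun_self hp hv hm)
    rw [eval_mul, h0, eval_sub, eval_pow, hs, eval_one] at h
    norm_num at h
  set S := (dirichlet p v m).eval s with hSdef
  set c := fun i => |(sol p v 1 0 i).eval s| with hc
  set d := fun i => |(sol p v 0 1 i).eval s| with hd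
  obtain ⟨Mc, hMc⟩ := ((Finset.range (3 ^ m + 1)).image c).bddAbove
  obtain ⟨Md, hMd⟩ := ((Finset.range (3 ^ m + 1)).image d).bddAbove
  have hMc' : ∀ i ≤ 3 ^ m, c i ≤ Mc := fun i hi =>
    hMc (Finset.mem_coe.mpr (Finset.mem_image_of_mem c (Finset.mem_range.mpr (by omega))))
  have hMd' : ∀ i ≤ 3 ^ m, d i ≤ Md := fun i hi =>
    hMd (Finset.mem_coe.mpr (Finset.mem_image_of_mem d (Finset.mem_range.mpr (by omega))))
  have hMc0 : 0 ≤ Mc := (abs_nonneg _).trans (hMc' 0 (Nat.zero_le _))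
  have hMd0 : 0 ≤ Md := (abs_nonneg _).trans (hMd' 0 (Nat.zero_le _))
  have hS0 : 0 < |S| := abs_pos.mpr hS
  refine ⟨1 + Mc + Md * ((1 + Mc) / |S|), ?_, fun y i hi => ?_⟩
  · have : 0 ≤ Md * ((1 + Mc) / |S|) := by positivity
    linarith
  have hmul : ∀ z, (phi p v (3 ^ m * z)).eval s = (phi p 0 z).eval 0 := fun z => by
    rw [phi_pow_mul hp hv hm, eval_comp, hs]
  have hblock : ∀ i, i ≤ 3 ^ m → (phi p v (3 ^ m * y + i)).eval s
      = (sol p v 1 0 i).eval s * (phi p 0 y).eval 0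
        + (sol p v 0 1 i).eval s * (phi p v (3 ^ m * y + 1)).eval s := fun i hi => by
    rw [phi_block hp hv hm y hi, eval_add, eval_mul, eval_mul, hmul]
  set a := |(phi p 0 y).eval 0|
  set b := |(phi p 0 (y + 1)).eval 0|
  have ha : 0 ≤ a := abs_nonneg _
  have hb : 0 ≤ b := abs_nonneg _
  have hone : |(phi p v (3 ^ m * y + 1)).eval s| ≤ (1 + Mc) / |S| * (a + b) := by
    have h := hblock (3 ^ m) le_rfl
    rw [← Nat.mul_succ, Nat.succ_eq_add_one, hmul] at h
    have h2 : |S| * |(phi p v (3 ^ m * y + 1)).eval s| ≤ b + c (3 ^ m) * a := by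
      rw [← abs_mul, hc, ← abs_mul, show S * (phi p v (3 ^ m * y + 1)).eval s
        = (phi p 0 (y + 1)).eval 0 - (sol p v 1 0 (3 ^ m)).eval s * (phi p 0 y).eval 0 by
          rw [h, hSdef, dirichlet]; ring]
      exact abs_sub _ _
    rw [div_mul_eq_mul_div, le_div_iff₀ hS0]
    nlinarith [hMc' (3 ^ m) le_rfl]
  rw [hblock i hi]
  refine (abs_add_le _ _).trans ?_
  rw [abs_mul, abs_mul]
  have h1 : |(sol p v 1 0 i).eval s| * a ≤ Mc * a := mul_le_mul_of_nonneg_right (hMc' i hi) ha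
  have h2 : |(sol p v 0 1 i).eval s| * |(phi p v (3 ^ m * y + 1)).eval s|
      ≤ Md * ((1 + Mc) / |S| * (a + b)) := mul_le_mul (hMd' i hi) hone (abs_nonneg _) hMd0
  nlinarith [mul_nonneg hMc0 hb]

lemma blockSymmetric_zero : BlockSymmetric 0 0 := blockSymmetric_const 0

lemma phi_zero_three_eval_zero {p : ℝ} (hp : p ∈ Set.Ioo (0 : ℝ) 1) :
    (phi p 0 3).eval 0 = 0 := by
  have h := phi_zero_three hp 0
  rw [zero_mul] at h
  exact (mul_eq_zero.mp h).resolve_left (pq_pos hp).ne'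

/-- The parameter `0` is fixed by the cubic, so the solution at `0` is unchanged under `y ↦ 3 * y`
and grows polynomially. The weight has the same invariance, and the block estimate transfers both
bounds to `s`. -/
lemma exists_weight_mul_phi_sq_le {p : ℝ} (hp : p ∈ Set.Ioo (0 : ℝ) 1) {n : ℕ} {v : ℕ → ℝ}
    (hv : BlockSymmetric n v) {m : ℕ} (hm : n ≤ m) {s : ℝ} (hs : (phi p v (3 ^ m)).eval s = 0) :
    ∃ M D : ℝ, 0 ≤ M ∧ 0 ≤ D ∧ ∀ k, ∀ x ≤ 3 ^ (m + k),
      weight p x * (phi p v x).eval s ^ 2 ≤ M * D ^ k := by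
  obtain ⟨B, hB, hBle⟩ := exists_abs_phi_block_le hp hv hm hs
  obtain ⟨B₀, hB₀, hB₀le⟩ := exists_abs_phi_block_le hp blockSymmetric_zero (Nat.zero_le 1)
    (s := 0) (by simpa using phi_zero_three_eval_zero hp)
  rw [pow_one] at hB₀le
  have hu : ∀ k, ∀ y ≤ 3 ^ k, |(phi p 0 y).eval 0| ≤ 1 * (2 * B₀) ^ k :=
    le_mul_pow_of_ternary (fun _ => abs_nonneg _) hB₀ (by simp [phi_zero]) (by simp [phi_one])
      (fun y => by
        have h := phi_pow_mul hp blockSymmetric_zero (Nat.zero_le 1) y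
        rw [pow_one] at h
        rw [h, eval_comp, phi_zero_three_eval_zero hp])
      (fun y i hi => hB₀le y i hi.le)
  set ρ := (min p (1 - p))⁻¹ with hρ
  have hρ1 : 1 ≤ ρ := one_le_inv_min hp
  have hw : ∀ k, ∀ y ≤ 3 ^ k, weight p y ≤ ρ * (2 * ρ ^ 3) ^ k :=
    le_mul_pow_of_ternary (fun y => (weight_pos hp y).le) (one_le_pow₀ hρ1)
      (by simpa [weight] using hρ1)
      (by simpa [weight] using weight_succ_le hp 0) (fun y => (weight_three_mul hp y).le)
      (fun y i hi => by
        have h := weight_block_le hp 1 y (i := i) (by omega)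
        rw [pow_one] at h
        refine h.trans (mul_le_mul_of_nonneg_left ?_ (by positivity))
        linarith [weight_pos hp (y + 1)])
  refine ⟨ρ ^ 3 ^ m * ρ * (4 * B ^ 2), 2 * ρ ^ 3 * (2 * B₀) ^ 2, by positivity, by positivity, ?_⟩
  intro k x hx
  obtain ⟨y, i, hi, rfl⟩ : ∃ y i, i < 3 ^ m ∧ x = 3 ^ m * y + i :=
    ⟨x / 3 ^ m, x % 3 ^ m, Nat.mod_lt _ (by positivity), (Nat.div_add_mod x _).symm⟩
  have hpow : 0 ≤ (2 * B₀) ^ k := by positivity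
  have hphi : |(phi p v (3 ^ m * y + i)).eval s| ≤ 2 * B * (2 * B₀) ^ k := by
    -- The right end `3 ^ (m + k)` has `y = 3 ^ k`, with no further block in range, so block ends
    -- are handled separately.
    rcases Nat.eq_zero_or_pos i with rfl | hpos
    · rw [add_zero, phi_pow_mul hp hv hm, eval_comp, hs]
      have hy : y ≤ 3 ^ k := by
        rw [add_zero, pow_add] at hx
        exact Nat.le_of_mul_le_mul_left hx (by positivity)
      have := hu k y hy
      nlinarith
    · have hy : y + 1 ≤ 3 ^ k := by
        rw [pow_add] at hx
        exact Nat.lt_of_mul_lt_mul_left (show 3 ^ m * y < 3 ^ m * 3 ^ k by omega)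
      have h1 := hu k y (by omega)
      have h2 := hu k (y + 1) hy
      refine (hBle y i hi.le).trans ?_
      nlinarith
  have hy : y ≤ 3 ^ k := by
    rw [pow_add] at hx
    exact Nat.le_of_mul_le_mul_left ((Nat.le_add_right _ _).trans hx) (by positivity)
  have hw' : weight p (3 ^ m * y + i) ≤ ρ ^ 3 ^ m * (ρ * (2 * ρ ^ 3) ^ k) :=
    (weight_block_le hp m y hi.le).trans (mul_le_mul_of_nonneg_left (hw k y hy) (by positivity))
  rw [← sq_abs]
  calc weight p (3 ^ m * y + i) * |(phi p v (3 ^ m * y + i)).eval s| ^ 2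
      ≤ ρ ^ 3 ^ m * (ρ * (2 * ρ ^ 3) ^ k) * (2 * B * (2 * B₀) ^ k) ^ 2 := by
        gcongr
    _ = _ := by
        rw [mul_pow (2 * ρ ^ 3) ((2 * B₀) ^ 2) k, ← pow_mul (2 * B₀) 2 k, mul_comm 2 k, pow_mul]
        ring

/-- The boundary inequality makes partial sums gain a factor `r = 1 + 1 / C` every two steps. Since
`2 * k ^ 2 + 1 ≤ 3 ^ k`, the sum up to `3 ^ (m + k)` is at least of order `r ^ (k ^ 2)`, which
outgrows any `(3 * D) ^ k`. -/
lemma not_forall_growth {t : ℕ → ℝ} {C M D : ℝ} {m : ℕ} (ht : ∀ x, 0 ≤ t x) (ht0 : 0 < t 0)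
    (hC : 0 < C) (hM : 0 ≤ M) (hD : 0 ≤ D)
    (hshnol : ∀ K, ∑ x ∈ Finset.range (K + 1), t x ≤ C * (t K + t (K + 1)))
    (hpoly : ∀ k, ∀ x ≤ 3 ^ (m + k), t x ≤ M * D ^ k) : False := by
  set A := fun K => ∑ x ∈ Finset.range K, t x with hA
  have hAmono : Monotone A := fun a b hab =>
    Finset.sum_le_sum_of_subset_of_nonneg (Finset.range_mono hab) fun _ _ _ => ht _
  set r := 1 + 1 / C with hr
  have hr1 : 1 < r := by rw [hr]; linarith [one_div_pos.mpr hC]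
  have hstep : ∀ K, r * A K ≤ A (K + 2) := by
    intro K
    have h1 : A (K + 2) = A K + (t K + t (K + 1)) := by
      simp only [hA, Finset.sum_range_succ]
      ring
    have h2 : A K / C ≤ t K + t (K + 1) := by
      rw [div_le_iff₀ hC, mul_comm]
      exact (hAmono (Nat.le_succ K)).trans (hshnol K)
    rw [h1, hr, add_mul, one_mul, one_div_mul_eq_div]
    linarith
  have hexp : ∀ q, r ^ q * t 0 ≤ A (2 * q + 1) := by
    intro q
    induction q with
    | zero => simp [hA]
    | succ q ih =>
      rw [pow_succ', mul_assoc]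
      exact (mul_le_mul_of_nonneg_left ih (by linarith)).trans (hstep _)
  have hup : ∀ k, A (3 ^ (m + k)) ≤ 3 ^ m * M * (3 * D) ^ k := by
    intro k
    have h : A (3 ^ (m + k)) ≤ (Finset.range (3 ^ (m + k))).card • (M * D ^ k) :=
      Finset.sum_le_card_nsmul _ _ _ fun x hx => hpoly k x (Finset.mem_range.mp hx).le
    refine h.trans_eq ?_
    rw [Finset.card_range, nsmul_eq_mul]
    push_cast
    rw [pow_add, mul_pow]
    ring
  have hsq : ∀ k, 3 ≤ k → 2 * k ^ 2 + 1 ≤ 3 ^ k := by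
    intro k hk
    induction k, hk using Nat.le_induction with
    | base => norm_num
    | succ k hk ih =>
      rw [pow_succ 3]
      nlinarith
  have hall : ∀ k, 3 ≤ k → (r ^ k) ^ k * t 0 ≤ 3 ^ m * M * (3 * D) ^ k := by
    intro k hk
    rw [← pow_mul, ← sq]
    refine (hexp _).trans ((hAmono ?_).trans (hup k))
    refine (hsq k hk).trans (Nat.pow_le_pow_right (by norm_num) (by omega))
  have h1 : ∀ᶠ k : ℕ in atTop, 2 * (3 * D) ≤ r ^ k :=
    (tendsto_pow_atTop_atTop_of_one_lt hr1).eventually_ge_atTop _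
  have h2 : ∀ᶠ k : ℕ in atTop, 3 ^ m * M / t 0 < (2 : ℝ) ^ k :=
    (tendsto_pow_atTop_atTop_of_one_lt (by norm_num : (1 : ℝ) < 2)).eventually_gt_atTop _
  have h3 : ∀ᶠ k : ℕ in atTop, 1 ≤ r ^ k / 2 :=
    ((tendsto_pow_atTop_atTop_of_one_lt hr1).atTop_div_const (by norm_num)).eventually_ge_atTop _
  obtain ⟨k, hk1, hk2, hk3, hk⟩ := (h1.and (h2.and (h3.and (eventually_ge_atTop 3)))).exists
  have h := hall k hk
  rw [div_lt_iff₀ ht0] at hk2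
  have e : (r ^ k) ^ k = 2 ^ k * (r ^ k / 2) ^ k := by rw [← mul_pow]; ring_nf
  have h5 : (3 * D) ^ k ≤ (r ^ k / 2) ^ k := by
    gcongr
    linarith
  have h6 : 1 ≤ (r ^ k / 2) ^ k := one_le_pow₀ hk3
  rw [e] at h
  have h7 : 3 ^ m * M * (3 * D) ^ k ≤ 3 ^ m * M * (r ^ k / 2) ^ k := by gcongr
  nlinarith

/-! ### The weighted `ℓ²` norm -/

/-- The squared norm of a sequence in `ℓ²` with the normalized reversible weight. -/
def wsum (p : ℝ) (f : ℕ → ℂ) : ℝ≥0∞ := ∑' x, ‖f x‖ₑ ^ 2 * ENNReal.ofReal (weight p x)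

lemma IsReversible.measure_singleton_ne_top {p : ℝ} {π : Measure ℕ} [SigmaFinite π]
    (_h : IsReversible p π) (x : ℕ) : π {x} ≠ ∞ :=
  ne_top_of_le_ne_top (measure_spanningSets_lt_top π (spanningSetsIndex π x)).ne
    (measure_mono (Set.singleton_subset_iff.mpr (mem_spanningSetsIndex π x)))

/-- Detailed balance fixes the measure up to scale, so `ℓ²` estimates can be made with the explicit
`weight`. -/
lemma IsReversible.measure_singleton_eq {p : ℝ} (hp : p ∈ Set.Ioo (0 : ℝ) 1) {π : Measure ℕ}
    (h : IsReversible p π) (x : ℕ) : π {x} = π {0} * ENNReal.ofReal (weight p x) := by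
  induction x with
  | zero => simp [weight]
  | succ x ih =>
    have hl : ENNReal.ofReal (stepLeft p (x + 1)) ≠ 0 := by simpa using stepLeft_pos hp x
    rw [← ENNReal.mul_left_inj hl ENNReal.ofReal_ne_top, ← h.balance_succ, ih, mul_assoc, mul_assoc,
      ← ENNReal.ofReal_mul (weight_pos hp _).le, ← ENNReal.ofReal_mul (weight_pos hp _).le,
      weight_balance hp]

lemma IsReversible.eLpNorm_eq {p : ℝ} (hp : p ∈ Set.Ioo (0 : ℝ) 1) {π : Measure ℕ}
    (h : IsReversible p π) (f : ℕ → ℂ) :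
    eLpNorm f 2 π = (π {0} * wsum p f) ^ (1 / 2 : ℝ) := by
  rw [eLpNorm_two, wsum, ← ENNReal.tsum_mul_left]
  congr 2
  funext x
  rw [h.measure_singleton_eq hp x, ENNReal.rpow_ofNat]
  ring

lemma IsReversible.memLp_iff {p : ℝ} (hp : p ∈ Set.Ioo (0 : ℝ) 1) {π : Measure ℕ} [SigmaFinite π]
    (h : IsReversible p π) (f : ℕ → ℂ) : MemLp f 2 π ↔ wsum p f ≠ ∞ := by
  have h0 := h.singleton_ne_zero hp 0
  have htop := h.measure_singleton_ne_top 0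
  rw [MemLp, and_iff_right (measurable_of_countable f).aestronglyMeasurable, h.eLpNorm_eq hp,
    ENNReal.rpow_lt_top_iff_of_pos (by norm_num), ENNReal.mul_lt_top_iff]
  constructor
  · rintro (h1 | h1 | h1)
    · exact h1.2.ne
    · exact absurd h1 h0
    · rw [h1]; exact ENNReal.zero_ne_top
  · exact fun h1 => Or.inl ⟨htop.lt_top, h1.lt_top⟩

lemma coeFn_jacobiOp {p : ℝ} (hp : p ∈ Set.Ioo (0 : ℝ) 1) {π : Measure ℕ} (hπ : IsReversible p π)
    (v : ℕ → ℝ) (hv : ∃ C, ∀ x, |v x| ≤ C) (f : Lp ℂ 2 π) :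
    (jacobiOp hp hπ v hv f : ℕ → ℂ) = act p v f :=
  hπ.eq_of_ae hp (MemLp.coeFn_toLp (memLp_act hp hπ hv f))

lemma coeFn_sub_jacobiOp {p : ℝ} (hp : p ∈ Set.Ioo (0 : ℝ) 1) {π : Measure ℕ}
    (hπ : IsReversible p π) (v : ℕ → ℝ) (hv : ∃ C, ∀ x, |v x| ≤ C) (E : ℝ) (f : Lp ℂ 2 π) :
    ((algebraMap ℂ (Lp ℂ 2 π →L[ℂ] Lp ℂ 2 π) E - jacobiOp hp hπ v hv) f : ℕ → ℂ)
      = -act p (fun x => v x - E) f := by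
  rw [_root_.sub_apply, hπ.eq_of_ae hp (Lp.coeFn_sub _ _), coeFn_jacobiOp,
    Algebra.algebraMap_eq_smul_one, _root_.smul_apply, one_apply_eq_self,
    hπ.eq_of_ae hp (Lp.coeFn_smul _ _)]
  funext x
  simp only [act, Pi.sub_apply, Pi.smul_apply, Pi.neg_apply, smul_eq_mul]
  push_cast
  ring

lemma wsum_neg (p : ℝ) (f : ℕ → ℂ) : wsum p (-f) = wsum p f := by
  simp [wsum]

/-- A quantitative form of membership in the resolvent set. -/
lemma exists_wsum_le_of_mem_resolventSet {p : ℝ} (hp : p ∈ Set.Ioo (0 : ℝ) 1) {π : Measure ℕ}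
    [SigmaFinite π] (hπ : IsReversible p π) {v : ℕ → ℝ} {hv : ∃ C, ∀ x, |v x| ≤ C} {E : ℝ}
    (hE : (E : ℂ) ∈ resolventSet ℂ (jacobiOp hp hπ v hv)) :
    ∃ C : ℝ, 0 < C ∧ ∀ f : ℕ → ℂ, wsum p f ≠ ∞ →
      wsum p f ≤ ENNReal.ofReal C * wsum p (act p (fun x => v x - E) f) := by
  obtain ⟨U, hU⟩ := spectrum.mem_resolventSet_iff.mp hE
  set V : Lp ℂ 2 π →L[ℂ] Lp ℂ 2 π := ↑U⁻¹ with hV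
  refine ⟨‖V‖ ^ 2 + 1, by positivity, fun f hf => ?_⟩
  have hmem := (hπ.memLp_iff hp f).mpr hf
  set F := hmem.toLp f with hF
  have hFf : (F : ℕ → ℂ) = f := hπ.eq_of_ae hp hmem.coeFn_toLp
  have hVU : V ((U : Lp ℂ 2 π →L[ℂ] Lp ℂ 2 π) F) = F := by
    rw [← mul_apply_eq_comp, hV, Units.inv_mul, one_apply_eq_self]
  have hnorm : ‖F‖ₑ ≤ ‖V‖ₑ * ‖(U : Lp ℂ 2 π →L[ℂ] Lp ℂ 2 π) F‖ₑ := by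
    conv_lhs => rw [← hVU]
    exact V.le_opENorm _
  rw [Lp.enorm_def, Lp.enorm_def, hU, coeFn_sub_jacobiOp, hFf, hπ.eLpNorm_eq hp, hπ.eLpNorm_eq hp,
    wsum_neg] at hnorm
  have h0 := hπ.singleton_ne_zero hp 0
  have htop := hπ.measure_singleton_ne_top 0
  have hsq := pow_le_pow_left' hnorm 2
  rw [mul_pow, ← ENNReal.rpow_natCast, ← ENNReal.rpow_natCast (_ ^ _), ← ENNReal.rpow_mul,
    ← ENNReal.rpow_mul] at hsq
  norm_num at hsq
  rw [mul_left_comm, ENNReal.mul_le_mul_iff_right h0 htop] at hsq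
  refine hsq.trans ?_
  gcongr
  rw [← ofReal_norm, ← ENNReal.ofReal_pow (norm_nonneg _)]
  exact ENNReal.ofReal_le_ofReal (by linarith)

lemma wsum_ofReal {p : ℝ} (hp : p ∈ Set.Ioo (0 : ℝ) 1) {g : ℕ → ℝ} {N : ℕ}
    (hg : ∀ x, N ≤ x → g x = 0) :
    wsum p (fun x => (g x : ℂ)) = ENNReal.ofReal (∑ x ∈ Finset.range N, weight p x * g x ^ 2) := by
  rw [wsum, tsum_eq_sum (s := Finset.range N), ENNReal.ofReal_sum_of_nonneg]
  · refine Finset.sum_congr rfl fun x _ => ?_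
    rw [← ofReal_norm, Complex.norm_real, Real.norm_eq_abs, ← ENNReal.ofReal_pow (abs_nonneg _),
      sq_abs, ← ENNReal.ofReal_mul (sq_nonneg _), mul_comm]
  · exact fun x _ => mul_nonneg (weight_pos hp x).le (sq_nonneg _)
  · intro x hx
    rw [hg x (by simpa using hx)]
    simp

/-- The energy of an orbit through `0` lies in the spectrum. -/
lemma not_mem_resolventSet_of_zero {p : ℝ} (hp : p ∈ Set.Ioo (0 : ℝ) 1) {π : Measure ℕ}
    [SigmaFinite π] (hπ : IsReversible p π) {n : ℕ} {v : ℕ → ℝ} {hvb : ∃ C, ∀ x, |v x| ≤ C}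
    (hv : BlockSymmetric n v) {m : ℕ} (hm : n ≤ m) {E : ℝ}
    (hE : (phi p v (3 ^ m)).eval (-E) = 0) :
    (E : ℂ) ∉ resolventSet ℂ (jacobiOp hp hπ v hvb) := by
  intro hres
  obtain ⟨C, hC, hCle⟩ := exists_wsum_le_of_mem_resolventSet hp hπ hres
  obtain ⟨M, D, hM, hD, hpoly⟩ := exists_weight_mul_phi_sq_le hp hv hm hE
  set φ : ℕ → ℝ := fun x => (phi p v x).eval (-E) with hφ
  have hrec := eval_phi_rec hp v (-E)
  refine not_forall_growth (t := fun x => weight p x * φ x ^ 2) (C := C)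
    (fun x => mul_nonneg (weight_pos hp x).le (sq_nonneg _)) (by simp [hφ, phi_zero, weight]) hC hM hD
    (fun K => ?_) hpoly
  -- Shnol's argument: the cut-off solution satisfies the eigenvalue equation except at `K` and `K +
  -- 1`, where `h` records the defect. The resolvent bound thus estimates a whole partial sum by two
  -- boundary terms.
  set g : ℕ → ℝ := fun x => if x ≤ K then φ x else 0 with hg
  set h : ℕ → ℝ := fun x => if x = K then stepRight p K * φ (K + 1)
    else if x = K + 1 then -(stepLeft p (K + 1) * φ K) else 0 with hh
  have hgK : ∀ x, K + 1 ≤ x → g x = 0 := fun x hx => if_neg (by omega)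
  have hhK : ∀ x, K + 2 ≤ x → h x = 0 := fun x hx => by
    rw [hh]
    simp only
    rw [if_neg (by omega), if_neg (by omega)]
  have hreal : ∀ x, (v x - E) * g x - stepLeft p x * g (x - 1) - stepRight p x * g (x + 1) = h x := by
    intro x
    have hr : stepRight p x * φ (x + 1) = (-E + v x) * φ x - stepLeft p x * φ (x - 1) := hrec x
    simp only [hg, hh]
    rcases lt_trichotomy x K with hx | hx | hx
    · rw [if_pos hx.le, if_pos (by omega), if_pos (by omega), if_neg (by omega), if_neg (by omega)]
      linear_combination -hr
    · rw [if_pos hx.le, if_pos (by omega), if_neg (by omega), if_pos hx, ← hx]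
      linear_combination -hr
    · rw [if_neg (by omega), if_neg (show ¬ x + 1 ≤ K by omega), if_neg (show ¬ x = K by omega)]
      by_cases hx1 : x = K + 1
      · rw [if_pos (by omega), if_pos hx1, hx1, Nat.add_sub_cancel]
        ring
      · rw [if_neg (by omega), if_neg hx1]
        ring
  have hact : act p (fun x => v x - E) (fun x => (g x : ℂ)) = fun x => (h x : ℂ) := by
    funext x
    rw [← hreal x, act]
    push_cast
    ring
  have hfin := hCle (fun x => (g x : ℂ)) (by rw [wsum_ofReal hp hgK]; exact ENNReal.ofReal_ne_top)
  rw [hact, wsum_ofReal hp hgK, wsum_ofReal hp hhK, ← ENNReal.ofReal_mul hC.le,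
    ENNReal.ofReal_le_ofReal_iff (mul_nonneg hC.le
      (Finset.sum_nonneg fun x _ => mul_nonneg (weight_pos hp x).le (sq_nonneg _)))] at hfin
  have e1 : ∑ x ∈ Finset.range (K + 1), weight p x * g x ^ 2
      = ∑ x ∈ Finset.range (K + 1), weight p x * φ x ^ 2 :=
    Finset.sum_congr rfl fun x hx => by
      rw [hg]
      simp only
      rw [if_pos (Nat.le_of_lt_succ (Finset.mem_range.mp hx))]
  have e2 : ∑ x ∈ Finset.range (K + 2), weight p x * h x ^ 2
      = weight p K * (stepRight p K * φ (K + 1)) ^ 2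
        + weight p (K + 1) * (stepLeft p (K + 1) * φ K) ^ 2 := by
    rw [Finset.sum_range_succ, Finset.sum_range_succ, Finset.sum_eq_zero, zero_add]
    · simp [hh]
    · intro x hx
      have := Finset.mem_range.mp hx
      simp only [hh]
      rw [if_neg (by omega), if_neg (by omega)]
      ring
  rw [e1, e2] at hfin
  refine hfin.trans (mul_le_mul_of_nonneg_left ?_ hC.le)
  have hb := weight_balance hp K
  have hR := stepRight_pos hp K
  have hL := stepLeft_pos hp K
  have hR1 := stepRight_le hp K
  have hL1 := stepLeft_le hp (K + 1)
  have hwK := weight_pos hp K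
  have hwK1 := weight_pos hp (K + 1)
  -- Detailed balance moves the weight across the edge, leaving a factor `stepLeft * stepRight ≤ 1`.
  have b1 : weight p K * (stepRight p K * φ (K + 1)) ^ 2 ≤ weight p (K + 1) * φ (K + 1) ^ 2 := by
    rw [show weight p K * (stepRight p K * φ (K + 1)) ^ 2
      = (weight p (K + 1) * φ (K + 1) ^ 2) * (stepLeft p (K + 1) * stepRight p K) by
        linear_combination -(stepRight p K * φ (K + 1) ^ 2) * hb]
    exact mul_le_of_le_one_right (by positivity) (mul_le_one₀ hL1 hR.le hR1)
  have b2 : weight p (K + 1) * (stepLeft p (K + 1) * φ K) ^ 2 ≤ weight p K * φ K ^ 2 := by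
    rw [show weight p (K + 1) * (stepLeft p (K + 1) * φ K) ^ 2
      = (weight p K * φ K ^ 2) * (stepRight p K * stepLeft p (K + 1)) by
        linear_combination (stepLeft p (K + 1) * φ K ^ 2) * hb]
    exact mul_le_of_le_one_right (by positivity) (mul_le_one₀ hR1 hL.le hL1)
  linarith

/-- Energies in the resolvent set escape under the spectral decimation. -/
theorem exists_one_lt_of_mem_resolventSet {p : ℝ} (hp : p ∈ Set.Ioo (0 : ℝ) 1) {π : Measure ℕ}
    [SigmaFinite π] (hπ : IsReversible p π) {n : ℕ} {v : ℕ → ℝ} {hvb : ∃ C, ∀ x, |v x| ≤ C}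
    (hv : BlockSymmetric n v) {E : ℝ} (hE : (E : ℂ) ∈ resolventSet ℂ (jacobiOp hp hπ v hvb)) :
    ∃ m, n ≤ m ∧ 1 < |(phi p v (3 ^ m)).eval (-E)| := by
  by_contra! hle
  -- A bounded orbit only yields spectrum arbitrarily near `E`; openness of the resolvent set closes
  -- the gap.
  have hopen : ∀ᶠ x : ℝ in 𝓝 E, (x : ℂ) ∈ resolventSet ℂ (jacobiOp hp hπ v hvb) :=
    Complex.continuous_ofReal.continuousAt.eventually
      ((spectrum.isOpen_resolventSet _).mem_nhds hE)
  obtain ⟨δ, hδ, hball⟩ := Metric.eventually_nhds_iff.mp hopen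
  obtain ⟨m, hm, t, ht, h0⟩ := exists_zero_near hp hv hle hδ
  refine not_mem_resolventSet_of_zero hp hπ hv hm (E := -t) (by rwa [neg_neg]) (hball ?_)
  rw [Real.dist_eq, ← abs_neg]
  convert ht using 2
  ring

/-! ### The resolvent set of the Laplacian -/

/-- Unique solvability in `ℓ²` of the equation `(w - A) g = h`, where `A` is the Markov operator. -/
def Solvable (p : ℝ) (π : Measure ℕ) (w : ℝ) : Prop :=
  ∀ h : ℕ → ℂ, MemLp h 2 π → ∃! g : ℕ → ℂ, MemLp g 2 π ∧ act p (fun _ => w) g = h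

lemma mem_resolventSet_jacobiOp_iff {p : ℝ} (hp : p ∈ Set.Ioo (0 : ℝ) 1) {π : Measure ℕ}
    (hπ : IsReversible p π) {c : ℝ} {hv : ∃ C, ∀ x : ℕ, |(fun _ => c : ℕ → ℝ) x| ≤ C} {E : ℝ} :
    (E : ℂ) ∈ resolventSet ℂ (jacobiOp hp hπ (fun _ => c) hv) ↔ Solvable p π (c - E) := by
  rw [spectrum.mem_resolventSet_iff, ContinuousLinearMap.isUnit_iff_bijective]
  set T := algebraMap ℂ (Lp ℂ 2 π →L[ℂ] Lp ℂ 2 π) E - jacobiOp hp hπ (fun _ => c) hv with hT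
  have hcoe : ∀ F : Lp ℂ 2 π, (T F : ℕ → ℂ) = -act p (fun _ => c - E) F :=
    coeFn_sub_jacobiOp hp hπ _ hv E
  rw [Function.bijective_iff_existsUnique]
  constructor
  · intro hbij h hh
    obtain ⟨F, hF, huniq⟩ := hbij (-hh.toLp h)
    have hh' : (hh.toLp h : ℕ → ℂ) = h := hπ.eq_of_ae hp hh.coeFn_toLp
    refine ⟨F, ⟨Lp.memLp F, ?_⟩, ?_⟩
    · have h1 := hcoe F
      rw [hF, hπ.eq_of_ae hp (Lp.coeFn_neg _), hh', neg_inj] at h1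
      exact h1.symm
    · rintro g ⟨hg, hgh⟩
      have hg' : (hg.toLp g : ℕ → ℂ) = g := hπ.eq_of_ae hp hg.coeFn_toLp
      rw [← hg', huniq (hg.toLp g)]
      apply Lp.ext
      rw [hcoe, hg', hgh, hπ.eq_of_ae hp (Lp.coeFn_neg _), hh']
  · intro hsol H
    obtain ⟨g, ⟨hg, hgh⟩, huniq⟩ := hsol (-H) (Lp.memLp H).neg
    have hg' : (hg.toLp g : ℕ → ℂ) = g := hπ.eq_of_ae hp hg.coeFn_toLp
    refine ⟨hg.toLp g, ?_, fun F hF => ?_⟩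
    · apply Lp.ext
      rw [hcoe, hg', hgh, neg_neg]
    · apply Lp.ext
      rw [hg', ← huniq F ⟨Lp.memLp F, ?_⟩]
      have h1 := hcoe F
      simp only at hF
      rw [hF] at h1
      rw [h1, neg_neg]

/-- The crude norm bound `2` for the Markov operator is enough, because escaping orbits pass every
threshold. -/
lemma solvable_of_two_lt {p : ℝ} (hp : p ∈ Set.Ioo (0 : ℝ) 1) {π : Measure ℕ}
    (hπ : IsReversible p π) {w : ℝ} (hw : 2 < |w|) : Solvable p π w := by
  have hv : ∃ C, ∀ x : ℕ, |(fun _ => 0 : ℕ → ℝ) x| ≤ C := ⟨0, fun _ => by simp⟩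
  have h := (mem_resolventSet_jacobiOp_iff hp hπ (hv := hv) (E := -w)).mp ?_
  · simpa using h
  · apply spectrum.mem_resolventSet_of_norm_lt_mul
    have hJ : ‖jacobiOp hp hπ (fun _ => 0) hv‖ ≤ 2 := by
      refine ContinuousLinearMap.opNorm_le_bound _ (by norm_num) fun F => ?_
      rw [Lp.norm_def, Lp.norm_def, coeFn_jacobiOp]
      have h1 := eLpNorm_act hp hπ (v := fun _ => 0) (C := 0) (fun _ => by simp) F
      refine (ENNReal.toReal_mono ?_ h1).trans_eq ?_
      · exact ENNReal.mul_ne_top ENNReal.ofReal_ne_top (Lp.eLpNorm_ne_top F)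
      · rw [ENNReal.toReal_mul, ENNReal.toReal_ofReal (by norm_num), zero_add]
    have hone : ‖(1 : Lp ℂ 2 π →L[ℂ] Lp ℂ 2 π)‖ ≤ 1 := ContinuousLinearMap.norm_id_le
    rw [Complex.norm_real, norm_neg, Real.norm_eq_abs]
    have := norm_nonneg (jacobiOp hp hπ (fun _ => 0) hv)
    nlinarith

/-! ### Block elimination in `ℓ²`. -/

lemma memLp_comp_injective {p : ℝ} (hp : p ∈ Set.Ioo (0 : ℝ) 1) {π : Measure ℕ} [SigmaFinite π]
    (hπ : IsReversible p π) {σ : ℕ → ℕ} (hσ : Function.Injective σ) {B : ℝ}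
    (hB : ∀ x, weight p x ≤ B * weight p (σ x)) {f : ℕ → ℂ} (hf : MemLp f 2 π) :
    MemLp (fun x => f (σ x)) 2 π := by
  rw [hπ.memLp_iff hp] at hf ⊢
  refine ne_top_of_le_ne_top (ENNReal.mul_ne_top (ENNReal.ofReal_ne_top (r := B)) hf) ?_
  calc wsum p (fun x => f (σ x))
      ≤ ∑' x, ENNReal.ofReal B * (‖f (σ x)‖ₑ ^ 2 * ENNReal.ofReal (weight p (σ x))) := by
        refine ENNReal.tsum_le_tsum fun x => ?_
        rw [mul_left_comm, ← ENNReal.ofReal_mul' (weight_pos hp _).le]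
        gcongr
        exact hB x
    _ = ENNReal.ofReal B * ∑' x, ‖f (σ x)‖ₑ ^ 2 * ENNReal.ofReal (weight p (σ x)) :=
        ENNReal.tsum_mul_left
    _ ≤ _ := by
        gcongr
        exact ENNReal.tsum_comp_le_tsum_of_injective hσ
          fun x => ‖f x‖ₑ ^ 2 * ENNReal.ofReal (weight p x)

lemma memLp_comp_div_three {p : ℝ} (hp : p ∈ Set.Ioo (0 : ℝ) 1) {π : Measure ℕ} [SigmaFinite π]
    (hπ : IsReversible p π) {f : ℕ → ℂ} (hf : MemLp f 2 π) : MemLp (fun x => f (x / 3)) 2 π := by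
  rw [hπ.memLp_iff hp] at hf ⊢
  set B := (min p (1 - p))⁻¹ ^ 3
  refine ne_top_of_le_ne_top
    (ENNReal.mul_ne_top (ENNReal.mul_ne_top (ENNReal.ofReal_ne_top (r := B)) hf)
      (ENNReal.natCast_ne_top 3)) ?_
  calc wsum p (fun x => f (x / 3))
      ≤ ∑' x, ENNReal.ofReal B * (‖f (x / 3)‖ₑ ^ 2 * ENNReal.ofReal (weight p (x / 3))) := by
        refine ENNReal.tsum_le_tsum fun x => ?_
        rw [mul_left_comm, ← ENNReal.ofReal_mul' (weight_pos hp _).le]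
        gcongr
        have h := weight_block_le hp 1 (x / 3) (i := x % 3) (by omega)
        rwa [pow_one, Nat.div_add_mod] at h
    _ = ENNReal.ofReal B * ∑' x, ‖f (x / 3)‖ₑ ^ 2 * ENNReal.ofReal (weight p (x / 3)) :=
        ENNReal.tsum_mul_left
    _ = ENNReal.ofReal B * ∑' y : ℕ × Fin 3, ‖f y.1‖ₑ ^ 2 * ENNReal.ofReal (weight p y.1) := by
        rw [← (Nat.divModEquiv 3).tsum_eq]
        rfl
    _ = ENNReal.ofReal B * wsum p f * (3 : ℕ) := by
        rw [ENNReal.tsum_prod (f := fun (y : ℕ) (_ : Fin 3) =>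
          ‖f y‖ₑ ^ 2 * ENNReal.ofReal (weight p y)), mul_assoc, wsum, ← ENNReal.tsum_mul_right]
        congr 2
        funext y
        rw [tsum_fintype, Finset.sum_const, Finset.card_univ, Fintype.card_fin, nsmul_eq_mul,
          mul_comm]
    _ ≤ _ := le_rfl

/-- The right-hand side of the decimated equation. -/
def decimatedSource (p w : ℝ) (r : ℕ → ℂ) (y : ℕ) : ℂ :=
  ((p * (1 - p) : ℝ) : ℂ)⁻¹ * (((w ^ 2 - p ^ 2 : ℝ) : ℂ) * r (3 * y)
    + stepLeft p y * (p * r (3 * (y - 1) + 1) + w * r (3 * (y - 1) + 2))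
    + stepRight p y * (w * r (3 * y + 1) + p * r (3 * y + 2)))

/-- The first interior value of a block in terms of the boundary values and the source. -/
def interiorOne (p w : ℝ) (r g : ℕ → ℂ) (y : ℕ) : ℂ :=
  ((w ^ 2 - p ^ 2 : ℝ) : ℂ)⁻¹ * (w * ((1 - p) * g y + r (3 * y + 1))
    + p * ((1 - p) * g (y + 1) + r (3 * y + 2)))

/-- The second interior value of a block in terms of the boundary values and the source. -/
def interiorTwo (p w : ℝ) (r g : ℕ → ℂ) (y : ℕ) : ℂ :=
  ((w ^ 2 - p ^ 2 : ℝ) : ℂ)⁻¹ * (p * ((1 - p) * g y + r (3 * y + 1))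
    + w * ((1 - p) * g (y + 1) + r (3 * y + 2)))

lemma act_block {p w : ℝ} (f : ℕ → ℂ) (y : ℕ) :
    act p (fun _ => w) f (3 * y + 1) = w * f (3 * y + 1) - (1 - p) * f (3 * y) - p * f (3 * y + 2) ∧
    act p (fun _ => w) f (3 * y + 2)
      = w * f (3 * y + 2) - p * f (3 * y + 1) - (1 - p) * f (3 * (y + 1)) := by
  have r1 : stepRight p (3 * y + 1) = p := by
    simpa using stepRight_pow_mul p 0 (c := 3 * y + 1) (by omega)
  have l1 : stepLeft p (3 * y + 1) = 1 - p := by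
    simpa using stepLeft_pow_mul p 0 (c := 3 * y + 1) (by omega)
  have r2 : stepRight p (3 * y + 2) = 1 - p := by
    simpa using stepRight_pow_mul p 0 (c := 3 * y + 2) (by omega)
  have l2 : stepLeft p (3 * y + 2) = p := by
    simpa using stepLeft_pow_mul p 0 (c := 3 * y + 2) (by omega)
  constructor
  · rw [act, r1, l1, Nat.add_sub_cancel, add_assoc]
    push_cast
    rfl
  · rw [act, r2, l2]
    push_cast
    rfl

lemma act_vertex {p w : ℝ} (f : ℕ → ℂ) (y : ℕ) :
    act p (fun _ => w) f (3 * y) = w * f (3 * y) - stepLeft p y * f (3 * (y - 1) + 2)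
      - stepRight p y * f (3 * y + 1) := by
  have r0 : stepRight p (3 * y) = stepRight p y := by simpa using stepRight_pow_mul_self p 1 y
  have l0 : stepLeft p (3 * y) = stepLeft p y := by simpa using stepLeft_pow_mul_self p 1 y
  rw [act, r0, l0]
  rcases y with _ | y
  · simp [stepLeft]
  · rw [show 3 * (y + 1) - 1 = 3 * (y + 1 - 1) + 2 by omega]

/-- The two interior equations of a block form a linear system with matrix `(w, -p; -p, w)` of
determinant `w ^ 2 - p ^ 2`. -/
lemma interior_iff {p w : ℝ} (hD : w ^ 2 - p ^ 2 ≠ 0) {r f : ℕ → ℂ} (y : ℕ) :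
    (act p (fun _ => w) f (3 * y + 1) = r (3 * y + 1) ∧
      act p (fun _ => w) f (3 * y + 2) = r (3 * y + 2)) ↔
    f (3 * y + 1) = interiorOne p w r (fun z => f (3 * z)) y ∧
      f (3 * y + 2) = interiorTwo p w r (fun z => f (3 * z)) y := by
  have hD' : (w : ℂ) ^ 2 - (p : ℂ) ^ 2 ≠ 0 := by exact_mod_cast hD
  obtain ⟨h1, h2⟩ := act_block (p := p) (w := w) f y
  rw [h1, h2, interiorOne, interiorTwo]
  push_cast
  rw [eq_inv_mul_iff_mul_eq₀ hD', eq_inv_mul_iff_mul_eq₀ hD']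
  constructor
  · rintro ⟨e1, e2⟩
    exact ⟨by linear_combination (w : ℂ) * e1 + p * e2, by linear_combination (p : ℂ) * e1 + w * e2⟩
  · rintro ⟨e1, e2⟩
    constructor
    · apply mul_left_cancel₀ hD'
      linear_combination (w : ℂ) * e1 - p * e2
    · apply mul_left_cancel₀ hD'
      linear_combination (w : ℂ) * e2 - p * e1

/-- A Schur complement: after substitution of the interior values, `w ^ 2 - p ^ 2` times the
equation at a block end is `p * (1 - p)` times the decimated equation. -/
lemma vertex_iff {p : ℝ} (hp : p ∈ Set.Ioo (0 : ℝ) 1) {w : ℝ} (hD : w ^ 2 - p ^ 2 ≠ 0)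
    {r f : ℕ → ℂ} (h1 : ∀ y, f (3 * y + 1) = interiorOne p w r (fun z => f (3 * z)) y)
    (h2 : ∀ y, f (3 * y + 2) = interiorTwo p w r (fun z => f (3 * z)) y) (y : ℕ) :
    act p (fun _ => w) f (3 * y) = r (3 * y) ↔
      act p (fun _ => (phi p 0 3).eval w) (fun z => f (3 * z)) y = decimatedSource p w r y := by
  have hD' : (w : ℂ) ^ 2 - (p : ℂ) ^ 2 ≠ 0 := by exact_mod_cast hD
  have hq : (p : ℂ) * (1 - p) ≠ 0 := by exact_mod_cast (pq_pos hp).ne'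
  have hT : (p : ℂ) * (1 - p) * ((phi p 0 3).eval w : ℝ)
      = w * (w ^ 2 - 1 + p * (1 - p)) := by
    exact_mod_cast phi_zero_three hp w
  have hLR : (stepLeft p y : ℂ) + stepRight p y = 1 := by
    exact_mod_cast stepLeft_add_stepRight p y
  -- For `y = 0` the indices differ, but the coefficient vanishes.
  have hL : (stepLeft p y : ℂ) * f (3 * (y - 1 + 1)) = stepLeft p y * f (3 * y) := by
    rcases y with _ | y
    · simp [stepLeft]
    · rfl
  have e1 := h1 y
  have e2 := h2 (y - 1)
  rw [interiorOne] at e1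
  rw [interiorTwo] at e2
  push_cast at e1 e2
  rw [eq_inv_mul_iff_mul_eq₀ hD'] at e1 e2
  rw [act_vertex, act, decimatedSource]
  push_cast
  rw [eq_inv_mul_iff_mul_eq₀ hq]
  have key : ((p : ℂ) * (1 - p)) * (((phi p 0 3).eval w : ℝ) * f (3 * y)
      - stepLeft p y * f (3 * (y - 1)) - stepRight p y * f (3 * (y + 1)))
      - ((w ^ 2 - p ^ 2) * r (3 * y)
        + stepLeft p y * (p * r (3 * (y - 1) + 1) + w * r (3 * (y - 1) + 2))
        + stepRight p y * (w * r (3 * y + 1) + p * r (3 * y + 2)))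
      = ((w : ℂ) ^ 2 - p ^ 2) * ((w * f (3 * y) - stepLeft p y * f (3 * (y - 1) + 2)
        - stepRight p y * f (3 * y + 1)) - r (3 * y)) := by
    linear_combination f (3 * y) * hT + (stepLeft p y : ℂ) * e2 + (stepRight p y : ℂ) * e1
      + w * (1 - p) * hL + w * (1 - p) * f (3 * y) * hLR
  constructor
  · intro h
    rw [h, sub_self, mul_zero] at key
    exact sub_eq_zero.mp key
  · intro h
    rw [h, sub_self] at key
    exact sub_eq_zero.mp ((mul_eq_zero.mp key.symm).resolve_left hD')

lemma act_eq_iff {p : ℝ} (hp : p ∈ Set.Ioo (0 : ℝ) 1) {w : ℝ} (hD : w ^ 2 - p ^ 2 ≠ 0)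
    {r f : ℕ → ℂ} : act p (fun _ => w) f = r ↔
      (∀ y, f (3 * y + 1) = interiorOne p w r (fun z => f (3 * z)) y) ∧
      (∀ y, f (3 * y + 2) = interiorTwo p w r (fun z => f (3 * z)) y) ∧
      act p (fun _ => (phi p 0 3).eval w) (fun z => f (3 * z)) = decimatedSource p w r := by
  constructor
  · intro h
    have hi := fun y => (interior_iff hD y).mp ⟨congrFun h (3 * y + 1), congrFun h (3 * y + 2)⟩
    have h1 := fun y => (hi y).1
    have h2 := fun y => (hi y).2
    exact ⟨h1, h2, funext fun y => (vertex_iff hp hD h1 h2 y).mp (congrFun h (3 * y))⟩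
  · rintro ⟨h1, h2, h⟩
    funext x
    have hi := (interior_iff hD (x / 3)).mpr ⟨h1 (x / 3), h2 (x / 3)⟩
    have h0 := (vertex_iff hp hD h1 h2 (x / 3)).mpr (congrFun h (x / 3))
    have hx : x = 3 * (x / 3) ∨ x = 3 * (x / 3) + 1 ∨ x = 3 * (x / 3) + 2 := by omega
    rcases hx with hx | hx | hx
    · rwa [← hx] at h0
    · have := hi.1; rwa [← hx] at this
    · have := hi.2; rwa [← hx] at this

lemma memLp_left {p : ℝ} (hp : p ∈ Set.Ioo (0 : ℝ) 1) {π : Measure ℕ} (hπ : IsReversible p π)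
    {f : ℕ → ℂ} (hf : MemLp f 2 π) : MemLp (fun x => (stepLeft p x : ℂ) * f (x - 1)) 2 π :=
  ⟨(measurable_of_countable _).aestronglyMeasurable, (eLpNorm_left hp hπ f).trans_lt hf.2⟩

lemma memLp_stepRight_mul {p : ℝ} (hp : p ∈ Set.Ioo (0 : ℝ) 1) {π : Measure ℕ} {f : ℕ → ℂ}
    (hf : MemLp f 2 π) : MemLp (fun x => (stepRight p x : ℂ) * f x) 2 π := by
  refine hf.of_le (measurable_of_countable _).aestronglyMeasurable (Eventually.of_forall fun x => ?_)
  rw [norm_mul, Complex.norm_real, Real.norm_of_nonneg (stepRight_pos hp x).le]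
  exact mul_le_of_le_one_left (norm_nonneg _) (stepRight_le hp x)

/-- Solvability lifts along the spectral decimation. -/
lemma Solvable.of_phi_three {p : ℝ} (hp : p ∈ Set.Ioo (0 : ℝ) 1) {π : Measure ℕ} [SigmaFinite π]
    (hπ : IsReversible p π) {w : ℝ} (hD : w ^ 2 - p ^ 2 ≠ 0)
    (hW : Solvable p π ((phi p 0 3).eval w)) : Solvable p π w := by
  set ρ := (min p (1 - p))⁻¹
  have hρ : 0 ≤ ρ := inv_nonneg.mpr (min_pos_of_mem hp).le
  have w1 : ∀ y, weight p y ≤ ρ * weight p (3 * y + 1) := fun y => by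
    rw [← weight_three_mul hp]; exact weight_le_succ hp _
  have w2 : ∀ y, weight p y ≤ ρ * ρ * weight p (3 * y + 2) := fun y => by
    rw [mul_assoc]
    exact (w1 y).trans (mul_le_mul_of_nonneg_left (weight_le_succ hp _) hρ)
  have c0 : ∀ {f : ℕ → ℂ}, MemLp f 2 π → MemLp (fun y => f (3 * y)) 2 π := fun hf =>
    memLp_comp_injective hp hπ (fun a b h => by simpa using h) (B := 1)
      (fun y => by rw [weight_three_mul hp, one_mul]) hf
  have c1 : ∀ {f : ℕ → ℂ}, MemLp f 2 π → MemLp (fun y => f (3 * y + 1)) 2 π := fun hf =>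
    memLp_comp_injective hp hπ (fun a b h => by simpa using h) w1 hf
  have c2 : ∀ {f : ℕ → ℂ}, MemLp f 2 π → MemLp (fun y => f (3 * y + 2)) 2 π := fun hf =>
    memLp_comp_injective hp hπ (fun a b h => by simpa using h) w2 hf
  have cs : ∀ {f : ℕ → ℂ}, MemLp f 2 π → MemLp (fun y => f (y + 1)) 2 π := fun hf =>
    memLp_comp_injective hp hπ (fun a b h => by simpa using h) (weight_le_succ hp) hf
  intro r hr
  have hsource : MemLp (decimatedSource p w r) 2 π := by
    refine MemLp.const_mul (((c0 hr).const_mul _).add ?_ |>.add ?_) _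
    · exact memLp_left hp hπ (f := fun y => p * r (3 * y + 1) + w * r (3 * y + 2))
        (((c1 hr).const_mul _).add ((c2 hr).const_mul _))
    · exact memLp_stepRight_mul hp (((c1 hr).const_mul _).add ((c2 hr).const_mul _))
  obtain ⟨g, ⟨hg, hgeq⟩, huniq⟩ := hW _ hsource
  have hF1 : MemLp (interiorOne p w r g) 2 π :=
    MemLp.const_mul (((hg.const_mul _).add (c1 hr) |>.const_mul _).add
      (((cs hg).const_mul _).add (c2 hr) |>.const_mul _)) _
  have hF2 : MemLp (interiorTwo p w r g) 2 π :=
    MemLp.const_mul (((hg.const_mul _).add (c1 hr) |>.const_mul _).add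
      (((cs hg).const_mul _).add (c2 hr) |>.const_mul _)) _
  set f : ℕ → ℂ := fun x => if x % 3 = 0 then g (x / 3)
    else if x % 3 = 1 then interiorOne p w r g (x / 3) else interiorTwo p w r g (x / 3) with hf
  have f0 : (fun z => f (3 * z)) = g := by
    funext z
    simp only [hf]
    rw [if_pos (by omega), show 3 * z / 3 = z by omega]
  have f1 : ∀ z, f (3 * z + 1) = interiorOne p w r g z := fun z => by
    simp only [hf]
    rw [if_neg (by omega), if_pos (by omega), show (3 * z + 1) / 3 = z by omega]
  have f2 : ∀ z, f (3 * z + 2) = interiorTwo p w r g z := fun z => by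
    simp only [hf]
    rw [if_neg (by omega), if_neg (by omega), show (3 * z + 2) / 3 = z by omega]
  have hfmem : MemLp f 2 π := by
    refine MemLp.of_le (((memLp_comp_div_three hp hπ hg).norm.add
      (memLp_comp_div_three hp hπ hF1).norm).add (memLp_comp_div_three hp hπ hF2).norm)
      (measurable_of_countable _).aestronglyMeasurable (Eventually.of_forall fun x => ?_)
    have n0 := norm_nonneg (g (x / 3))
    have n1 := norm_nonneg (interiorOne p w r g (x / 3))
    have n2 := norm_nonneg (interiorTwo p w r g (x / 3))
    simp only [Pi.add_apply]
    rw [Real.norm_of_nonneg (by positivity)]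
    simp only [hf]
    split_ifs <;> linarith
  refine ⟨f, ⟨hfmem, ?_⟩, ?_⟩
  · rw [act_eq_iff hp hD, f0]
    exact ⟨f1, f2, hgeq⟩
  · rintro f' ⟨hf', hf'eq⟩
    obtain ⟨h1, h2, h0⟩ := (act_eq_iff hp hD).mp hf'eq
    have h0' := huniq _ ⟨c0 hf', h0⟩
    rw [h0'] at h1 h2
    funext x
    have hx : x = 3 * (x / 3) ∨ x = 3 * (x / 3) + 1 ∨ x = 3 * (x / 3) + 2 := by omega
    rcases hx with hx | hx | hx
    · rw [hx, congrFun h0' (x / 3), ← congrFun f0 (x / 3)]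
    · rw [hx, h1, f1]
    · rw [hx, h2, f2]

lemma abs_phi_pow_of_abs_eq_one {p : ℝ} (hp : p ∈ Set.Ioo (0 : ℝ) 1) {w : ℝ} (hw : |w| = 1)
    (m : ℕ) : |(phi p 0 (3 ^ m)).eval w| = 1 := by
  induction m with
  | zero => simpa [phi_one] using hw
  | succ m ih =>
    have h := eval_phi_pow_succ hp blockSymmetric_zero (Nat.zero_le m) w
    rw [← sq_abs ((phi p 0 (3 ^ m)).eval w), ih] at h
    have : (phi p 0 (3 ^ (m + 1))).eval w = (phi p 0 (3 ^ m)).eval w :=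
      mul_left_cancel₀ (pq_pos hp).ne' (by linear_combination h)
    rw [this, ih]

/-- The excluded values `w = ±p` are sent by the cubic to `∓1`, whose orbit keeps modulus one. They
therefore never occur on an escaping orbit. -/
lemma solvable_of_two_lt_phi_pow {p : ℝ} (hp : p ∈ Set.Ioo (0 : ℝ) 1) {π : Measure ℕ}
    [SigmaFinite π] (hπ : IsReversible p π) (m : ℕ) :
    ∀ w : ℝ, 2 < |(phi p 0 (3 ^ m)).eval w| → Solvable p π w := by
  induction m with
  | zero =>
    intro w hw
    exact solvable_of_two_lt hp hπ (by simpa [phi_one] using hw)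
  | succ m ih =>
    intro w hw
    rw [add_comm, phi_pow_add hp blockSymmetric_zero (Nat.zero_le 1), eval_comp, pow_one] at hw
    refine Solvable.of_phi_three hp hπ (fun hD => ?_) (ih _ hw)
    have h := phi_zero_three hp w
    have hw2 : w ^ 2 = p ^ 2 := sub_eq_zero.mp hD
    have hsq : ((phi p 0 3).eval w) ^ 2 = 1 := by
      have h2 : (p * (1 - p)) ^ 2 * ((phi p 0 3).eval w) ^ 2 = (p * (1 - p)) ^ 2 * 1 := by
        rw [← mul_pow, h, mul_pow, hw2]
        ring
      exact mul_left_cancel₀ (pow_pos (pq_pos hp) 2).ne' h2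
    rw [abs_phi_pow_of_abs_eq_one hp ((pow_eq_one_iff_of_nonneg (abs_nonneg _) two_ne_zero).mp ((sq_abs _).trans hsq)) m] at hw
    norm_num at hw

lemma phi_one_pow_eval {p : ℝ} (hp : p ∈ Set.Ioo (0 : ℝ) 1) (m : ℕ) (s : ℝ) :
    (phi p (fun _ => 1) (3 ^ m)).eval s = (phi p 0 (3 ^ m)).eval (s + 1) := by
  have h := phi_pow_mul hp (blockSymmetric_const 1) (Nat.zero_le 0) (3 ^ m)
  rw [pow_zero, one_mul, phi_one] at h
  rw [h, eval_comp, eval_add, eval_X, eval_C]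

/-- Escaping energies lie in the resolvent set of the Laplacian. -/
theorem mem_resolventSet_laplacian {p : ℝ} (hp : p ∈ Set.Ioo (0 : ℝ) 1) {π : Measure ℕ}
    [SigmaFinite π] (hπ : IsReversible p π) {m : ℕ} {E : ℝ}
    (hE : 1 < |(phi p (fun _ => 1) (3 ^ m)).eval (-E)|) :
    (E : ℂ) ∈ resolventSet ℂ (laplacian hp hπ) := by
  rw [phi_one_pow_eval hp, neg_add_eq_sub] at hE
  refine (mem_resolventSet_jacobiOp_iff hp hπ).mpr ?_
  -- After `k` more levels the modulus is at least its `3 ^ k`-th power, hence at least its `k`-th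
  -- power, which exceeds `2`.
  obtain ⟨k, hk⟩ := pow_unbounded_of_one_lt 2 hE
  refine solvable_of_two_lt_phi_pow hp hπ (m + k) _ (hk.trans_le ?_)
  rw [phi_pow_add hp blockSymmetric_zero (Nat.zero_le m), eval_comp]
  exact (pow_le_pow_right₀ hE.le (Nat.lt_pow_self (by norm_num)).le).trans (abs_pow_le_abs_phi hp hE _)

/-! ### Closed gaps and gap labels -/

/-- For `m ≥ n` the frequency times `3 ^ m` is an integer, so a block shift changes the angle by a
multiple of `2π`. Reflection uses that the cosine is even, which requires phase `0`. -/
lemma blockSymmetric_potential (β : ℝ) (n k : ℕ) :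
    BlockSymmetric n (potential β ((k : ℝ) / 3 ^ n) 0) := by
  intro m hm x i hi
  obtain ⟨d, rfl⟩ := Nat.exists_eq_add_of_le hm
  have h3 : (3 : ℝ) ^ n ≠ 0 := by positivity
  have hle : i ≤ 3 ^ (n + d) * (x + 1) := hi.trans (Nat.le_mul_of_pos_right _ x.succ_pos)
  constructor
  · have e : 2 * Real.pi * ((k : ℝ) / 3 ^ n) * ((3 ^ (n + d) * x + i : ℕ) : ℝ) + 0
        = 2 * Real.pi * ((k : ℝ) / 3 ^ n) * i + 0 + (k * 3 ^ d * x : ℕ) * (2 * Real.pi) := by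
      push_cast
      field_simp
      ring
    rw [potential, e, Real.cos_add_nat_mul_two_pi, potential]
  · have e : 2 * Real.pi * ((k : ℝ) / 3 ^ n) * ((3 ^ (n + d) * (x + 1) - i : ℕ) : ℝ) + 0
        = (k * 3 ^ d * (x + 1) : ℕ) * (2 * Real.pi)
          - (2 * Real.pi * ((k : ℝ) / 3 ^ n) * i + 0) := by
      push_cast [Nat.cast_sub hle]
      field_simp
      ring
    rw [potential, e, Real.cos_nat_mul_two_pi_sub, potential]

/-! ### Which gaps are open. -/

lemma exists_notMem_card_filter_le_eq (s : Finset ℝ) {k : ℕ} (hk : k ≤ s.card) :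
    ∃ a ∉ s, (s.filter (a ≤ ·)).card = k := by
  have key : ∀ k ≤ s.card, ∃ lo hi : Finset ℝ,
      s = lo ∪ hi ∧ (∀ x ∈ lo, ∀ y ∈ hi, x < y) ∧ hi.card = k := by
    clear hk
    induction s using Finset.induction_on_min with
    | empty => exact fun k hk => ⟨∅, ∅, by simp, by simp, by simpa [eq_comm] using hk⟩
    | insert b s hb ih =>
      have hbs : b ∉ s := fun h => (hb b h).false
      intro k hk
      rw [Finset.card_insert_of_notMem hbs] at hk
      rcases hk.eq_or_lt with rfl | hlt
      · exact ⟨∅, insert b s, by simp, by simp, Finset.card_insert_of_notMem hbs⟩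
      · obtain ⟨lo, hi, rfl, hlt', hc⟩ := ih k (by omega)
        refine ⟨insert b lo, hi, (Finset.insert_union _ _ _).symm, ?_, hc⟩
        intro x hx y hy
        rcases Finset.mem_insert.mp hx with rfl | hx
        · exact hb y (Finset.mem_union_right _ hy)
        · exact hlt' x hx y hy
  obtain ⟨lo, hi, rfl, hlt, rfl⟩ := key k hk
  obtain ⟨a, h1, h2⟩ := Order.exists_between_finsets lo hi hlt
  refine ⟨a, fun h => ?_, ?_⟩
  · rcases Finset.mem_union.mp h with h | h
    · exact (h1 a h).false
    · exact (h2 a h).false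
  · congr 1
    ext y
    simp only [Finset.mem_filter, Finset.mem_union]
    constructor
    · rintro ⟨h | h, hay⟩
      · exact absurd (h1 y h) (not_lt.mpr hay)
      · exact h
    · exact fun h => ⟨Or.inr h, (h2 y h).le⟩

/-- For `p ≠ 1/2` the critical points of the iterated decimation polynomial escape, so that every
possible gap is open. -/
lemma derivative_phi_pow_ne_zero {p : ℝ} (hp : p ∈ Set.Ioo (0 : ℝ) 1) {v : ℕ → ℝ}
    (hv : BlockSymmetric 0 v) {m : ℕ} (hpm : p = 1 / 2 → m = 0) {t : ℝ}
    (ht : |(phi p v (3 ^ m)).eval t| ≤ 1) : (derivative (phi p v (3 ^ m))).eval t ≠ 0 := by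
  induction m with
  | zero => simp [phi_one]
  | succ m ih =>
    have hp2 : p ≠ 1 / 2 := fun h => by simpa using hpm h
    have htm : |(phi p v (3 ^ m)).eval t| ≤ 1 := by
      by_contra! h
      exact (one_lt_abs_phi_pow_mono hp hv m.zero_le m.le_succ h).not_ge ht
    have hd := ih (fun h => absurd h hp2) htm
    intro h0
    have h1 := eval_phi_pow_succ hp hv m.zero_le t
    have h2 := eval_derivative_phi_pow_succ hp hv m.zero_le t
    rw [h0, mul_zero] at h2
    have hw := (mul_eq_zero.mp h2.symm).resolve_left hd
    have hW := (sq_le_one_iff_abs_le_one _).mpr ht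
    set w := (phi p v (3 ^ m)).eval t
    set W := (phi p v (3 ^ (m + 1))).eval t
    set q := p * (1 - p) with hqdef
    have hq : 0 < q := pq_pos hp
    have hq4 : 0 < 1 - 4 * q := by
      have h : 0 < (p - 1 / 2) ^ 2 := sq_pos_of_ne_zero (sub_ne_zero.mpr hp2)
      rw [hqdef]
      linarith
    -- At a critical point of the cubic `3 * w ^ 2 = 1 - q`; substitution gives the critical value,
    -- which exceeds `1` in modulus exactly because `4 * q < 1`.
    have e : 27 * q ^ 2 * (W ^ 2 - 1) = (1 - 4 * q) * (q + 2) ^ 2 := by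
      linear_combination 27 * (q * W + w * (w ^ 2 - 1 + q)) * h1
        + (9 * w ^ 4 + 15 * (q - 1) * w ^ 2 + 4 * (1 - q) ^ 2) * hw
    have : 0 < (1 - 4 * q) * (q + 2) ^ 2 := by positivity
    rw [← e] at this
    have := pos_of_mul_pos_right this (by positivity)
    linarith

/-- `hd` makes the `2 * 3 ^ m` real roots of `Q ^ 2 - 1` simple, so some non-root `a` has exactly `2
* j` of them to its right. The even count makes `Q ^ 2 - 1` positive at `a`. The counts for `Q - 1`
and `Q + 1` differ by at most one and sum to `2 * j`, so both are `j`. -/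
lemma exists_one_lt_and_cnt_eq {p : ℝ} (hp : p ∈ Set.Ioo (0 : ℝ) 1) {n : ℕ} {v : ℕ → ℝ}
    (hv : BlockSymmetric n v) {m : ℕ} (hm : n ≤ m)
    (hd : ∀ t, |(phi p v (3 ^ m)).eval t| ≤ 1 → (derivative (phi p v (3 ^ m))).eval t ≠ 0)
    {j : ℕ} (hj : j ≤ 3 ^ m) :
    ∃ a, 1 < |(phi p v (3 ^ m)).eval a| ∧ cnt (phi p v (3 ^ m) - C 1) a = j := by
  have hA := splits_phi_pow_sub_one hp hv hm
  have hB := splits_phi_pow_add_one hp hv hm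
  have hdA := natDegree_phi_pow_sub_C hp v m 1
  have hdB := natDegree_phi_pow_sub_C hp v m (-1)
  have hlA := leadingCoeff_phi_pow_sub_C_pos hp v m 1
  have hlB := leadingCoeff_phi_pow_sub_C_pos hp v m (-1)
  have hpos : 3 ^ m ≠ 0 := by positivity
  set Q := phi p v (3 ^ m)
  set F := (Q - C 1) * (Q - C (-1)) with hF
  have hlF : 0 < F.leadingCoeff := by
    rw [leadingCoeff_mul]
    exact mul_pos hlA hlB
  have hF0 : F ≠ 0 := leadingCoeff_ne_zero.mp hlF.ne'
  have heval : ∀ t, F.eval t = Q.eval t ^ 2 - 1 := fun t => by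
    simp only [hF, eval_mul, eval_sub, eval_C]
    ring
  have hderiv : ∀ t, (derivative F).eval t = 2 * Q.eval t * (derivative Q).eval t := fun t => by
    simp only [hF, derivative_mul, derivative_sub, derivative_C, eval_add, eval_mul, eval_sub,
      eval_C, sub_zero]
    ring
  have hnodup : F.roots.Nodup := by
    rw [Multiset.nodup_iff_count_le_one]
    intro t
    rw [count_roots]
    by_contra! h
    obtain ⟨h1, h2⟩ := (one_lt_rootMultiplicity_iff_isRoot hF0).mp h
    rw [IsRoot, heval, sub_eq_zero] at h1
    rw [IsRoot, hderiv] at h2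
    refine mul_ne_zero (mul_ne_zero two_ne_zero fun h => ?_)
      (hd t ((sq_le_one_iff_abs_le_one _).mp h1.le)) h2
    simp [h] at h1
  have hcard : F.roots.card = 2 * 3 ^ m := by
    rw [← (hA.mul hB).natDegree_eq_card_roots, natDegree_mul, hdA, hdB, two_mul]
    · exact leadingCoeff_ne_zero.mp hlA.ne'
    · exact leadingCoeff_ne_zero.mp hlB.ne'
  obtain ⟨a, ha, hcnt⟩ := exists_notMem_card_filter_le_eq ⟨F.roots, hnodup⟩ (k := 2 * j)
    (by rw [Finset.card_mk, hcard]; omega)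
  have hcF : cnt F a = 2 * j := hcnt
  have hFa : F.eval a ≠ 0 := fun h => ha ((mem_roots hF0).mpr h)
  have hsign := neg_one_pow_cnt_mul_eval_pos (hA.mul hB) hlF hFa
  rw [← hF, hcF, pow_mul, neg_one_sq, one_pow, one_mul, heval] at hsign
  refine ⟨a, (one_lt_sq_iff_one_lt_abs _).mp (by linarith), ?_⟩
  have h1 := cnt_derivative_bounds hA (by rw [hdA]; exact hpos) a
  have h2 := cnt_derivative_bounds hB (by rw [hdB]; exact hpos) a
  rw [derivative_sub, derivative_C, sub_zero] at h1 h2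
  rw [hF, cnt_mul hF0] at hcF
  omega

/-- For `p = 1/2` the decimation polynomial maps `[-1, 1]` into itself. -/
lemma one_lt_abs_phi_pow_of_half {n : ℕ} {v : ℕ → ℝ} (hv : BlockSymmetric n v) {m : ℕ}
    (hm : n ≤ m) {s : ℝ} (h : 1 < |(phi (1 / 2) v (3 ^ m)).eval s|) :
    1 < |(phi (1 / 2) v (3 ^ n)).eval s| := by
  have hp : (1 / 2 : ℝ) ∈ Set.Ioo (0 : ℝ) 1 := by norm_num
  induction m, hm using Nat.le_induction with
  | base => exact h
  | succ m hm ih =>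
    refine ih ?_
    contrapose! h
    have h1 := eval_phi_pow_succ hp hv hm s
    set w := (phi (1 / 2) v (3 ^ m)).eval s
    -- Chebyshev: `1 - (4 w ^ 3 - 3 w) ^ 2 = (1 - w ^ 2) (1 - 4 w ^ 2) ^ 2`.
    have e : (phi (1 / 2) v (3 ^ (m + 1))).eval s = 4 * w ^ 3 - 3 * w := by linarith
    rw [← sq_le_one_iff_abs_le_one] at h ⊢
    rw [e]
    have : 0 ≤ (1 - w ^ 2) * (1 - 4 * w ^ 2) ^ 2 := mul_nonneg (by linarith) (sq_nonneg _)
    linarith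

/-- The hypothesis `hpm` lets one lemma serve both cases: for `p = 1/2` only level `0` is used, with
labels `0` and `1`. -/
lemma mem_gapLabels_laplacian {p : ℝ} (hp : p ∈ Set.Ioo (0 : ℝ) 1) {π : Measure ℕ}
    [SigmaFinite π] (hπ : IsReversible p π) {ν : Measure ℝ}
    (hν : ∀ m, 0 ≤ m → ∀ x : ℝ, 1 < |(phi p (fun _ => 1) (3 ^ m)).eval (-x)| →
      ν.real (Set.Iic x) = cnt (phi p (fun _ => 1) (3 ^ m) - C 1) (-x) / 3 ^ m)
    {m : ℕ} (hpm : p = 1 / 2 → m = 0) {j : ℕ} (hj : j ≤ 3 ^ m) :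
    (j : ℝ) / 3 ^ m ∈ gapLabels (laplacian hp hπ) ν := by
  obtain ⟨a, ha, hc⟩ := exists_one_lt_and_cnt_eq hp (blockSymmetric_const 1) m.zero_le
    (fun t => derivative_phi_pow_ne_zero hp (blockSymmetric_const 1) hpm) hj
  rw [← neg_neg a] at ha hc
  exact ⟨-a, mem_resolventSet_laplacian hp hπ ha, by rw [hν m m.zero_le _ ha, hc]⟩

theorem gapLabels_laplacian_of_ne_half {p : ℝ} (hp : p ∈ Set.Ioo (0 : ℝ) 1) (hp2 : p ≠ 1 / 2)
    {π : Measure ℕ} [SigmaFinite π] (hπ : IsReversible p π) {ν : Measure ℝ}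
    (hν : ∀ m, 0 ≤ m → ∀ x : ℝ, 1 < |(phi p (fun _ => 1) (3 ^ m)).eval (-x)| →
      ν.real (Set.Iic x) = cnt (phi p (fun _ => 1) (3 ^ m) - C 1) (-x) / 3 ^ m) :
    gapLabels (laplacian hp hπ) ν = {r : ℝ | ∃ i j : ℕ, j ≤ 3 ^ i ∧ r = (j : ℝ) / 3 ^ i} := by
  ext r
  constructor
  · rintro ⟨x, hx, rfl⟩
    obtain ⟨m, hm, h⟩ := exists_one_lt_of_mem_resolventSet hp hπ (blockSymmetric_const 1) hx
    exact ⟨m, _, by exact_mod_cast cnt_phi_pow_le hp _ m 1 (-x), hν m hm x h⟩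
  · rintro ⟨m, j, hj, rfl⟩
    exact mem_gapLabels_laplacian hp hπ hν (fun h => absurd h hp2) hj

theorem gapLabels_laplacian_of_eq_half {p : ℝ} (hp : p ∈ Set.Ioo (0 : ℝ) 1) (hp2 : p = 1 / 2) {π : Measure ℕ}
    [SigmaFinite π] (hπ : IsReversible p π) {ν : Measure ℝ}
    (hν : ∀ m, 0 ≤ m → ∀ x : ℝ, 1 < |(phi p (fun _ => 1) (3 ^ m)).eval (-x)| →
      ν.real (Set.Iic x) = cnt (phi p (fun _ => 1) (3 ^ m) - C 1) (-x) / 3 ^ m) :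
    gapLabels (laplacian hp hπ) ν = {0, 1} := by
  ext r
  constructor
  · rintro ⟨x, hx, rfl⟩
    obtain ⟨m, hm, h⟩ := exists_one_lt_of_mem_resolventSet hp hπ (blockSymmetric_const 1) hx
    subst hp2
    have h0 := one_lt_abs_phi_pow_of_half (blockSymmetric_const 1) hm h
    have hc := cnt_phi_pow_le hp (fun _ => 1) 0 1 (-x)
    rw [hν 0 le_rfl x h0]
    simp only [pow_zero, div_one] at hc ⊢
    have hc' : cnt (phi (1 / 2) (fun _ => 1) 1 - C 1) (-x) ≤ 1 := by exact_mod_cast hc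
    interval_cases cnt (phi (1 / 2) (fun _ => 1) 1 - C 1) (-x) <;> simp
  · intro hr
    obtain ⟨j, hj, rfl⟩ : ∃ j : ℕ, j ≤ 3 ^ 0 ∧ r = j := by
      rcases hr with rfl | rfl
      exacts [⟨0, by simp, by simp⟩, ⟨1, by simp, by simp⟩]
    simpa using mem_gapLabels_laplacian hp hπ hν (fun _ => rfl) hj

/-- Escape at level `n + d` gives a label `c / 3 ^ (n + d)`; dividing `c` by `3 ^ d` leaves a
remainder whose quotient by `3 ^ d` is a label of the Laplacian. For `p = 1/2` one may take `d = 0`.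
-/
theorem gapLabels_jacobiOp_subset {p : ℝ} (hp : p ∈ Set.Ioo (0 : ℝ) 1) {π : Measure ℕ}
    [SigmaFinite π] (hπ : IsReversible p π) {μ ν : Measure ℝ}
    (hμ : ∀ m, 0 ≤ m → ∀ x : ℝ, 1 < |(phi p (fun _ => 1) (3 ^ m)).eval (-x)| →
      μ.real (Set.Iic x) = cnt (phi p (fun _ => 1) (3 ^ m) - C 1) (-x) / 3 ^ m)
    {n : ℕ} {v : ℕ → ℝ} {hvb : ∃ C, ∀ x, |v x| ≤ C} (hv : BlockSymmetric n v)
    (hν : ∀ m, n ≤ m → ∀ x : ℝ, 1 < |(phi p v (3 ^ m)).eval (-x)| →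
      ν.real (Set.Iic x) = cnt (phi p v (3 ^ m) - C 1) (-x) / 3 ^ m) :
    gapLabels (jacobiOp hp hπ v hvb) ν ⊆ {r : ℝ | ∃ j : ℕ, j < 3 ^ n ∧
      ∃ g ∈ gapLabels (laplacian hp hπ) μ, r = (j : ℝ) / 3 ^ n + 1 / 3 ^ n * g} := by
  rintro _ ⟨x, hx, rfl⟩
  obtain ⟨d, hpd, h⟩ : ∃ d, (p = 1 / 2 → d = 0) ∧ 1 < |(phi p v (3 ^ (n + d))).eval (-x)| := by
    obtain ⟨m, hm, h⟩ := exists_one_lt_of_mem_resolventSet hp hπ hv hx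
    by_cases hp2 : p = 1 / 2
    · subst hp2
      exact ⟨0, fun _ => rfl, one_lt_abs_phi_pow_of_half hv hm h⟩
    · obtain ⟨d, rfl⟩ := Nat.exists_eq_add_of_le hm
      exact ⟨d, fun h => absurd h hp2, h⟩
  rw [hν _ (Nat.le_add_right n d) x h]
  have hc : cnt (phi p v (3 ^ (n + d)) - C 1) (-x) ≤ 3 ^ n * 3 ^ d := by
    rw [← pow_add]
    exact_mod_cast cnt_phi_pow_le hp v (n + d) 1 (-x)
  generalize cnt (phi p v (3 ^ (n + d)) - C 1) (-x) = c at hc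
  have h3n : 0 < 3 ^ n := by positivity
  have h3d : 0 < 3 ^ d := by positivity
  -- For the maximal count `c = 3 ^ (n + d)` the Euclidean quotient would be `3 ^ n`, out of range.
  -- It is written instead with `j = 3 ^ n - 1` and `r = 3 ^ d`, that is, with Laplacian label `1`.
  obtain ⟨j, r, hj, hr, rfl⟩ : ∃ j r : ℕ, j < 3 ^ n ∧ r ≤ 3 ^ d ∧ c = 3 ^ d * j + r := by
    rcases hc.eq_or_lt with rfl | hlt
    · obtain ⟨y, hy⟩ := Nat.exists_eq_succ_of_ne_zero h3n.ne'
      exact ⟨y, 3 ^ d, by omega, le_rfl, by rw [hy, Nat.succ_eq_add_one]; ring⟩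
    · exact ⟨c / 3 ^ d, c % 3 ^ d, Nat.div_lt_of_lt_mul (by rwa [mul_comm]),
        (Nat.mod_lt _ h3d).le, (Nat.div_add_mod _ _).symm⟩
  refine ⟨j, hj, r / 3 ^ d, mem_gapLabels_laplacian hp hπ hμ hpd hr, ?_⟩
  push_cast
  rw [pow_add]
  field_simp

end

end SelfSimilarAMO

theorem corollary4p5 (p : ℝ) (hp : p ∈ Set.Ioo (0 : ℝ) 1) (β : ℝ) (n : ℕ) (hn : 1 ≤ n)
    (k : ℕ) (hk : k < 3 ^ n) (π : MeasureTheory.Measure ℕ) [MeasureTheory.SigmaFinite π]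
    (hπ : SelfSimilarAMO.IsReversible p π) :
    ∃ νΔ νH : MeasureTheory.Measure ℝ,
      SelfSimilarAMO.IsDensityOfStates (SelfSimilarAMO.finiteLaplacian p) νΔ ∧
      SelfSimilarAMO.IsDensityOfStates
        (SelfSimilarAMO.finiteAlmostMathieu p β ((k : ℝ) / 3 ^ n) 0) νH ∧
      SelfSimilarAMO.gapLabels (SelfSimilarAMO.almostMathieu hp hπ β ((k : ℝ) / 3 ^ n) 0) νH ⊆
        {r : ℝ | ∃ j : ℕ, j < 3 ^ n ∧
          ∃ g ∈ SelfSimilarAMO.gapLabels (SelfSimilarAMO.laplacian hp hπ) νΔ,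
            r = (j : ℝ) / 3 ^ n + 1 / 3 ^ n * g} ∧
      (p = 1 / 2 → SelfSimilarAMO.gapLabels (SelfSimilarAMO.laplacian hp hπ) νΔ = {0, 1}) ∧
      (p ≠ 1 / 2 → SelfSimilarAMO.gapLabels (SelfSimilarAMO.laplacian hp hπ) νΔ =
        {r : ℝ | ∃ i j : ℕ, j ≤ 3 ^ i ∧ r = (j : ℝ) / 3 ^ i}) := by
  obtain ⟨μ, hμ, hμ'⟩ :=
    SelfSimilarAMO.exists_isDensityOfStates hp (SelfSimilarAMO.blockSymmetric_const 1)
  have hv := SelfSimilarAMO.blockSymmetric_potential β n k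
  obtain ⟨ν, hν, hν'⟩ := SelfSimilarAMO.exists_isDensityOfStates hp hv
  exact ⟨μ, ν, hμ, hν, SelfSimilarAMO.gapLabels_jacobiOp_subset hp hπ hμ' hv hν',
    fun h => SelfSimilarAMO.gapLabels_laplacian_of_eq_half hp h hπ hμ',
    fun h => SelfSimilarAMO.gapLabels_laplacian_of_ne_half hp h hπ hμ'⟩
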